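/- Let $d\in\{2,3\}$ and let $\Omega\subset\mathbb{R}^d$ be a polyhedral domain: a nonempty connected open set that is the interior of its closure and whose closure is a finite union of convex polytopes. Let $\ell\ge 1$, and let $K$ be a continuous (in particular, any smooth) symmetric positive definite $d\times d$ matrix function on $\overline\Omega$. For a conforming simplicial triangulation $\mathcal{T}_h$ of $\Omega$ let $$V_h=\{v\in H(\mathrm{div};\Omega): v|_T\in [P_\ell(T)]^d+x\,P_\ell(T)\ \ \forall\,T\in\mathcal{T}_h\}$$ be the Raviart–Thomas–Nédélec space of order $\ell$, and let $Q_h$ be the space of discontinuous piecewise $P_\ell$ functions. Let $\mathcal{S}_h$ be the set of the sides (edges for $d=2$, faces for $d=3$) of the elements, let $h_\sigma$ be the diameter and $n_\sigma$ a unit normal of the side $\sigma$, and let $[\![q]\!]=\sum_{T\supset\sigma}q|_T\,n_{T,\sigma}$ be the jump of $q$ across $\sigma$, where $T$ runs over the one or two elements having $\sigma$ as a side and $n_{T,\sigma}$ is the outward unit normal of $T$ on $\sigma$. Put $$\|v\|_{L_2(\Omega;\mathcal{T}_h)}^2=\sum_{T\in\mathcal{T}_h}\|v\|_{L_2(T)}^2+\sum_{\sigma\in\mathcal{S}_h}h_\sigma\|v\cdot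 n_\sigma\|_{L_2(\sigma)}^2,\qquad \|q\|_{H^1(\Omega;\mathcal{T}_h)}^2=\sum_{T\in\mathcal{T}_h}\|\nabla q\|_{L_2(T)}^2+\sum_{\sigma\in\mathcal{S}_h}\frac1{h_\sigma}\|[\![q]\!]\|_{L_2(\sigma)}^2,$$ $$a(w,v)=\int_\Omega (K^{-1}w)\cdot v\,dx,\qquad b(v,q)=-\int_\Omega(\mathrm{div}\,v)\,q\,dx,\qquad \mathcal{B}((v,q),(w,r))=a(v,w)+b(w,q)+b(v,r).$$ For $\gamma\in\mathbb{R}$ call $\mathcal{T}_h$ $\gamma$-shape regular if every $T\in\mathcal{T}_h$ contains a ball of some radius $\rho>0$ with $\mathrm{diam}\,T\le\gamma\rho$. Then the following hold for every $\gamma$ (all suprema are finite and taken over the elements with nonzero denominator). 1. (Inf-sup condition.) There are constants $c,C>0$ depending only on $\Omega$, $\ell$ and $\gamma$ such that for every $\gamma$-shape regular triangulation $\mathcal{T}_h$ of $\Omega$ and every $q\in Q_h$, $$c\,\|q\|_{H^1(\Omega;\mathcal{T}_h)}\le\sup_{v\in V_h}\frac{b(v,q)}{\|v\|_{L_2(\Omega;\mathcal{T}_h)}}\le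 C\,\|q\|_{H^1(\Omega;\mathcal{T}_h)}.$$ 2. (Stability estimate.) There are constants $c,C>0$ depending only on $\Omega$, $K$, $\ell$ and $\gamma$ such that for every $\gamma$-shape regular triangulation $\mathcal{T}_h$ of $\Omega$ and every $(v,q)\in V_h\times Q_h$, $$c\,\big(\|v\|_{L_2(\Omega;\mathcal{T}_h)}+\|q\|_{H^1(\Omega;\mathcal{T}_h)}\big)\le\sup_{(w,r)\in V_h\times Q_h}\frac{\mathcal{B}((v,q),(w,r))}{\|w\|_{L_2(\Omega;\mathcal{T}_h)}+\|r\|_{H^1(\Omega;\mathcal{T}_h)}}\le C\,\big(\|v\|_{L_2(\Omega;\mathcal{T}_h)}+\|q\|_{H^1(\Omega;\mathcal{T}_h)}\big).$$ -/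

import Mathlib

open MeasureTheory
open scoped ContDiff

namespace DarcyRT

noncomputable section

/-- The Euclidean space `ℝ^d`. -/
abbrev Euc (d : ℕ) : Type := EuclideanSpace ℝ (Fin d)

/-! ### Polyhedral domains and simplicial triangulations -/

/-- A polyhedral domain: a connected, nonempty open set that is the interior of its closure (it has
no slits), and whose closure is a finite union of convex polytopes (hence compact). -/
structure IsPolyhedralDomain {d : ℕ} (Ω : Set (Euc d)) : Prop where
  isOpen : IsOpen Ω
  isConnected : IsConnected Ω
  interior_closure : interior (closure Ω) = Ω
  polyhedral : ∃ P : Finset (Finset (Euc d)),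
    closure Ω = ⋃ s ∈ P, convexHull ℝ (s : Set (Euc d))

/-- A simplicial triangulation of `Ω`: a finite (conforming) simplicial complex all of whose faces
are faces of `d`-dimensional simplices, and whose underlying space is the closure of `Ω`. -/
structure Triangulation {d : ℕ} (Ω : Set (Euc d)) extends
    Geometry.SimplicialComplex ℝ (Euc d) where
  finite_faces : faces.Finite
  pure_dim : ∀ s ∈ faces, ∃ T ∈ faces, s ⊆ T ∧ T.card = d + 1
  space_eq : toSimplicialComplex.space = closure Ω

/-- The closed simplex with the given vertices. -/
abbrev cell {d : ℕ} (s : Finset (Euc d)) : Set (Euc d) := convexHull ℝ (s : Set (Euc d))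

namespace Triangulation

variable {d : ℕ} {Ω : Set (Euc d)} (𝒯 : Triangulation Ω)

/-- The elements of the triangulation (each given by its set of `d + 1` vertices). -/
def elements : Finset (Finset (Euc d)) := {s ∈ 𝒯.finite_faces.toFinset | s.card = d + 1}

/-- The sides of the elements: edges for `d = 2`, faces for `d = 3`. -/
def sides : Finset (Finset (Euc d)) := {s ∈ 𝒯.finite_faces.toFinset | s.card = d}

/-- Shape regularity: every element `T` contains a ball whose radius `ρ` satisfies
`diam T ≤ γ ρ`. -/
def ShapeRegular (γ : ℝ) : Prop :=
  ∀ T ∈ 𝒯.elements, ∃ x : Euc d, ∃ ρ : ℝ, 0 < ρ ∧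
    Metric.closedBall x ρ ⊆ cell T ∧ Metric.diam (cell T) ≤ γ * ρ

end Triangulation

/-- `n` is the unit normal of the side `σ` pointing towards the outside of the simplex `T`. -/
def IsOutwardUnitNormal {d : ℕ} (T σ : Finset (Euc d)) (n : Euc d) : Prop :=
  ‖n‖ = 1 ∧ (∀ x ∈ σ, ∀ y ∈ σ, inner ℝ n (y - x) = 0) ∧
    ∀ x ∈ σ, ∀ p ∈ T, p ∉ σ → inner ℝ n (p - x) < 0

/-- The unit normal of the side `σ` pointing towards the outside of `T`. -/
def outwardNormal {d : ℕ} (T σ : Finset (Euc d)) : Euc d :=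
  Classical.epsilon (IsOutwardUnitNormal T σ)

/-- The restriction `f|_T`, extended by continuity from the interior of `T` to the closed
simplex `T`. -/
def trace {d : ℕ} {F : Type*} [TopologicalSpace F] (T : Finset (Euc d)) (f : Euc d → F) :
    Euc d → F :=
  extendFrom (interior (cell T)) f

/-! ### The space `H(div; Ω)` -/

/-- `g` is the divergence of `v` on `Ω` in the sense of distributions. -/
def HasWeakDiv {d : ℕ} (Ω : Set (Euc d)) (v : Euc d → Euc d) (g : Euc d → ℝ) : Prop :=
  ∀ φ : Euc d → ℝ, ContDiff ℝ ∞ φ → HasCompactSupport φ → tsupport φ ⊆ Ω →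
    ∫ x in Ω, inner ℝ (v x) (gradient φ x) = -∫ x in Ω, g x * φ x

/-- `v ∈ H(div; Ω)`: both `v` and its weak divergence are square integrable on `Ω`. -/
def MemHDiv {d : ℕ} (Ω : Set (Euc d)) (v : Euc d → Euc d) : Prop :=
  MemLp v 2 (volume.restrict Ω) ∧
    ∃ g : Euc d → ℝ, MemLp g 2 (volume.restrict Ω) ∧ HasWeakDiv Ω v g

/-- The weak divergence of `v ∈ H(div; Ω)` (unique up to a null set). -/
def weakDiv {d : ℕ} (Ω : Set (Euc d)) (v : Euc d → Euc d) : Euc d → ℝ :=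
  Classical.epsilon fun g => MemLp g 2 (volume.restrict Ω) ∧ HasWeakDiv Ω v g

/-! ### The finite element spaces -/

/-- The restriction of `q` to the interior of the simplex `T` is a polynomial of degree at
most `ℓ`. -/
def IsPolyOn {d : ℕ} (ℓ : ℕ) (T : Finset (Euc d)) (q : Euc d → ℝ) : Prop :=
  ∃ p : MvPolynomial (Fin d) ℝ, p.totalDegree ≤ ℓ ∧
    ∀ x ∈ interior (cell T), q x = MvPolynomial.eval (fun i => x i) p

/-- The restriction of `v` to the interior of the simplex `T` belongs to the local
Raviart–Thomas–Nédélec space `[P_ℓ]^d + x P_ℓ` of order `ℓ`. -/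
def IsRTOn {d : ℕ} (ℓ : ℕ) (T : Finset (Euc d)) (v : Euc d → Euc d) : Prop :=
  ∃ (P : Fin d → MvPolynomial (Fin d) ℝ) (s : MvPolynomial (Fin d) ℝ),
    (∀ i, (P i).totalDegree ≤ ℓ) ∧ s.totalDegree ≤ ℓ ∧
    ∀ x ∈ interior (cell T), ∀ i,
      v x i = MvPolynomial.eval (fun j => x j) (P i) + x i * MvPolynomial.eval (fun j => x j) s

namespace Triangulation

variable {d : ℕ} {Ω : Set (Euc d)} (𝒯 : Triangulation Ω)

/-- The Raviart–Thomas–Nédélec space `V_h ⊂ H(div; Ω)` of order `ℓ`. Its members are functions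
defined everywhere; their values outside the interiors of the elements are irrelevant. -/
def V (ℓ : ℕ) : Set (Euc d → Euc d) := {v | MemHDiv Ω v ∧ ∀ T ∈ 𝒯.elements, IsRTOn ℓ T v}

/-- The space `Q_h` of discontinuous piecewise polynomials of degree at most `ℓ`. -/
def Q (ℓ : ℕ) : Set (Euc d → ℝ) := {q | ∀ T ∈ 𝒯.elements, IsPolyOn ℓ T q}

/-! ### Mesh-dependent norms -/

/-- The normal component `v · n_σ` on the side `σ`, computed from an element `T` having `σ` as a
side; for `v ∈ V_h` it is, up to sign, independent of the choice of `T`. -/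
def normalTrace (σ : Finset (Euc d)) (v : Euc d → Euc d) (x : Euc d) : ℝ :=
  let T := Classical.epsilon fun T : Finset (Euc d) => T ∈ 𝒯.elements ∧ σ ⊆ T
  inner ℝ (trace T v x) (outwardNormal T σ)

open Classical in
/-- The (vector valued) jump of `q` across the side `σ`: the sum of `q|_T n_{σ,T}` over the elements
`T` having `σ` as a side (two elements if `σ` is interior, one if `σ` lies on the boundary). -/
def jump (σ : Finset (Euc d)) (q : Euc d → ℝ) (x : Euc d) : Euc d :=
  ∑ T ∈ 𝒯.elements with σ ⊆ T, trace T q x • outwardNormal T σ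

/-- The norm `‖v‖_{L₂(Ω;T_h)}`; the sides carry the `(d-1)`-dimensional surface measure. -/
def normL2 (v : Euc d → Euc d) : ℝ :=
  √(∑ T ∈ 𝒯.elements, (∫ x in interior (cell T), ‖v x‖ ^ 2) +
    ∑ σ ∈ 𝒯.sides, Metric.diam (cell σ) * ∫ x in cell σ, 𝒯.normalTrace σ v x ^ 2 ∂μHE[d - 1])

/-- The norm `‖q‖_{H¹(Ω;T_h)}`. -/
def normH1 (q : Euc d → ℝ) : ℝ :=
  √(∑ T ∈ 𝒯.elements, (∫ x in interior (cell T), ‖gradient q x‖ ^ 2) +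
    ∑ σ ∈ 𝒯.sides, (1 / Metric.diam (cell σ)) * ∫ x in cell σ, ‖𝒯.jump σ q x‖ ^ 2 ∂μHE[d - 1])

end Triangulation

/-! ### The bilinear forms -/

/-- `a(w, v) = ∫_Ω (K⁻¹ w) · v dx`. -/
def aForm {d : ℕ} (Ω : Set (Euc d)) (K : Euc d → Matrix (Fin d) (Fin d) ℝ)
    (w v : Euc d → Euc d) : ℝ :=
  ∫ x in Ω, inner ℝ (Matrix.toEuclideanLin (K x)⁻¹ (w x)) (v x)

/-- `b(v, q) = -∫_Ω (div v) q dx`. -/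
def bForm {d : ℕ} (Ω : Set (Euc d)) (v : Euc d → Euc d) (q : Euc d → ℝ) : ℝ :=
  -∫ x in Ω, weakDiv Ω v x * q x

/-- `B((v, q), (w, r)) = a(v, w) + b(w, q) + b(v, r)`. -/
def BForm {d : ℕ} (Ω : Set (Euc d)) (K : Euc d → Matrix (Fin d) (Fin d) ℝ)
    (v : Euc d → Euc d) (q : Euc d → ℝ) (w : Euc d → Euc d) (r : Euc d → ℝ) : ℝ :=
  aForm Ω K v w + bForm Ω w q + bForm Ω v r

end

end DarcyRT

open DarcyRT

/-! On each element `v` is a polynomial field and `q` a polynomial. Green's formula on the elements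
gives `b(v,q) = ∑_T ∫_T v·∇q - ∑_σ ∫_σ (v·n_σ)⟦q⟧` (`bForm_eq`), because a field in `H(div)` has a
single-valued normal component. The weights `h_σ` and `1/h_σ` of the two norms are dual to each
other, so the Cauchy–Schwarz inequality bounds `b` with constant one (`abs_bBroken_le`).

The lower bound in the inf-sup condition comes from an explicit test field. A field `∑_p c_p(x)(p -
x)`, summed over the vertices of `T`, is locally Raviart–Thomas if `c_p ∈ P_ℓ`, and on the side
opposite to `p` its outward normal component is `-h_p c_p`, with `h_p` the height above that side.
One choice of the `c_p` yields `jumpLift`, with normal component `-⟦q⟧/h_σ` on every side. The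
choice `c_p = λ_p ⟨p - z, ∇q⟩ / diam² T` yields `gradLift`, with no normal component at all; its
product with `∇q` is a sum of squares weighted by the `λ_p λ_q` and controls `‖∇q‖²`. In `jumpLift +
M • gradLift` a large `M` absorbs the cross term (`exists_infsup_field`).

The constants are uniform without passing to a reference element. An integral over a simplex is
written along the rays from a vertex (`integral_cell`), one inequality for univariate polynomials is
applied on every ray, and what remains are quotients of diameters, heights and inradii, bounded by
shape regularity.

For the stability estimate, `a` is coercive in `L²`, and a discrete trace inequality
(`exists_fluxSq_le`) makes it coercive in the mesh-dependent norm on all of `V_h`, not only on the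
kernel of `b`. Testing with `(v + δ v', -q)`, where `v'` is the inf-sup field of `q`, cancels
`b(v,q)`; a small `δ` absorbs `δ a(v,v')` (`exists_stability`). -/

namespace DarcyRT

/-! ### Norm equivalence for univariate polynomials -/

/-- The quotient `Ψ / Φ` is invariant under scaling and continuous on the compact unit sphere, hence
bounded. -/
theorem exists_le_mul_of_homogeneous {n : ℕ} {Φ Ψ : (Fin n → ℝ) → ℝ} (hΦ : Continuous Φ)
    (hΨ : Continuous Ψ) (hΦs : ∀ (r : ℝ) a, Φ (r • a) = r ^ 2 * Φ a)
    (hΨs : ∀ (r : ℝ) a, Ψ (r • a) = r ^ 2 * Ψ a) (hpos : ∀ a, a ≠ 0 → 0 < Φ a) :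
    ∃ C : ℝ, 0 < C ∧ ∀ a, Ψ a ≤ C * Φ a := by
  have hc : IsCompact (Metric.sphere (0 : Fin n → ℝ) 1) := isCompact_sphere _ _
  have hne : ∀ a ∈ Metric.sphere (0 : Fin n → ℝ) 1, a ≠ 0 := by
    rintro a ha rfl
    simp at ha
  obtain ⟨B, hB⟩ := hc.bddAbove_image (f := fun a => Ψ a / Φ a)
    (hΨ.continuousOn.div hΦ.continuousOn fun a ha => (hpos a (hne a ha)).ne')
  -- `B` is only an upper bound and may be negative or arbitrary (for `n = 0` the sphere is empty);
  -- the maximum with 1 makes the constant positive.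
  refine ⟨max B 1, by positivity, fun a => ?_⟩
  rcases eq_or_ne a 0 with rfl | ha
  · have h1 := hΦs 0 0
    have h2 := hΨs 0 0
    simp at h1 h2
    simp [h1, h2]
  have hn : 0 < ‖a‖ := norm_pos_iff.2 ha
  set b := ‖a‖⁻¹ • a with hb
  have hbs : b ∈ Metric.sphere (0 : Fin n → ℝ) 1 := by
    simp [hb, norm_smul, hn.ne']
  have hab : a = ‖a‖ • b := by simp [hb, smul_smul, hn.ne']
  have h1 : Ψ b / Φ b ≤ B := hB ⟨b, hbs, rfl⟩
  have hb0 := hpos b (hne b hbs)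
  have h2 : Ψ b ≤ max B 1 * Φ b :=
    ((div_le_iff₀ hb0).1 h1).trans (mul_le_mul_of_nonneg_right (le_max_left _ _) hb0.le)
  rw [hab, hΦs, hΨs]
  nlinarith [mul_le_mul_of_nonneg_left h2 (sq_nonneg ‖a‖)]

/-- Polynomials of degree at most `m` form a finite-dimensional space on which the weighted integral
is a positive definite quadratic form. On a ray from a vertex `p` of a simplex, `t ^ k` contains the
Jacobian of the conical coordinates, `1 - t` is the barycentric coordinate of `p`, and `t = 1` lies
on the opposite side. -/
theorem exists_polynomial_weighted_bound (k m : ℕ) :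
    ∃ C : ℝ, 0 < C ∧ ∀ P : Polynomial ℝ, P.natDegree ≤ m →
      P.eval 1 ^ 2 ≤ C * ∫ t in (0 : ℝ)..1, t ^ k * (1 - t) * P.eval t ^ 2 ∧
      ∫ t in (0 : ℝ)..1, t ^ k * P.eval t ^ 2 ≤
        C * ∫ t in (0 : ℝ)..1, t ^ k * (1 - t) * P.eval t ^ 2 := by
  let E : (Fin (m + 1) → ℝ) → ℝ → ℝ := fun a t => ∑ i, a i * t ^ (i : ℕ)
  have hE : Continuous (Function.uncurry E) := by
    simp only [E, Function.uncurry_def]; fun_prop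
  have hEs : ∀ (r : ℝ) a t, E (r • a) t = r * E a t := by
    intro r a t
    simp [E, Finset.mul_sum, mul_assoc]
  have hcont : ∀ w : ℝ → ℝ, Continuous w →
      Continuous fun a => ∫ t in (0 : ℝ)..1, w t * E a t ^ 2 := by
    intro w hw
    apply intervalIntegral.continuous_parametric_intervalIntegral_of_continuous'
    have := hE.pow 2
    simp only [Function.uncurry_def] at this ⊢
    exact (hw.comp continuous_snd).mul this
  have hsc : ∀ (w : ℝ → ℝ) (r : ℝ) a, ∫ t in (0 : ℝ)..1, w t * E (r • a) t ^ 2 =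
      r ^ 2 * ∫ t in (0 : ℝ)..1, w t * E a t ^ 2 := by
    intro w r a
    rw [← intervalIntegral.integral_const_mul]
    congr 1
    ext t
    rw [hEs]; ring
  have hpos : ∀ a, a ≠ 0 → 0 < ∫ t in (0 : ℝ)..1, (t ^ k * (1 - t)) * E a t ^ 2 := by
    intro a ha
    have hEa : Continuous (E a) := hE.comp (Continuous.prodMk_right a)
    by_contra hcon
    have hnn : ∀ t ∈ Set.Ioo (0 : ℝ) 1, 0 < t ^ k * (1 - t) := fun t ht =>
      mul_pos (pow_pos ht.1 _) (sub_pos.2 ht.2)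
    have hz : ∀ t ∈ Set.Ioo (0 : ℝ) 1, E a t = 0 := by
      intro t ht
      by_contra htz
      apply hcon
      apply intervalIntegral.integral_pos (by norm_num) (by fun_prop)
      · intro x hx
        exact mul_nonneg (mul_nonneg (pow_nonneg hx.1.le _) (sub_nonneg.2 hx.2)) (sq_nonneg _)
      · exact ⟨t, ⟨ht.1.le, ht.2.le⟩, mul_pos (hnn t ht) (by positivity)⟩
    let P : Polynomial ℝ := ∑ i : Fin (m + 1), Polynomial.monomial (i : ℕ) (a i)
    have hP : P = 0 := by
      apply Polynomial.eq_zero_of_infinite_isRoot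
      apply (Set.Ioo_infinite (zero_lt_one (α := ℝ))).mono
      intro t ht
      have := hz t ht
      simpa [P, Polynomial.IsRoot, Polynomial.eval_finsetSum, E] using this
    apply ha
    ext i
    have := congrArg (fun Q => Polynomial.coeff Q i) hP
    simpa [P, Polynomial.finsetSum_coeff, Polynomial.coeff_monomial, Fin.val_inj] using this
  obtain ⟨C₁, hC₁, h₁⟩ := exists_le_mul_of_homogeneous
    (Φ := fun a => ∫ t in (0 : ℝ)..1, (t ^ k * (1 - t)) * E a t ^ 2)
    (Ψ := fun a => E a 1 ^ 2) (hcont _ (by fun_prop))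
    ((hE.comp (Continuous.prodMk_left (1 : ℝ))).pow 2)
    (hsc _) (fun r a => by rw [hEs]; ring) hpos
  obtain ⟨C₂, hC₂, h₂⟩ := exists_le_mul_of_homogeneous
    (Φ := fun a => ∫ t in (0 : ℝ)..1, (t ^ k * (1 - t)) * E a t ^ 2)
    (Ψ := fun a => ∫ t in (0 : ℝ)..1, t ^ k * E a t ^ 2) (hcont _ (by fun_prop))
    (hcont _ (by fun_prop)) (hsc _) (hsc _) hpos
  refine ⟨max C₁ C₂, lt_max_of_lt_left hC₁, fun P hP => ?_⟩
  have hPE : ∀ t, P.eval t = E (fun i => P.coeff i) t := by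
    intro t
    rw [Polynomial.eval_eq_sum_range' (Nat.lt_succ_of_le hP), Finset.sum_range]
  have h0 : 0 ≤ ∫ t in (0 : ℝ)..1, (t ^ k * (1 - t)) * E (fun i => P.coeff i) t ^ 2 := by
    apply intervalIntegral.integral_nonneg (by norm_num)
    intro t ht
    exact mul_nonneg (mul_nonneg (pow_nonneg ht.1 _) (sub_nonneg.2 ht.2)) (sq_nonneg _)
  simp only [hPE]
  exact ⟨(h₁ _).trans (mul_le_mul_of_nonneg_right (le_max_left _ _) h0),
    (h₂ _).trans (mul_le_mul_of_nonneg_right (le_max_right _ _) h0)⟩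

/-! ### Polynomial functions on Euclidean space -/

/-- `f` is a polynomial function of total degree at most `m`. -/
def PolyLE {d : ℕ} (m : ℕ) (f : Euc d → ℝ) : Prop :=
  ∃ p : MvPolynomial (Fin d) ℝ, p.totalDegree ≤ m ∧
    ∀ x, f x = MvPolynomial.eval (fun i => x i) p

namespace PolyLE

variable {d m n : ℕ} {f g : Euc d → ℝ}

theorem mono (hf : PolyLE m f) (h : m ≤ n) : PolyLE n f :=
  let ⟨p, hp, hpf⟩ := hf
  ⟨p, hp.trans h, hpf⟩

theorem const (c : ℝ) : PolyLE m (fun _ : Euc d => c) :=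
  ⟨MvPolynomial.C c, by simp, by simp⟩

theorem coord (i : Fin d) : PolyLE 1 (fun x : Euc d => x i) :=
  ⟨MvPolynomial.X i, by simp, by simp⟩

theorem add (hf : PolyLE m f) (hg : PolyLE m g) : PolyLE m (fun x => f x + g x) := by
  obtain ⟨p, hp, hpf⟩ := hf
  obtain ⟨q, hq, hqg⟩ := hg
  exact ⟨p + q, (MvPolynomial.totalDegree_add _ _).trans (max_le hp hq), by simp [hpf, hqg]⟩

theorem mul (hf : PolyLE m f) (hg : PolyLE n g) : PolyLE (m + n) (fun x => f x * g x) := by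
  obtain ⟨p, hp, hpf⟩ := hf
  obtain ⟨q, hq, hqg⟩ := hg
  exact ⟨p * q, (MvPolynomial.totalDegree_mul _ _).trans (add_le_add hp hq), by simp [hpf, hqg]⟩

theorem const_mul (c : ℝ) (hf : PolyLE m f) : PolyLE m (fun x => c * f x) := by
  simpa using (const (m := 0) c).mul hf

theorem neg (hf : PolyLE m f) : PolyLE m (fun x => -f x) := by
  simpa using hf.const_mul (-1)

theorem sum {ι : Type*} (s : Finset ι) {f : ι → Euc d → ℝ} (hf : ∀ i ∈ s, PolyLE m (f i)) :
    PolyLE m (fun x => ∑ i ∈ s, f i x) := by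
  classical
  induction s using Finset.induction_on with
  | empty => simpa using const (d := d) (m := m) 0
  | insert a s ha ih =>
    simp only [Finset.sum_insert ha]
    exact (hf a (Finset.mem_insert_self _ _)).add
      (ih fun i hi => hf i (Finset.mem_insert_of_mem hi))

theorem inner_left (e : Euc d) : PolyLE 1 (fun x : Euc d => inner ℝ e x) := by
  simp only [PiLp.inner_apply]
  exact sum _ fun i _ => (by simpa [mul_comm] using (coord i).const_mul (e i))

/-- Affine substitutions do not raise the degree; this keeps a jump transported from a side into an
element inside `P_ℓ`. -/
theorem comp {π : Euc d → Euc d} (hf : PolyLE m f) (hπ : ∀ i, PolyLE 1 (fun x => π x i)) :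
    PolyLE m (fun x => f (π x)) := by
  obtain ⟨p, hp, hpf⟩ := hf
  choose P hP hPπ using hπ
  refine ⟨MvPolynomial.bind₁ P p, ?_, fun x => ?_⟩
  · rw [MvPolynomial.bind₁, MvPolynomial.aeval_def, MvPolynomial.eval₂_eq]
    refine MvPolynomial.totalDegree_finsetSum_le fun s hs => ?_
    refine (MvPolynomial.totalDegree_mul _ _).trans ?_
    simp only [MvPolynomial.algebraMap_eq, MvPolynomial.totalDegree_C, zero_add]
    refine (MvPolynomial.totalDegree_finsetProd _ _).trans ?_
    refine le_trans (Finset.sum_le_sum (g := fun i => s i) fun i _ => ?_)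
      ((MvPolynomial.le_totalDegree hs).trans hp)
    exact (MvPolynomial.totalDegree_pow _ _).trans (by simpa using Nat.mul_le_mul_left (s i) (hP i))
  · simp only [hpf, MvPolynomial.eval, MvPolynomial.eval₂Hom_bind₁]
    simp only [hPπ]
    rfl

/-- The passage to rays, where the univariate bounds apply. -/
theorem exists_line (hf : PolyLE m f) (x y : Euc d) :
    ∃ P : Polynomial ℝ, P.natDegree ≤ m ∧ ∀ t : ℝ, f (x + t • y) = P.eval t := by
  obtain ⟨p, hp, hpf⟩ := hf
  refine ⟨MvPolynomial.aeval (fun i => Polynomial.C (x i) + Polynomial.X * Polynomial.C (y i)) p,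
    ?_, fun t => ?_⟩
  · simpa using MvPolynomial.aeval_natDegree_le (n := 1) p hp _ fun i => by compute_degree
  · rw [hpf, ← Polynomial.coe_evalRingHom, MvPolynomial.map_aeval]
    simp only [MvPolynomial.eval, Polynomial.coe_evalRingHom]
    congr 1
    congr 1
    · ext; simp
    · ext i
      simp only [Polynomial.eval_add, Polynomial.eval_mul, Polynomial.eval_C,
        Polynomial.eval_X, PiLp.add_apply, PiLp.smul_apply, smul_eq_mul]

theorem contDiff (hf : PolyLE m f) : ContDiff ℝ ∞ f := by
  obtain ⟨p, -, hpf⟩ := hf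
  have : f = fun x : Euc d => MvPolynomial.eval (fun i => x i) p := funext hpf
  rw [this]
  clear hpf this
  induction p using MvPolynomial.induction_on with
  | C a => simpa using contDiff_const
  | add p q hp hq =>
    simp only [map_add]
    exact hp.add hq
  | mul_X p i hp =>
    simp only [map_mul, MvPolynomial.eval_X]
    exact hp.mul (by fun_prop)

theorem continuous (hf : PolyLE m f) : Continuous f := hf.contDiff.continuous

theorem _root_.MvPolynomial.totalDegree_pderiv_le {σ R : Type*} [CommSemiring R]
    (p : MvPolynomial σ R) (i : σ) :
    (MvPolynomial.pderiv i p).totalDegree ≤ p.totalDegree - 1 := by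
  classical
  conv_lhs => rw [p.as_sum]
  rw [map_sum]
  refine MvPolynomial.totalDegree_finsetSum_le fun s hs => ?_
  rw [MvPolynomial.pderiv_monomial]
  rcases Nat.eq_zero_or_pos (s i) with h | h
  · simp [h]
  · refine (MvPolynomial.totalDegree_monomial_le _ _).trans ?_
    have h1 : s = (s - Finsupp.single i 1) + Finsupp.single i 1 := by
      rw [tsub_add_cancel_of_le]
      exact Finsupp.single_le_iff.2 h
    have h2 := MvPolynomial.le_totalDegree hs
    have h3 : (s.sum fun _ e => e) = (s - Finsupp.single i 1).sum (fun _ e => e) + 1 := by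
      conv_lhs => rw [h1]
      rw [Finsupp.sum_add_index' (by simp) (by simp)]
      simp
    change (s - Finsupp.single i 1).sum (fun _ e => e) ≤ _
    omega

theorem _root_.MvPolynomial.hasFDerivAt_eval_euclidean (p : MvPolynomial (Fin d) ℝ) (x : Euc d) :
    HasFDerivAt (fun x : Euc d => MvPolynomial.eval (fun i => x i) p)
      (∑ i, MvPolynomial.eval (fun j => x j) (MvPolynomial.pderiv i p) •
        (EuclideanSpace.proj i : Euc d →L[ℝ] ℝ)) x := by
  induction p using MvPolynomial.induction_on with
  | C a => simpa using hasFDerivAt_const a x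
  | add p q hp hq =>
    simp only [map_add, add_smul, Finset.sum_add_distrib]
    exact hp.add hq
  | mul_X p i hp =>
    have h1 : HasFDerivAt (fun x : Euc d => x i) (EuclideanSpace.proj i : Euc d →L[ℝ] ℝ) x :=
      (EuclideanSpace.proj i : Euc d →L[ℝ] ℝ).hasFDerivAt
    simp only [map_mul, MvPolynomial.eval_X]
    refine (hp.mul h1).congr_fderiv ?_
    simp only [Derivation.leibniz, MvPolynomial.pderiv_X, smul_eq_mul, map_add, map_mul,
      MvPolynomial.eval_X, add_smul, Finset.sum_add_distrib, Finset.smul_sum, mul_smul]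
    congr 1
    rw [Finset.sum_eq_single i]
    · simp
    · intro j _ hj
      simp [Pi.single_eq_of_ne hj.symm]
    · simp

/-- The lost degree leaves room for a barycentric factor in front of a gradient. The truncated
subtraction is harmless: for `m = 0` the derivative is zero. -/
theorem fderiv_apply (hf : PolyLE m f) (e : Euc d) : PolyLE (m - 1) (fun x => fderiv ℝ f x e) := by
  obtain ⟨p, hp, hpf⟩ := hf
  have hf' : f = fun x : Euc d => MvPolynomial.eval (fun i => x i) p := funext hpf
  have : (fun x => fderiv ℝ f x e) = fun x : Euc d =>
      ∑ i, e i * MvPolynomial.eval (fun j => x j) (MvPolynomial.pderiv i p) := by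
    ext x
    rw [hf', (p.hasFDerivAt_eval_euclidean x).fderiv]
    simp [mul_comm]
  rw [this]
  exact sum _ fun i _ => const_mul _
    ⟨_, (p.totalDegree_pderiv_le i).trans (Nat.sub_le_sub_right hp 1), fun _ => rfl⟩

end PolyLE

end DarcyRT

namespace DarcyRT

variable {d : ℕ} {T : Finset (Euc d)} {p q : Euc d}

/-! ### Simplices and barycentric coordinates -/

/-- `T` is the vertex set of a nondegenerate `d`-simplex. -/
structure IsSimplex (T : Finset (Euc d)) : Prop where
  indep : AffineIndependent ℝ ((↑) : T → Euc d)
  card_eq : T.card = d + 1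

/-- The affine basis of the vertices of a simplex. -/
noncomputable def IsSimplex.basis (hT : IsSimplex T) : AffineBasis T ℝ (Euc d) :=
  ⟨(↑), hT.indep, by
    rw [hT.indep.affineSpan_eq_top_iff_card_eq_finrank_add_one]
    simp [hT.card_eq]⟩

open Classical in
/-- The barycentric coordinate of the vertex `p` of `T`. -/
noncomputable def bary (T : Finset (Euc d)) (p x : Euc d) : ℝ :=
  -- With the value 0 in the degenerate case, matched by `baryGrad`, the function is affine for all
  -- `T` and `p`, so the affine identities below need no hypotheses.
  if h : IsSimplex T ∧ p ∈ T then h.1.basis.coord ⟨p, h.2⟩ x else 0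

open Classical in
/-- The (constant) gradient of the barycentric coordinate of the vertex `p` of `T`. -/
noncomputable def baryGrad (T : Finset (Euc d)) (p : Euc d) : Euc d :=
  if h : IsSimplex T ∧ p ∈ T then (InnerProductSpace.toDual ℝ (Euc d)).symm
    (LinearMap.toContinuousLinearMap (h.1.basis.coord ⟨p, h.2⟩).linear) else 0

/-- The height of the simplex `T` above the side opposite to the vertex `p`. -/
noncomputable def height (T : Finset (Euc d)) (p : Euc d) : ℝ := ‖baryGrad T p‖⁻¹

theorem bary_add (T : Finset (Euc d)) (p x v : Euc d) :
    bary T p (x + v) = bary T p x + inner ℝ (baryGrad T p) v := by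
  unfold bary baryGrad
  split_ifs with h
  · rw [InnerProductSpace.toDual_symm_apply, add_comm x v, ← vadd_eq_add, AffineMap.map_vadd]
    simp [add_comm]
  · simp

theorem bary_sub (T : Finset (Euc d)) (p x y : Euc d) :
    bary T p x - bary T p y = inner ℝ (baryGrad T p) (x - y) := by
  have := bary_add T p y (x - y)
  rw [add_sub_cancel] at this
  rw [this]; ring

theorem bary_line (T : Finset (Euc d)) (p x y : Euc d) (t : ℝ) :
    bary T p (x + t • (y - x)) = (1 - t) * bary T p x + t * bary T p y := by
  rw [bary_add, inner_smul_right, ← bary_sub]; ring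

theorem polyLE_bary (T : Finset (Euc d)) (p : Euc d) : PolyLE 1 (bary T p) := by
  have : bary T p = fun x => bary T p 0 + inner ℝ (baryGrad T p) x := by
    ext x
    rw [← bary_add, zero_add]
  rw [this]
  exact (PolyLE.const _).add (PolyLE.inner_left _)

theorem continuous_bary (T : Finset (Euc d)) (p : Euc d) : Continuous (bary T p) :=
  (polyLE_bary T p).continuous

namespace IsSimplex

theorem bary_eq (hT : IsSimplex T) (hp : p ∈ T) (x : Euc d) :
    bary T p x = hT.basis.coord ⟨p, hp⟩ x := dif_pos ⟨hT, hp⟩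

theorem sum_bary (hT : IsSimplex T) (x : Euc d) : ∑ p ∈ T, bary T p x = 1 := by
  rw [← hT.basis.sum_coord_apply_eq_one x, ← Finset.sum_coe_sort]
  exact Finset.sum_congr rfl fun p _ => hT.bary_eq p.2 x

theorem sum_bary_smul (hT : IsSimplex T) (x : Euc d) : ∑ p ∈ T, bary T p x • p = x := by
  conv_rhs => rw [← hT.basis.linear_combination_coord_eq_self x]
  rw [← Finset.sum_coe_sort]
  exact Finset.sum_congr rfl fun p _ => by rw [hT.bary_eq p.2 x]; rfl

theorem bary_self (hT : IsSimplex T) (hp : p ∈ T) : bary T p p = 1 := by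
  rw [hT.bary_eq hp]
  exact hT.basis.coord_apply_eq ⟨p, hp⟩

theorem bary_of_ne (hT : IsSimplex T) (hq : q ∈ T) (hpq : p ≠ q) : bary T p q = 0 := by
  by_cases hp : p ∈ T
  · rw [hT.bary_eq hp]
    exact hT.basis.coord_apply_ne (i := ⟨p, hp⟩) (j := ⟨q, hq⟩) (by simpa using hpq)
  · exact dif_neg fun h => hp h.2

theorem range_basis (hT : IsSimplex T) : Set.range hT.basis = (T : Set (Euc d)) := by
  have : (hT.basis : T → Euc d) = (↑) := rfl
  rw [this, Subtype.range_coe]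

theorem mem_cell_iff (hT : IsSimplex T) {x : Euc d} :
    x ∈ cell T ↔ ∀ p ∈ T, 0 ≤ bary T p x := by
  have h := hT.basis.convexHull_eq_nonneg_coord
  rw [hT.range_basis] at h
  rw [cell, h]
  constructor
  · intro hx p hp
    rw [hT.bary_eq hp]
    exact hx ⟨p, hp⟩
  · rintro hx ⟨p, hp⟩
    rw [← hT.bary_eq hp]
    exact hx p hp

theorem mem_interior_iff (hT : IsSimplex T) {x : Euc d} :
    x ∈ interior (cell T) ↔ ∀ p ∈ T, 0 < bary T p x := by
  have h := hT.basis.interior_convexHull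
  rw [hT.range_basis] at h
  rw [cell, h]
  constructor
  · intro hx p hp
    rw [hT.bary_eq hp]
    exact hx ⟨p, hp⟩
  · rintro hx ⟨p, hp⟩
    rw [← hT.bary_eq hp]
    exact hx p hp

theorem mem_cell_of_subset_iff (hT : IsSimplex T) {s : Finset (Euc d)} (hs : s ⊆ T) {x : Euc d} :
    x ∈ cell s ↔ (∀ p ∈ T, 0 ≤ bary T p x) ∧ ∀ p ∈ T, p ∉ s → bary T p x = 0 := by
  constructor
  · intro hx
    refine ⟨hT.mem_cell_iff.1 (convexHull_mono (by exact_mod_cast hs) hx), fun p hp hps => ?_⟩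
    have hconv : Convex ℝ {y : Euc d | bary T p y = 0} := by
      intro y hy z hz a b ha hb hab
      have : a • y + b • z = y + b • (z - y) := by
        rw [← eq_sub_iff_add_eq] at hab
        subst hab
        module
      simp only [Set.mem_ofPred_eq] at hy hz ⊢
      rw [this, bary_line, hy, hz]; ring
    have : cell s ⊆ {y : Euc d | bary T p y = 0} := convexHull_min
      (fun q hq => hT.bary_of_ne (hs hq) (fun h => hps (h ▸ hq))) hconv
    exact this hx
  · rintro ⟨h0, hz⟩
    have h1 : ∑ p ∈ s, bary T p x = 1 := by
      rw [← hT.sum_bary x]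
      exact Finset.sum_subset hs fun p hp hps => hz p hp hps
    have h2 : ∑ p ∈ s, bary T p x • p = x := by
      conv_rhs => rw [← hT.sum_bary_smul x]
      exact Finset.sum_subset hs fun p hp hps => by rw [hz p hp hps, zero_smul]
    rw [← h2]
    exact (convex_convexHull ℝ _).sum_mem (fun p hp => h0 p (hs hp)) h1
      fun p hp => subset_convexHull ℝ _ hp

theorem mem_side_iff (hT : IsSimplex T) (hp : p ∈ T) {x : Euc d} :
    x ∈ cell (T.erase p) ↔ (∀ q ∈ T, 0 ≤ bary T q x) ∧ bary T p x = 0 := by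
  rw [hT.mem_cell_of_subset_iff (Finset.erase_subset _ _)]
  refine and_congr_right fun _ => ⟨fun h => h p hp (by simp), fun h q hq hqe => ?_⟩
  simp only [Finset.mem_erase] at hqe
  by_cases hqp : q = p
  · rwa [hqp]
  · exact absurd hq (fun _ => by simp_all)

theorem sum_inner_baryGrad (hT : IsSimplex T) (v : Euc d) :
    ∑ p ∈ T, inner ℝ (baryGrad T p) v = 0 := by
  have h1 := hT.sum_bary (0 + v)
  simp only [bary_add, Finset.sum_add_distrib, hT.sum_bary] at h1
  linarith

/-- The derivative of `x = ∑ λ_p(x) p` in the direction `v`, a resolution of the identity. -/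
theorem sum_inner_baryGrad_smul (hT : IsSimplex T) (v : Euc d) :
    ∑ p ∈ T, inner ℝ (baryGrad T p) v • p = v := by
  have h1 := hT.sum_bary_smul (0 + v)
  simp only [bary_add, add_smul, Finset.sum_add_distrib, hT.sum_bary_smul] at h1
  simpa using h1

theorem exists_mem_ne (hT : IsSimplex T) (hd : 2 ≤ d) (p : Euc d) : ∃ q ∈ T, q ≠ p :=
  T.exists_mem_ne (by rw [hT.card_eq]; omega) p

theorem baryGrad_ne_zero (hT : IsSimplex T) (hd : 2 ≤ d) (hp : p ∈ T) : baryGrad T p ≠ 0 := by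
  obtain ⟨q, hq, hqp⟩ := hT.exists_mem_ne hd p
  intro h
  have := bary_sub T p p q
  rw [hT.bary_self hp, hT.bary_of_ne hq hqp.symm, h] at this
  simp at this

theorem height_pos (hT : IsSimplex T) (hd : 2 ≤ d) (hp : p ∈ T) : 0 < height T p :=
  inv_pos.2 (norm_pos_iff.2 (hT.baryGrad_ne_zero hd hp))

/-- The gradient of `λ_p` is orthogonal to the opposite side, a level set of `λ_p`, and points
towards `p`. -/
theorem isOutwardUnitNormal (hT : IsSimplex T) (hd : 2 ≤ d) (hp : p ∈ T) :
    IsOutwardUnitNormal T (T.erase p) (-(height T p • baryGrad T p)) := by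
  have hh := hT.height_pos hd hp
  have hg := hT.baryGrad_ne_zero hd hp
  refine ⟨?_, ?_, ?_⟩
  · rw [norm_neg, norm_smul, height, norm_inv, norm_norm,
      inv_mul_cancel₀ (norm_ne_zero_iff.2 hg)]
  · intro x hx y hy
    rw [Finset.mem_erase] at hx hy
    rw [inner_neg_left, real_inner_smul_left, ← bary_sub, hT.bary_of_ne hx.2 hx.1.symm,
      hT.bary_of_ne hy.2 hy.1.symm]
    simp
  · intro x hx q hq hqe
    have hqp : q = p := by
      by_contra hne
      exact hqe (Finset.mem_erase.2 ⟨hne, hq⟩)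
    subst hqp
    rw [Finset.mem_erase] at hx
    rw [inner_neg_left, real_inner_smul_left, ← bary_sub, hT.bary_self hq,
      hT.bary_of_ne hx.2 hx.1.symm]
    simpa using hh

/-- Uniqueness is needed because `outwardNormal` is an unspecified choice. Expanding `v = ∑ ⟨∇λ_r,
v⟩ r`, all terms of `⟨n, v⟩` except that of `p` vanish, so `n` is a negative multiple of `∇λ_p`,
fixed by its length. -/
theorem eq_of_isOutwardUnitNormal (hT : IsSimplex T) (hd : 2 ≤ d) (hp : p ∈ T) {n : Euc d}
    (hn : IsOutwardUnitNormal T (T.erase p) n) : n = -(height T p • baryGrad T p) := by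
  obtain ⟨h1, h2, h3⟩ := hn
  obtain ⟨q, hq, hqp⟩ := hT.exists_mem_ne hd p
  have hqe : q ∈ T.erase p := Finset.mem_erase.2 ⟨hqp, hq⟩
  set c : ℝ := inner ℝ n (p - q) with hc
  have hc0 : c < 0 := h3 q hqe p hp (by simp)
  have key : ∀ v, inner ℝ n v = c * inner ℝ (baryGrad T p) v := by
    intro v
    have e1 : inner ℝ n v = ∑ r ∈ T, inner ℝ (baryGrad T r) v * inner ℝ n (r - q) := by
      conv_lhs => rw [← hT.sum_inner_baryGrad_smul v]
      simp only [inner_sum, inner_smul_right, inner_sub_right, mul_sub, Finset.sum_sub_distrib,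
        ← Finset.sum_mul, hT.sum_inner_baryGrad]
      simp
    rw [e1, Finset.sum_eq_single_of_mem p hp]
    · ring
    · intro r hr hrp
      rw [h2 q hqe r (Finset.mem_erase.2 ⟨hrp, hr⟩), mul_zero]
  have hn : n = c • baryGrad T p := by
    refine ext_inner_right ℝ fun v => ?_
    rw [key, real_inner_smul_left]
  have hcn : |c| * ‖baryGrad T p‖ = 1 := by
    rw [← h1, hn, norm_smul, Real.norm_eq_abs]
  rw [hn, ← neg_smul]
  congr 1
  rw [abs_of_neg hc0] at hcn
  rw [height, ← eq_inv_of_mul_eq_one_left hcn, neg_neg]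

theorem outwardNormal_eq (hT : IsSimplex T) (hd : 2 ≤ d) (hp : p ∈ T) :
    outwardNormal T (T.erase p) = -(height T p • baryGrad T p) :=
  hT.eq_of_isOutwardUnitNormal hd hp
    (Classical.epsilon_spec ⟨_, hT.isOutwardUnitNormal hd hp⟩)

theorem norm_outwardNormal (hT : IsSimplex T) (hd : 2 ≤ d) (hp : p ∈ T) :
    ‖outwardNormal T (T.erase p)‖ = 1 := by
  rw [hT.outwardNormal_eq hd hp]
  exact (hT.isOutwardUnitNormal hd hp).1

theorem inner_outwardNormal (hT : IsSimplex T) (hd : 2 ≤ d) (hp : p ∈ T) (v : Euc d) :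
    inner ℝ (outwardNormal T (T.erase p)) v = -(height T p * inner ℝ (baryGrad T p) v) := by
  rw [hT.outwardNormal_eq hd hp, inner_neg_left, real_inner_smul_left]

theorem inner_outwardNormal_sub (hT : IsSimplex T) (hd : 2 ≤ d) (hp : p ∈ T) (x y : Euc d) :
    inner ℝ (outwardNormal T (T.erase p)) (x - y) =
      height T p * (bary T p y - bary T p x) := by
  rw [hT.inner_outwardNormal hd hp, ← bary_sub]; ring

theorem isCompact_cell (s : Finset (Euc d)) : IsCompact (cell s) :=
  s.finite_toSet.isCompact_convexHull ℝ

theorem interior_nonempty (hT : IsSimplex T) : (interior (cell T)).Nonempty := by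
  have h := hT.basis.centroid_mem_interior_convexHull
  rw [hT.range_basis] at h
  exact ⟨_, h⟩

theorem closure_interior (hT : IsSimplex T) : closure (interior (cell T)) = cell T := by
  rw [(convex_convexHull ℝ _).closure_interior_eq_closure_of_nonempty_interior
    hT.interior_nonempty, (isCompact_cell T).isClosed.closure_eq]

end IsSimplex

end DarcyRT

namespace DarcyRT

variable {d : ℕ} {T : Finset (Euc d)} {p q : Euc d}

/-! ### Integration over a simplex in conical coordinates -/

/-- The isometric parametrization of the hyperplane of the side of `T` opposite to `p` by the
orthogonal complement of its normal. -/
noncomputable def sideParam (T : Finset (Euc d)) (p : Euc d)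
    (u : (Submodule.span ℝ {outwardNormal T (T.erase p)})ᗮ) : Euc d :=
  p + (height T p • outwardNormal T (T.erase p) + (u : Euc d))

theorem isometry_sideParam (T : Finset (Euc d)) (p : Euc d) : Isometry (sideParam T p) := by
  refine Isometry.of_dist_eq fun u v => ?_
  simp [sideParam, dist_eq_norm]

namespace IsSimplex

theorem finrank_orthogonal (hT : IsSimplex T) (hd : 2 ≤ d) (hp : p ∈ T) :
    Module.finrank ℝ (Submodule.span ℝ {outwardNormal T (T.erase p)})ᗮ = d - 1 := by
  have : Fact (Module.finrank ℝ (Euc d) = (d - 1) + 1) := ⟨by simp; omega⟩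
  apply Submodule.finrank_orthogonal_span_singleton
  rw [← norm_ne_zero_iff, hT.norm_outwardNormal hd hp]
  exact one_ne_zero

theorem measurableEmbedding_sideParam :
    MeasurableEmbedding (sideParam T p) :=
  (isometry_sideParam T p).isClosedEmbedding.measurableEmbedding

/-- Isometries preserve the Euclidean Hausdorff measure, which is Lebesgue measure on the
`(d-1)`-dimensional complement; surface integrals thus become ordinary ones. -/
theorem map_sideParam (hT : IsSimplex T) (hd : 2 ≤ d) (hp : p ∈ T) :
    Measure.map (sideParam T p) volume =
      (μHE[d - 1] : Measure (Euc d)).restrict (Set.range (sideParam T p)) := by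
  rw [← (isometry_sideParam T p).map_euclideanHausdorffMeasure (d := d - 1),
    ← hT.finrank_orthogonal hd hp, InnerProductSpace.euclideanHausdorffMeasure_eq_volume]

theorem inner_eq_zero_of_mem_orthogonal
    (u : (Submodule.span ℝ {outwardNormal T (T.erase p)})ᗮ) :
    inner ℝ (outwardNormal T (T.erase p)) (u : Euc d) = 0 :=
  Submodule.inner_right_of_mem_orthogonal (Submodule.mem_span_singleton_self _) u.2

/-- Here `r` is the depth below `p` along the outward normal; displacements orthogonal to the normal
do not change `λ_p`. -/
theorem bary_cone (hT : IsSimplex T) (hd : 2 ≤ d) (hp : p ∈ T) (r : ℝ)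
    (u : (Submodule.span ℝ {outwardNormal T (T.erase p)})ᗮ) :
    height T p * bary T p (p + (r • outwardNormal T (T.erase p) + (u : Euc d))) =
      height T p - r := by
  have h := hT.inner_outwardNormal_sub hd hp
    (p + (r • outwardNormal T (T.erase p) + (u : Euc d))) p
  rw [add_sub_cancel_left, inner_add_right, inner_eq_zero_of_mem_orthogonal, inner_smul_right,
    real_inner_self_eq_norm_sq, hT.norm_outwardNormal hd hp, hT.bary_self hp] at h
  linarith

theorem bary_sideParam (hT : IsSimplex T) (hd : 2 ≤ d) (hp : p ∈ T)
    (u : (Submodule.span ℝ {outwardNormal T (T.erase p)})ᗮ) :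
    bary T p (sideParam T p u) = 0 := by
  have h := hT.bary_cone hd hp (height T p) u
  rw [sub_self, mul_eq_zero] at h
  exact h.resolve_left (hT.height_pos hd hp).ne'

theorem side_subset_range (hT : IsSimplex T) (hd : 2 ≤ d) (hp : p ∈ T) :
    cell (T.erase p) ⊆ Set.range (sideParam T p) := by
  intro x hx
  have hx0 := ((hT.mem_side_iff hp).1 hx).2
  refine ⟨⟨x - p - height T p • outwardNormal T (T.erase p), ?_⟩, by simp [sideParam]⟩
  rw [Submodule.mem_orthogonal_singleton_iff_inner_right, inner_sub_right,
    hT.inner_outwardNormal_sub hd hp, inner_smul_right, real_inner_self_eq_norm_sq,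
    hT.norm_outwardNormal hd hp, hx0, hT.bary_self hp]
  ring

theorem measurableSet_cell (s : Finset (Euc d)) : MeasurableSet (cell s) :=
  (isCompact_cell s).isClosed.measurableSet

theorem integral_side (hT : IsSimplex T) (hd : 2 ≤ d) (hp : p ∈ T) (g : Euc d → ℝ) :
    ∫ y in cell (T.erase p), g y ∂μHE[d - 1] =
      ∫ u, (cell (T.erase p)).indicator g (sideParam T p u) := by
  rw [← measurableEmbedding_sideParam.integral_map, hT.map_sideParam hd hp,
    setIntegral_indicator (measurableSet_cell _),
    Set.inter_eq_right.2 (hT.side_subset_range hd hp)]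

theorem measure_side_lt_top (hT : IsSimplex T) (hd : 2 ≤ d) (hp : p ∈ T) :
    (μHE[d - 1] : Measure (Euc d)) (cell (T.erase p)) < ⊤ := by
  have h : (μHE[d - 1] : Measure (Euc d)) (cell (T.erase p)) =
      volume (sideParam T p ⁻¹' cell (T.erase p)) := by
    rw [← measurableEmbedding_sideParam.map_apply, hT.map_sideParam hd hp,
      Measure.restrict_apply (measurableSet_cell _),
      Set.inter_eq_left.2 (hT.side_subset_range hd hp)]
  rw [h]
  exact ((isometry_sideParam T p).isClosedEmbedding.isCompact_preimage
    (isCompact_cell _)).measure_lt_top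

/-- Fubini's theorem for the orthogonal splitting into the normal line and its complement, with
origin at `p`. -/
theorem integral_eq_iterated (hT : IsSimplex T) (hd : 2 ≤ d) (hp : p ∈ T) {F : Euc d → ℝ}
    (hF : Integrable F) :
    ∫ x, F x = ∫ r : ℝ, ∫ u : (Submodule.span ℝ {outwardNormal T (T.erase p)})ᗮ,
      F (p + (r • outwardNormal T (T.erase p) + (u : Euc d))) := by
  set n := outwardNormal T (T.erase p) with hn
  have hmp : MeasurePreserving ((Submodule.span ℝ {n}).measurableEquivProd p) volume volume := by
    rw [← InnerProductSpace.euclideanHausdorffMeasure_eq_volume (V := Euc d)]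
    exact (Submodule.span ℝ {n}).measurePreserving_measurableEquivProd p
  have h1 : ∫ x, F x = ∫ z, F (((Submodule.span ℝ {n}).measurableEquivProd p).symm z) :=
    ((hmp.symm _).integral_comp' F).symm
  have hi : Integrable (fun z => F (((Submodule.span ℝ {n}).measurableEquivProd p).symm z)) :=
    (hmp.symm _).integrable_comp_of_integrable hF
  let L := LinearIsometryEquiv.toSpanUnitSingleton (𝕜 := ℝ) n (hT.norm_outwardNormal hd hp)
  rw [h1, Measure.volume_eq_prod, integral_prod _ hi,
    ← (L.measurePreserving).integral_comp L.toHomeomorph.measurableEmbedding]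
  simp only [Submodule.measurableEquivProd_symm_apply, vadd_eq_add]
  congr 1
  ext r
  congr 1
  ext u
  rw [add_comm p]
  rfl

/-- Along the ray from `p` to `y` the coordinates of the other vertices are multiplied by `t`, so
their signs are those at `y`. -/
theorem mem_cell_cone_iff (hT : IsSimplex T) (hp : p ∈ T) {y : Euc d}
    (hy : bary T p y = 0) {t : ℝ} (ht : t ∈ Set.Ioc (0 : ℝ) 1) :
    p + t • (y - p) ∈ cell T ↔ y ∈ cell (T.erase p) := by
  rw [hT.mem_cell_iff, hT.mem_side_iff hp]
  simp only [bary_line, hy, and_true]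
  constructor
  · intro h q hq
    by_cases hqp : q = p
    · rw [hqp, hy]
    have := h q hq
    rw [hT.bary_of_ne hp hqp, mul_zero, zero_add] at this
    exact nonneg_of_mul_nonneg_right this ht.1
  · intro h q hq
    have h1 : 0 ≤ bary T q p := hT.mem_cell_iff.1 (subset_convexHull ℝ _ hp) q hq
    exact add_nonneg (mul_nonneg (sub_nonneg.2 ht.2) h1) (mul_nonneg ht.1.le (h q hq))

/-- Integration over a simplex along the rays emanating from one of its vertices. -/
theorem integral_cell (hT : IsSimplex T) (hd : 2 ≤ d) (hp : p ∈ T) {f : Euc d → ℝ}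
    (hf : IntegrableOn f (cell T)) :
    ∫ x in cell T, f x = height T p * ∫ t in (0 : ℝ)..1, t ^ (d - 1) *
      ∫ y in cell (T.erase p), f (p + t • (y - p)) ∂μHE[d - 1] := by
  set n := outwardNormal T (T.erase p) with hn
  set h := height T p with hh
  have hpos : 0 < h := hT.height_pos hd hp
  set F := (cell T).indicator f with hF
  have hFi : Integrable F := hf.integrable_indicator (measurableSet_cell _)
  rw [← integral_indicator (measurableSet_cell _), hT.integral_eq_iterated hd hp hFi]
  set G : ℝ → ℝ := fun r => ∫ u : (Submodule.span ℝ {n})ᗮ, F (p + (r • n + (u : Euc d))) with hG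
  -- Inside `T` the coordinate `λ_p` lies in `[0, 1]`, so slices at other depths miss `T`.
  have hG0 : ∀ r ∉ Set.Icc 0 h, G r = 0 := by
    intro r hr
    have : ∀ u : (Submodule.span ℝ {n})ᗮ, F (p + (r • n + (u : Euc d))) = 0 := by
      intro u
      refine Set.indicator_of_notMem (fun hmem => hr ?_) _
      have hb := hT.bary_cone hd hp r u
      have hm := hT.mem_cell_iff.1 hmem
      have h1 : bary T p (p + (r • n + (u : Euc d))) ≤ 1 := by
        rw [← hT.sum_bary (p + (r • n + (u : Euc d)))]
        exact Finset.single_le_sum (f := fun q => bary T q (p + (r • n + (u : Euc d)))) hm hp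
      have h2 := hm p hp
      constructor <;> nlinarith
    simp [hG, this]
  rw [← setIntegral_eq_integral_of_forall_compl_eq_zero hG0, integral_Icc_eq_integral_Ioc,
    ← intervalIntegral.integral_of_le hpos.le]
  -- The substitution `r = h t` yields the factor `height T p`; the dilation `u ↦ t u` of the slice
  -- yields `t ^ (d - 1)`.
  have h2 := intervalIntegral.mul_integral_comp_mul_left (a := 0) (b := 1) (f := G) h
  rw [mul_zero, mul_one] at h2
  rw [← h2]
  congr 1
  refine intervalIntegral.integral_congr_ae (Filter.Eventually.of_forall fun t ht => ?_)
  rw [Set.uIoc_of_le zero_le_one] at ht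
  rw [hT.integral_side hd hp]
  have h3 := Measure.integral_comp_smul (volume : Measure (Submodule.span ℝ {n})ᗮ)
    (fun u => F (p + ((h * t) • n + (u : Euc d)))) t
  rw [hT.finrank_orthogonal hd hp, abs_of_pos (inv_pos.2 (pow_pos ht.1 _)), smul_eq_mul] at h3
  have h4 : G (h * t) = t ^ (d - 1) *
      ∫ u : (Submodule.span ℝ {n})ᗮ, F (p + ((h * t) • n + ((t • u : (Submodule.span ℝ {n})ᗮ) : Euc d))) := by
    rw [h3, ← mul_assoc, mul_inv_cancel₀ (pow_pos ht.1 _).ne', one_mul]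
  rw [h4]
  congr 2
  ext u
  have h5 : p + ((h * t) • n + ((t • u : (Submodule.span ℝ {n})ᗮ) : Euc d)) =
      p + t • (sideParam T p u - p) := by
    rw [sideParam, Submodule.coe_smul, add_sub_cancel_left, smul_add, smul_smul, mul_comm h t]
  rw [h5]
  have h6 := hT.mem_cell_cone_iff hp (hT.bary_sideParam hd hp u) ht
  by_cases hm : sideParam T p u ∈ cell (T.erase p)
  · rw [hF, Set.indicator_of_mem (h6.2 hm), Set.indicator_of_mem hm]
  · rw [hF, Set.indicator_of_notMem (fun hc => hm (h6.1 hc)), Set.indicator_of_notMem hm]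

end IsSimplex

end DarcyRT

namespace DarcyRT

variable {d : ℕ} {T : Finset (Euc d)} {p q : Euc d}

/-- The divergence of a differentiable vector field. -/
noncomputable def divg (v : Euc d → Euc d) (x : Euc d) : ℝ :=
  ∑ i, fderiv ℝ v x (EuclideanSpace.basisFun (Fin d) ℝ i) i

namespace IsSimplex

/-! ### Finiteness of the surface measure and Fubini's theorem on a side. -/

theorem isFiniteMeasure_side (hT : IsSimplex T) (hd : 2 ≤ d) (hp : p ∈ T) :
    IsFiniteMeasure ((μHE[d - 1] : Measure (Euc d)).restrict (cell (T.erase p))) :=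
  ⟨by simpa using hT.measure_side_lt_top hd hp⟩

/-- The surface measure is not locally finite on `ℝ^d`, whereas its restriction to a side is finite.
Results about integrals over compact sets are therefore applied to the restricted measure, and the
second restriction is removed here. -/
theorem restrict_side_self (s : Finset (Euc d)) :
    ((μHE[d - 1] : Measure (Euc d)).restrict (cell s)).restrict (cell s) =
      (μHE[d - 1] : Measure (Euc d)).restrict (cell s) := by
  rw [Measure.restrict_restrict (measurableSet_cell s), Set.inter_self]

theorem integrableOn_side (hT : IsSimplex T) (hd : 2 ≤ d) (hp : p ∈ T) {f : Euc d → ℝ}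
    (hf : Continuous f) : IntegrableOn f (cell (T.erase p)) μHE[d - 1] := by
  obtain ⟨M, hM⟩ := ((isCompact_cell (T.erase p)).image hf).isBounded.exists_norm_le
  exact Measure.integrableOn_of_bounded (hT.measure_side_lt_top hd hp).ne hf.aestronglyMeasurable
    (M := M) ((ae_restrict_iff' (measurableSet_cell _)).2
      (Filter.Eventually.of_forall fun x hx => hM _ ⟨x, hx, rfl⟩))

theorem integrableOn_cell {f : Euc d → ℝ} (hf : Continuous f) (s : Finset (Euc d)) :
    IntegrableOn f (cell s) :=
  hf.continuousOn.integrableOn_compact (isCompact_cell s)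

theorem integral_side_swap (hT : IsSimplex T) (hd : 2 ≤ d) (hp : p ∈ T) {F : ℝ → Euc d → ℝ}
    (hF : Continuous (Function.uncurry F)) :
    ∫ t in (0 : ℝ)..1, ∫ y in cell (T.erase p), F t y ∂μHE[d - 1] =
      ∫ y in cell (T.erase p), (∫ t in (0 : ℝ)..1, F t y) ∂μHE[d - 1] := by
  have := hT.isFiniteMeasure_side hd hp
  apply intervalIntegral_integral_swap
  rw [Set.uIoc_of_le zero_le_one]
  obtain ⟨M, hM⟩ := (((isCompact_Icc (a := (0 : ℝ)) (b := 1)).prod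
    (isCompact_cell (T.erase p))).image hF).isBounded.exists_norm_le
  refine Integrable.of_bound hF.aestronglyMeasurable M ?_
  rw [← restrict_side_self, Measure.prod_restrict,
    ae_restrict_iff' (measurableSet_Ioc.prod (measurableSet_cell _))]
  exact Filter.Eventually.of_forall fun z hz =>
    hM _ ⟨z, ⟨Set.Ioc_subset_Icc_self hz.1, hz.2⟩, rfl⟩

theorem integral_cell_eq_integral_side (hT : IsSimplex T) (hd : 2 ≤ d) (hp : p ∈ T)
    {f : Euc d → ℝ} (hf : Continuous f) :
    ∫ x in cell T, f x = height T p * ∫ y in cell (T.erase p),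
      (∫ t in (0 : ℝ)..1, t ^ (d - 1) * f (p + t • (y - p))) ∂μHE[d - 1] := by
  rw [hT.integral_cell hd hp (integrableOn_cell hf T), ← hT.integral_side_swap hd hp]
  · simp only [integral_const_mul]
  · simp only [Function.uncurry_def]; fun_prop

/-! ### The divergence theorem on a simplex -/

/-- On a ray the integrand times the Jacobian is the derivative of `t ^ d * g (p + t • (y - p))`.
This is the divergence theorem for `g(x)(x - p)`, a field tangential to every side through `p`. -/
theorem integral_radial (hT : IsSimplex T) (hd : 2 ≤ d) (hp : p ∈ T) {g : Euc d → ℝ}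
    (hg : ContDiff ℝ 1 g) :
    ∫ x in cell T, ((d : ℝ) * g x + fderiv ℝ g x (x - p)) =
      height T p * ∫ y in cell (T.erase p), g y ∂μHE[d - 1] := by
  have hg' : Continuous (fderiv ℝ g) := hg.continuous_fderiv (by simp)
  have hgc : Continuous g := hg.continuous
  rw [hT.integral_cell_eq_integral_side hd hp (by fun_prop)]
  congr 1
  refine setIntegral_congr_fun (measurableSet_cell _) fun y _ => ?_
  have hder : ∀ t : ℝ, HasDerivAt (fun t : ℝ => t ^ d * g (p + t • (y - p)))
      (t ^ (d - 1) * ((d : ℝ) * g (p + t • (y - p)) +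
        fderiv ℝ g (p + t • (y - p)) (p + t • (y - p) - p))) t := by
    intro t
    have h1 : HasDerivAt (fun t : ℝ => p + t • (y - p)) (y - p) t := by
      simpa using ((hasDerivAt_id t).smul_const (y - p)).const_add p
    have h2 := ((hg.differentiable (by simp)).differentiableAt.hasFDerivAt
      (x := p + t • (y - p))).comp_hasDerivAt t h1
    refine ((hasDerivAt_pow d t).mul h2).congr_deriv ?_
    obtain ⟨k, rfl⟩ : ∃ k, d = k + 1 := ⟨d - 1, by omega⟩
    simp only [Function.comp_apply, add_sub_cancel_left, map_smul, smul_eq_mul,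
      Nat.add_sub_cancel, pow_succ]
    ring
  rw [intervalIntegral.integral_eq_sub_of_hasDerivAt (fun t _ => hder t)]
  · simp [show d ≠ 0 by omega]
  · apply Continuous.intervalIntegrable
    fun_prop

/-- Both sides are the trace of `A`, since `∑ p ⊗ ∇λ_p` is the identity. -/
theorem sum_inner_baryGrad_apply (hT : IsSimplex T) (A : Euc d →L[ℝ] Euc d) :
    ∑ p ∈ T, inner ℝ (baryGrad T p) (A p) =
      ∑ i, A (EuclideanSpace.basisFun (Fin d) ℝ i) i := by
  have h1 : ∀ p ∈ T, inner ℝ (baryGrad T p) (A p) =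
      ∑ i, p i * inner ℝ (baryGrad T p) (A (EuclideanSpace.basisFun (Fin d) ℝ i)) := by
    intro p _
    have hA : A p = ∑ i, p i • A (EuclideanSpace.basisFun (Fin d) ℝ i) := by
      conv_lhs => rw [← (EuclideanSpace.basisFun (Fin d) ℝ).sum_repr p]
      simp only [map_sum, map_smul, EuclideanSpace.basisFun_repr]
    simp only [hA, inner_sum, inner_smul_right]
  rw [Finset.sum_congr rfl h1, Finset.sum_comm]
  refine Finset.sum_congr rfl fun i _ => ?_
  conv_rhs => rw [← hT.sum_inner_baryGrad_smul (A (EuclideanSpace.basisFun (Fin d) ℝ i))]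
  simp [mul_comm]

/-- Apply `integral_radial` at every vertex to `g = -⟨∇λ_p, v⟩` and add. The terms without the
vertex `p` as a factor cancel because `∑ ∇λ_p = 0`; the remaining `∑ ⟨∇λ_p, Dv p⟩` is the
divergence. -/
theorem integral_divg (hT : IsSimplex T) (hd : 2 ≤ d) {v : Euc d → Euc d}
    (hv : ContDiff ℝ 1 v) :
    ∫ x in cell T, divg v x = ∑ p ∈ T, ∫ y in cell (T.erase p),
      inner ℝ (outwardNormal T (T.erase p)) (v y) ∂μHE[d - 1] := by
  have hg : ∀ p, ContDiff ℝ 1 fun x => -inner ℝ (baryGrad T p) (v x) := fun p =>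
    (contDiff_const.inner ℝ hv).neg
  have hfd : ∀ p x w, fderiv ℝ (fun x => -inner ℝ (baryGrad T p) (v x)) x w =
      -inner ℝ (baryGrad T p) (fderiv ℝ v x w) := by
    intro p x w
    have h1 := (((innerSL ℝ (baryGrad T p)).hasFDerivAt (x := v x)).comp x
      ((hv.differentiable (by simp)).differentiableAt (x := x)).hasFDerivAt).neg
    have h2 : HasFDerivAt (fun x => -inner ℝ (baryGrad T p) (v x)) _ x := h1
    rw [h2.fderiv]
    rfl
  have h1 : ∀ p ∈ T, ∫ y in cell (T.erase p),
      inner ℝ (outwardNormal T (T.erase p)) (v y) ∂μHE[d - 1] =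
      ∫ x in cell T, ((d : ℝ) * -inner ℝ (baryGrad T p) (v x) +
        -inner ℝ (baryGrad T p) (fderiv ℝ v x (x - p))) := by
    intro p hp
    have := hT.integral_radial hd hp (hg p)
    simp only [hfd] at this
    rw [this, ← integral_const_mul]
    congr 1
    ext y
    rw [hT.inner_outwardNormal hd hp]; ring
  have hvc := hv.continuous
  have hv' : Continuous (fderiv ℝ v) := hv.continuous_fderiv (by simp)
  rw [Finset.sum_congr rfl h1, ← integral_finsetSum]
  · congr 1
    ext x
    have h2 : ∀ p, -inner ℝ (baryGrad T p) (fderiv ℝ v x (x - p)) =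
        -inner ℝ (baryGrad T p) (fderiv ℝ v x x) + inner ℝ (baryGrad T p) (fderiv ℝ v x p) := by
      intro p
      rw [map_sub, inner_sub_right]; ring
    simp only [h2]
    rw [divg, ← hT.sum_inner_baryGrad_apply, Finset.sum_add_distrib, Finset.sum_add_distrib,
      ← Finset.mul_sum, Finset.sum_neg_distrib, Finset.sum_neg_distrib, hT.sum_inner_baryGrad,
      hT.sum_inner_baryGrad]
    simp
  · intro p _
    apply integrableOn_cell
    fun_prop

theorem _root_.DarcyRT.divg_smul {φ : Euc d → ℝ} {v : Euc d → Euc d} {x : Euc d}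
    (hφ : DifferentiableAt ℝ φ x) (hv : DifferentiableAt ℝ v x) :
    divg (fun x => φ x • v x) x = φ x * divg v x + fderiv ℝ φ x (v x) := by
  unfold divg
  rw [fderiv_fun_smul hφ hv]
  simp only [add_apply, smul_apply, PiLp.add_apply,
    PiLp.smul_apply, smul_eq_mul, Finset.sum_add_distrib, ← Finset.mul_sum,
    ContinuousLinearMap.smulRight_apply]
  congr 1
  conv_rhs => rw [← (EuclideanSpace.basisFun (Fin d) ℝ).sum_repr (v x)]
  simp [mul_comm]

/-- Green's formula on a simplex. -/
theorem integral_green (hT : IsSimplex T) (hd : 2 ≤ d) {v : Euc d → Euc d} {φ : Euc d → ℝ}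
    (hv : ContDiff ℝ 1 v) (hφ : ContDiff ℝ 1 φ) :
    ∫ x in cell T, fderiv ℝ φ x (v x) = -(∫ x in cell T, divg v x * φ x) +
      ∑ p ∈ T, ∫ y in cell (T.erase p),
        inner ℝ (outwardNormal T (T.erase p)) (v y) * φ y ∂μHE[d - 1] := by
  have hφv : ContDiff ℝ 1 fun x => φ x • v x := hφ.smul hv
  have h := hT.integral_divg hd hφv
  have hvc := hv.continuous
  have hφc := hφ.continuous
  have hv' : Continuous (fderiv ℝ v) := hv.continuous_fderiv (by simp)
  have hφ' : Continuous (fderiv ℝ φ) := hφ.continuous_fderiv (by simp)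
  have hdc : Continuous (divg v) := by unfold divg; fun_prop
  have e1 : ∀ x, divg (fun x => φ x • v x) x = divg v x * φ x + fderiv ℝ φ x (v x) := fun x => by
    rw [divg_smul (hφ.differentiable (by simp)).differentiableAt
      (hv.differentiable (by simp)).differentiableAt, mul_comm]
  simp only [e1] at h
  rw [integral_add (integrableOn_cell (by fun_prop) T) (integrableOn_cell (by fun_prop) T)] at h
  simp only [inner_smul_right, mul_comm (φ _)] at h
  linarith

/-! ### Inequalities for polynomials on a simplex -/

/-- In conical coordinates both sides carry the factor `height T p`, and on each ray the bound is
that of `P(1)²` by a weighted integral of `P²`; hence the constant does not depend on the shape of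
`T`. -/
theorem exists_trace_inequality (d m : ℕ) (hd : 2 ≤ d) : ∃ C : ℝ, 0 < C ∧
    ∀ (T : Finset (Euc d)), IsSimplex T → ∀ p ∈ T, ∀ f : Euc d → ℝ, PolyLE m f →
      height T p * ∫ y in cell (T.erase p), f y ^ 2 ∂μHE[d - 1] ≤
        C * ∫ x in cell T, f x ^ 2 := by
  obtain ⟨C, hC, h⟩ := exists_polynomial_weighted_bound (d - 1) m
  refine ⟨C, hC, fun T hT p hp f hf => ?_⟩
  have hfc := hf.continuous
  rw [hT.integral_cell_eq_integral_side hd hp (by fun_prop), mul_left_comm]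
  refine mul_le_mul_of_nonneg_left ?_ (hT.height_pos hd hp).le
  rw [← integral_const_mul]
  have hc2 : Continuous fun y => C * ∫ t in (0 : ℝ)..1, t ^ (d - 1) * f (p + t • (y - p)) ^ 2 := by
    refine continuous_const.mul ?_
    apply intervalIntegral.continuous_parametric_intervalIntegral_of_continuous'
    simp only [Function.uncurry_def]; fun_prop
  refine setIntegral_mono (hT.integrableOn_side hd hp (by fun_prop))
    (hT.integrableOn_side hd hp hc2) fun y => ?_
  obtain ⟨P, hP, hPf⟩ := hf.exists_line p (y - p)
  have h1 := (h P hP).1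
  have h2 : f y = P.eval 1 := by rw [← hPf, one_smul, add_sub_cancel]
  simp only [hPf, h2]
  refine h1.trans (mul_le_mul_of_nonneg_left ?_ hC.le)
  refine intervalIntegral.integral_mono_on zero_le_one
    (Continuous.intervalIntegrable (by fun_prop) _ _)
    (Continuous.intervalIntegrable (by fun_prop) _ _) fun t ht => ?_
  refine mul_le_mul_of_nonneg_right ?_ (sq_nonneg _)
  exact mul_le_of_le_one_right (pow_nonneg ht.1 _) (by linarith [ht.1])

/-- A weight homogeneous of degree `j` along the rays from `p` only raises the exponent of the
Jacobian to `d - 1 + j`, and `λ_p` is the factor `1 - t` of the univariate bound. -/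
theorem exists_weight_inequality (d m j : ℕ) (hd : 2 ≤ d) : ∃ C : ℝ, 0 < C ∧
    ∀ (T : Finset (Euc d)), IsSimplex T → ∀ p ∈ T, ∀ w : Euc d → ℝ, Continuous w →
      (∀ y ∈ cell (T.erase p), 0 ≤ w y) →
      (∀ y ∈ cell (T.erase p), ∀ t : ℝ, w (p + t • (y - p)) = t ^ j * w y) →
      ∀ f : Euc d → ℝ, PolyLE m f →
      ∫ x in cell T, w x * f x ^ 2 ≤ C * ∫ x in cell T, bary T p x * (w x * f x ^ 2) := by
  obtain ⟨C, hC, h⟩ := exists_polynomial_weighted_bound (d - 1 + j) m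
  refine ⟨C, hC, fun T hT p hp w hw hw0 hwt f hf => ?_⟩
  have hfc := hf.continuous
  have hbc := continuous_bary T p
  rw [hT.integral_cell_eq_integral_side hd hp (by fun_prop),
    hT.integral_cell_eq_integral_side hd hp (by fun_prop), mul_left_comm]
  refine mul_le_mul_of_nonneg_left ?_ (hT.height_pos hd hp).le
  rw [← integral_const_mul]
  refine setIntegral_mono_on (hT.integrableOn_side hd hp ?_)
    (hT.integrableOn_side hd hp (continuous_const.mul ?_)) (measurableSet_cell _) fun y hy => ?_
  · apply intervalIntegral.continuous_parametric_intervalIntegral_of_continuous'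
    simp only [Function.uncurry_def]; fun_prop
  · apply intervalIntegral.continuous_parametric_intervalIntegral_of_continuous'
    simp only [Function.uncurry_def]; fun_prop
  obtain ⟨P, hP, hPf⟩ := hf.exists_line p (y - p)
  have h2 := mul_le_mul_of_nonneg_left (h P hP).2 (hw0 y hy)
  have hb0 : bary T p y = 0 := ((hT.mem_side_iff hp).1 hy).2
  have e1 : ∀ t : ℝ, t ^ (d - 1) * (w (p + t • (y - p)) * f (p + t • (y - p)) ^ 2) =
      w y * (t ^ (d - 1 + j) * P.eval t ^ 2) := fun t => by
    rw [hwt y hy, hPf, pow_add]; ring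
  have e2 : ∀ t : ℝ, t ^ (d - 1) * (bary T p (p + t • (y - p)) *
      (w (p + t • (y - p)) * f (p + t • (y - p)) ^ 2)) =
      w y * (t ^ (d - 1 + j) * (1 - t) * P.eval t ^ 2) := fun t => by
    rw [hwt y hy, hPf, bary_line, hb0, hT.bary_self hp, pow_add]; ring
  simp only [e1, e2, intervalIntegral.integral_const_mul]
  linarith

/-- Insert `λ_q` with the weight 1 on the rays from `q`, then `λ_p` with the weight `λ_q`, which is
homogeneous of degree one on the rays from `p`. -/
theorem exists_bubble_inequality (d m : ℕ) (hd : 2 ≤ d) : ∃ C : ℝ, 0 < C ∧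
    ∀ (T : Finset (Euc d)), IsSimplex T → ∀ p ∈ T, ∀ q ∈ T, p ≠ q →
      ∀ f : Euc d → ℝ, PolyLE m f →
      ∫ x in cell T, f x ^ 2 ≤ C * ∫ x in cell T, bary T p x * bary T q x * f x ^ 2 := by
  obtain ⟨C₀, hC₀, h₀⟩ := exists_weight_inequality d m 0 hd
  obtain ⟨C₁, hC₁, h₁⟩ := exists_weight_inequality d m 1 hd
  refine ⟨C₀ * C₁, mul_pos hC₀ hC₁, fun T hT p hp q hq hpq f hf => ?_⟩
  have e0 := h₀ T hT q hq (fun _ => 1) continuous_const (by simp) (by simp) f hf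
  have e1 := h₁ T hT p hp (bary T q) (continuous_bary T q)
    (fun y hy => ((hT.mem_side_iff hp).1 hy).1 q hq)
    (fun y _ t => by rw [bary_line, hT.bary_of_ne hp hpq.symm]; ring) f hf
  simp only [one_mul] at e0
  calc _ ≤ _ := e0
    _ ≤ C₀ * (C₁ * _) := mul_le_mul_of_nonneg_left e1 hC₀.le
    _ = _ := by simp only [mul_assoc]

/-- Composition with the affine projection of a simplex onto one of its sides that moves the
opposite vertex `p` to a vertex `z` of the side. -/
theorem integral_comp_collapse_le (hT : IsSimplex T) (hd : 2 ≤ d) (hp : p ∈ T) {z : Euc d}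
    (hz : z ∈ T.erase p) {g : Euc d → ℝ} (hg : Continuous g) (hg0 : ∀ x, 0 ≤ g x) :
    ∫ x in cell T, g (x + bary T p x • (z - p)) ≤
      height T p * ∫ y in cell (T.erase p), g y ∂μHE[d - 1] := by
  have hbc := continuous_bary T p
  have hzc : z ∈ cell (T.erase p) := subset_convexHull ℝ _ hz
  rw [hT.integral_cell hd hp (integrableOn_cell (by fun_prop) T)]
  refine mul_le_mul_of_nonneg_left ?_ (hT.height_pos hd hp).le
  set S := ∫ y in cell (T.erase p), g y ∂μHE[d - 1] with hS
  have hS0 : 0 ≤ S := integral_nonneg hg0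
  have key : ∀ t ∈ Set.Ioc (0 : ℝ) 1, t ^ (d - 1) * ∫ y in cell (T.erase p),
      g (p + t • (y - p) + bary T p (p + t • (y - p)) • (z - p)) ∂μHE[d - 1] ≤ S := by
    intro t ht
    -- On the slice `t` the collapse is the homothety of ratio `t` with centre `z`. It maps the side
    -- into itself and its Jacobian cancels `t ^ (d - 1)`, so each slice contributes at most the
    -- full side integral.
    have e1 : ∫ y in cell (T.erase p),
        g (p + t • (y - p) + bary T p (p + t • (y - p)) • (z - p)) ∂μHE[d - 1] =
        ∫ y in cell (T.erase p), g (z + t • (y - z)) ∂μHE[d - 1] := by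
      refine setIntegral_congr_fun (measurableSet_cell _) fun y hy => ?_
      simp only [bary_line, ((hT.mem_side_iff hp).1 hy).2, hT.bary_self hp]
      congr 1
      module
    rw [e1, hS, hT.integral_side hd hp, hT.integral_side hd hp]
    -- With the parameter `u₀` of `z` as origin, the homothety becomes a linear dilation.
    obtain ⟨u₀, hu₀⟩ := hT.side_subset_range hd hp hzc
    have hline : ∀ (r : ℝ) u, sideParam T p (u₀ + r • u) = z + r • (sideParam T p (u₀ + u) - z) := by
      intro r u
      rw [← hu₀]
      simp only [sideParam, Submodule.coe_add, Submodule.coe_smul]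
      module
    rw [← integral_add_left_eq_self _ u₀, ← integral_add_left_eq_self
      (fun u => (cell (T.erase p)).indicator g (sideParam T p u)) u₀]
    have h3 := Measure.integral_comp_smul volume
      (fun u => (cell (T.erase p)).indicator g (sideParam T p (u₀ + u))) t
    rw [hT.finrank_orthogonal hd hp, abs_of_pos (inv_pos.2 (pow_pos ht.1 _)), smul_eq_mul] at h3
    rw [← mul_inv_cancel_left₀ (pow_pos ht.1 (d - 1)).ne'
      (∫ u, (cell (T.erase p)).indicator g (sideParam T p (u₀ + u))), ← h3]
    refine mul_le_mul_of_nonneg_left ?_ (pow_pos ht.1 _).le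
    have hint : Integrable fun u => (cell (T.erase p)).indicator g (sideParam T p (u₀ + u)) := by
      have h4 : Integrable fun u => (cell (T.erase p)).indicator g (sideParam T p u) := by
        have h5 := (measurableEmbedding_sideParam (T := T) (p := p)).integrable_map_iff
          (μ := volume) (g := (cell (T.erase p)).indicator g)
        refine h5.1 ?_
        rw [hT.map_sideParam hd hp]
        exact ((hT.integrableOn_side hd hp hg).integrable_indicator (measurableSet_cell _)).restrict
      exact h4.comp_add_left u₀
    refine integral_mono_of_nonneg (Filter.Eventually.of_forall fun u => ?_)
      (hint.comp_smul ht.1.ne') (Filter.Eventually.of_forall fun u => ?_)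
    · exact Set.indicator_nonneg (fun _ _ => hg0 _) _
    · dsimp only
      by_cases hm : sideParam T p (u₀ + u) ∈ cell (T.erase p)
      · rw [Set.indicator_of_mem hm]
        rw [hline, Set.indicator_of_mem]
        exact (convex_convexHull ℝ _).add_smul_sub_mem hzc hm ⟨ht.1.le, ht.2⟩
      · rw [Set.indicator_of_notMem hm]
        exact Set.indicator_nonneg (fun _ _ => hg0 _) _
  have hc : Continuous fun t : ℝ => t ^ (d - 1) * ∫ y in cell (T.erase p),
      g (p + t • (y - p) + bary T p (p + t • (y - p)) • (z - p)) ∂μHE[d - 1] := by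
    refine (continuous_pow _).mul ?_
    have := hT.isFiniteMeasure_side hd hp
    have hcont := continuous_parametric_integral_of_continuous
      (μ := (μHE[d - 1] : Measure (Euc d)).restrict (cell (T.erase p)))
      (f := fun (t : ℝ) y => g (p + t • (y - p) + bary T p (p + t • (y - p)) • (z - p)))
      (by simp only [Function.uncurry_def]; fun_prop) (isCompact_cell (T.erase p))
    simpa only [restrict_side_self] using hcont
  calc _ ≤ ∫ t in (0 : ℝ)..1, S := by
        refine intervalIntegral.integral_mono_on_of_le_Ioo zero_le_one
          (hc.intervalIntegrable _ _) (by simp) fun t ht => key t ⟨ht.1, ht.2.le⟩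
    _ = S := by simp

/-- The relative boundary of a side of a simplex is negligible for the surface measure. -/
theorem measure_side_bary_eq_zero (hT : IsSimplex T) (hd : 2 ≤ d) (hp : p ∈ T)
    (hq : q ∈ T.erase p) :
    (μHE[d - 1] : Measure (Euc d)) (cell (T.erase p) ∩ {x | bary T q x = 0}) = 0 := by
  set A := {x | bary T q x = 0} with hA
  have hAm : MeasurableSet A := (isClosed_eq (continuous_bary T q) continuous_const).measurableSet
  obtain ⟨hqp, hqT⟩ := Finset.mem_erase.1 hq
  have hnull : volume (cell T ∩ A) = 0 := by
    refine measure_mono_null (fun x hx => ?_) ((convex_convexHull ℝ (T : Set (Euc d))).addHaar_frontier volume)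
    refine ⟨subset_closure hx.1, fun hi => ?_⟩
    exact ((hT.mem_interior_iff).1 hi q hqT).ne' hx.2
  -- The set `λ_q = 0` meets `T` in a null set and is a cone with apex `p`; the conical formula
  -- therefore equates zero with `height / d` times the surface measure sought.
  have h := hT.integral_cell hd hp (f := A.indicator fun _ => (1 : ℝ))
    ((integrableOn_cell continuous_const T).indicator hAm)
  rw [setIntegral_indicator hAm, setIntegral_measure_zero _ hnull] at h
  have hfin : (μHE[d - 1] : Measure (Euc d)) (cell (T.erase p) ∩ A) ≠ ⊤ :=
    (measure_mono Set.inter_subset_left |>.trans_lt (hT.measure_side_lt_top hd hp)).ne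
  have e1 : ∀ t ∈ Set.uIoc (0 : ℝ) 1, t ^ (d - 1) * ∫ y in cell (T.erase p),
      A.indicator (fun _ => (1 : ℝ)) (p + t • (y - p)) ∂μHE[d - 1] =
      t ^ (d - 1) * (μHE[d - 1] : Measure (Euc d)).real (cell (T.erase p) ∩ A) := by
    intro t ht
    rw [Set.uIoc_of_le zero_le_one] at ht
    have : ∀ y, A.indicator (fun _ => (1 : ℝ)) (p + t • (y - p)) = A.indicator (fun _ => 1) y := by
      intro y
      have : p + t • (y - p) ∈ A ↔ y ∈ A := by
        simp only [hA, Set.mem_ofPred_eq, bary_line, hT.bary_of_ne hp hqp]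
        simp [ht.1.ne']
      by_cases hy : y ∈ A
      · rw [Set.indicator_of_mem hy, Set.indicator_of_mem (this.2 hy)]
      · rw [Set.indicator_of_notMem hy, Set.indicator_of_notMem (fun h => hy (this.1 h))]
    simp only [this]
    rw [setIntegral_indicator hAm, setIntegral_const, smul_eq_mul, mul_one]
  rw [intervalIntegral.integral_congr_ae (Filter.Eventually.of_forall e1), intervalIntegral.integral_mul_const,
    integral_pow] at h
  have h0 := (hT.height_pos hd hp).ne'
  have h1 : (μHE[d - 1] : Measure (Euc d)).real (cell (T.erase p) ∩ A) = 0 := by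
    have hd1 : ((d - 1 : ℕ) : ℝ) + 1 ≠ 0 := by positivity
    field_simp at h
    simpa [h0] using h.symm
  rwa [measureReal_eq_zero_iff hfin] at h1

end IsSimplex

end DarcyRT

namespace DarcyRT

variable {d : ℕ} {T : Finset (Euc d)} {p q : Euc d}

namespace IsSimplex

/-! ### Shape regularity -/

theorem isBounded_cell (s : Finset (Euc d)) : Bornology.IsBounded (cell s) :=
  (isCompact_cell s).isBounded

theorem bary_le_one (hT : IsSimplex T) (hp : p ∈ T) {x : Euc d} (hx : x ∈ cell T) :
    bary T p x ≤ 1 := by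
  rw [← hT.sum_bary x]
  exact Finset.single_le_sum (f := fun q => bary T q x) (hT.mem_cell_iff.1 hx) hp

theorem add_smul_mem_of_closedBall_subset {x : Euc d} {ρ : ℝ}
    (hb : Metric.closedBall x ρ ⊆ cell T) {u : Euc d} (hu : ‖u‖ = 1) {r : ℝ} (hr : |r| ≤ ρ) :
    x + r • u ∈ cell T := by
  apply hb
  simpa [norm_smul, hu] using hr

/-- Crossing the ball along the normal changes `λ_p` by `2ρ / height`, and `λ_p` stays in `[0, 1]`.
-/
theorem two_mul_le_height (hT : IsSimplex T) (hd : 2 ≤ d) (hp : p ∈ T) {x : Euc d} {ρ : ℝ}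
    (hρ : 0 < ρ) (hb : Metric.closedBall x ρ ⊆ cell T) : 2 * ρ ≤ height T p := by
  have hn := hT.norm_outwardNormal hd hp
  set n := outwardNormal T (T.erase p) with hndef
  have h1 := add_smul_mem_of_closedBall_subset hb hn (r := ρ) (abs_of_pos hρ).le
  have h2 := add_smul_mem_of_closedBall_subset hb hn (r := -ρ) (by rw [abs_neg, abs_of_pos hρ])
  have h3 := hT.inner_outwardNormal_sub hd hp (x + ρ • n) (x + (-ρ) • n)
  have e : x + ρ • n - (x + (-ρ) • n) = (2 * ρ) • n := by module
  rw [e, inner_smul_right, ← hndef, real_inner_self_eq_norm_sq, hn] at h3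
  have h4 := hT.mem_cell_iff.1 h1 p hp
  have h5 := hT.bary_le_one hp h2
  nlinarith [hT.height_pos hd hp]

theorem diam_side_le (s : Finset (Euc d)) (hs : s ⊆ T) :
    Metric.diam (cell s) ≤ Metric.diam (cell T) :=
  Metric.diam_mono (convexHull_mono (by exact_mod_cast hs)) (isBounded_cell T)

/-- A diameter of the ball parallel to the side is projected centrally from `p` onto the side; this
stretches it by `1 / (1 - b) ≥ 1`, with `b` the value of `λ_p` at the centre. -/
theorem two_mul_le_diam_side (hT : IsSimplex T) (hd : 2 ≤ d) (hp : p ∈ T) {x : Euc d} {ρ : ℝ}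
    (hρ : 0 < ρ) (hb : Metric.closedBall x ρ ⊆ cell T) :
    2 * ρ ≤ Metric.diam (cell (T.erase p)) := by
  have hn := hT.norm_outwardNormal hd hp
  obtain ⟨u, hu⟩ : ∃ u : (Submodule.span ℝ {outwardNormal T (T.erase p)})ᗮ, ‖u‖ = 1 := by
    have : Nontrivial (Submodule.span ℝ {outwardNormal T (T.erase p)})ᗮ := by
      apply Module.nontrivial_of_finrank_pos (R := ℝ)
      rw [hT.finrank_orthogonal hd hp]; omega
    exact exists_norm_eq _ zero_le_one
  have hu1 : ‖(u : Euc d)‖ = 1 := hu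
  have hgu : inner ℝ (baryGrad T p) (u : Euc d) = 0 := by
    have h := hT.inner_outwardNormal hd hp u
    rw [inner_eq_zero_of_mem_orthogonal, eq_comm, neg_eq_zero, mul_eq_zero] at h
    exact h.resolve_left (hT.height_pos hd hp).ne'
  have hx : x ∈ cell T := hb (Metric.mem_closedBall_self hρ.le)
  set b := bary T p x with hbdef
  have hb0 : 0 ≤ b := hT.mem_cell_iff.1 hx p hp
  have hb1 : b < 1 := by
    have h2 := add_smul_mem_of_closedBall_subset hb hn (r := -ρ)
      (by rw [abs_neg, abs_of_pos hρ])
    have h3 := hT.inner_outwardNormal_sub hd hp x (x + (-ρ) • outwardNormal T (T.erase p))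
    rw [sub_add_cancel_left, inner_neg_right, inner_smul_right, real_inner_self_eq_norm_sq, hn] at h3
    have h5 := hT.bary_le_one hp h2
    have hh := hT.height_pos hd hp
    by_contra hcon
    nlinarith
  have ht : 1 - b ∈ Set.Ioc (0 : ℝ) 1 := ⟨by linarith, by linarith⟩
  have key : ∀ r : ℝ, |r| ≤ ρ → p + (1 - b)⁻¹ • (x + r • (u : Euc d) - p) ∈ cell (T.erase p) := by
    intro r hr
    have hxr := add_smul_mem_of_closedBall_subset hb hu1 hr
    rw [← hT.mem_cell_cone_iff hp _ ht]
    · rw [add_sub_cancel_left, smul_smul, mul_inv_cancel₀ ht.1.ne', one_smul, add_sub_cancel]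
      exact hxr
    · rw [bary_line, bary_add, inner_smul_right, hgu, hT.bary_self hp, ← hbdef]
      field_simp [ht.1.ne']
      ring
  have h1 := Metric.dist_le_diam_of_mem (isBounded_cell (T.erase p))
    (key ρ (abs_of_pos hρ).le) (key (-ρ) (by rw [abs_neg, abs_of_pos hρ]))
  refine le_trans ?_ h1
  have e : p + (1 - b)⁻¹ • (x + ρ • (u : Euc d) - p) - (p + (1 - b)⁻¹ • (x + (-ρ) • (u : Euc d) - p)) =
      ((1 - b)⁻¹ * (2 * ρ)) • (u : Euc d) := by module
  rw [dist_eq_norm, e, norm_smul, hu1, mul_one, Real.norm_eq_abs,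
    abs_of_pos (mul_pos (inv_pos.2 ht.1) (by linarith))]
  exact le_mul_of_one_le_left (by linarith) (one_le_inv_iff₀.2 ⟨ht.1, ht.2⟩)

/-- A linear functional on `T` attains its extrema at vertices, and it varies by `2ρ‖G‖` already on
the ball. -/
theorem exists_width (hT : IsSimplex T) {x : Euc d} {ρ : ℝ}
    (hρ : 0 < ρ) (hb : Metric.closedBall x ρ ⊆ cell T) (G : Euc d) :
    ∃ p ∈ T, ∃ q ∈ T, 2 * ρ * ‖G‖ ≤ inner ℝ (p - q) G := by
  have hne : T.Nonempty := Finset.card_pos.1 (by rw [hT.card_eq]; omega)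
  obtain ⟨p, hp, hpm⟩ := T.exists_max_image (fun p => inner ℝ p G) hne
  obtain ⟨q, hq, hqm⟩ := T.exists_min_image (fun p => inner ℝ p G) hne
  refine ⟨p, hp, q, hq, ?_⟩
  rcases eq_or_ne G 0 with rfl | hG
  · simp
  have hG0 : 0 < ‖G‖ := norm_pos_iff.2 hG
  have hu : ‖‖G‖⁻¹ • G‖ = 1 := by simp [norm_smul, hG0.ne']
  have h1 := add_smul_mem_of_closedBall_subset hb hu (r := ρ) (abs_of_pos hρ).le
  have h2 := add_smul_mem_of_closedBall_subset hb hu (r := -ρ) (by rw [abs_neg, abs_of_pos hρ])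
  have hsum : ∀ z, inner ℝ z G = ∑ r ∈ T, bary T r z * inner ℝ r G := by
    intro z
    conv_lhs => rw [← hT.sum_bary_smul z]
    simp [sum_inner, real_inner_smul_left]
  have h3 : inner ℝ (x + ρ • ‖G‖⁻¹ • G) G ≤ inner ℝ p G := by
    rw [hsum (x + ρ • ‖G‖⁻¹ • G), ← one_mul (inner ℝ p G), ← hT.sum_bary (x + ρ • ‖G‖⁻¹ • G), Finset.sum_mul]
    exact Finset.sum_le_sum fun r hr =>
      mul_le_mul_of_nonneg_left (hpm r hr) (hT.mem_cell_iff.1 h1 r hr)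
  have h4 : inner ℝ q G ≤ inner ℝ (x + (-ρ) • ‖G‖⁻¹ • G) G := by
    rw [hsum (x + (-ρ) • ‖G‖⁻¹ • G), ← one_mul (inner ℝ q G), ← hT.sum_bary (x + (-ρ) • ‖G‖⁻¹ • G), Finset.sum_mul]
    exact Finset.sum_le_sum fun r hr =>
      mul_le_mul_of_nonneg_left (hqm r hr) (hT.mem_cell_iff.1 h2 r hr)
  have h5 : ‖G‖⁻¹ * ‖G‖ ^ 2 = ‖G‖ := by field_simp
  simp only [inner_add_left, real_inner_smul_left, real_inner_self_eq_norm_sq, h5] at h3 h4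
  rw [inner_sub_left]
  linarith

/-! ### The bubble field -/

/-- The quadratic bubble matrix of the simplex `T` applied to the field `G`. -/
noncomputable def _root_.DarcyRT.bubble (T : Finset (Euc d)) (z : Euc d) (G : Euc d → Euc d)
    (x : Euc d) : Euc d :=
  ∑ p ∈ T, (bary T p x * inner ℝ (p - z) (G x)) • (p - x)

/-- With the barycentric coordinates as weights of total mass one, the left side is the variance of
`p ↦ ⟨p - z, G⟩`, which does not depend on `z`; the right side is its expression by pairwise
differences. -/
theorem inner_bubble (hT : IsSimplex T) (z : Euc d) (G : Euc d → Euc d) (x : Euc d) :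
    inner ℝ (bubble T z G x) (G x) =
      1 / 2 * ∑ p ∈ T, ∑ q ∈ T, bary T p x * bary T q x * inner ℝ (p - q) (G x) ^ 2 := by
  set a : Euc d → ℝ := fun p => inner ℝ (p - z) (G x) with ha
  set m := ∑ p ∈ T, bary T p x * a p with hm
  set s := ∑ p ∈ T, bary T p x * a p ^ 2 with hs
  have hxz : inner ℝ (x - z) (G x) = m := by
    have : x - z = ∑ p ∈ T, bary T p x • (p - z) := by
      simp only [smul_sub, Finset.sum_sub_distrib, hT.sum_bary_smul, ← Finset.sum_smul,
        hT.sum_bary, one_smul]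
    rw [this, sum_inner]
    simp only [real_inner_smul_left, hm, ha]
  have h1 : inner ℝ (bubble T z G x) (G x) = s - m * m := by
    have : ∀ p, inner ℝ (p - x) (G x) = a p - m := fun p => by
      rw [← hxz, ha, ← inner_sub_left, sub_sub_sub_cancel_right]
    simp only [bubble, sum_inner, real_inner_smul_left, this, hs]
    rw [hm, Finset.sum_mul, ← Finset.sum_sub_distrib]
    exact Finset.sum_congr rfl fun p _ => by ring
  have h2 : ∀ p q : Euc d, inner ℝ (p - q) (G x) = a p - a q := fun p q => by
    rw [ha, ← inner_sub_left, sub_sub_sub_cancel_right]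
  rw [h1]
  simp only [h2]
  have h3 : ∀ p q : Euc d, bary T p x * bary T q x * (a p - a q) ^ 2 =
      bary T p x * a p ^ 2 * bary T q x + bary T p x * (bary T q x * a q ^ 2) -
        2 * (bary T p x * a p * (bary T q x * a q)) := fun p q => by ring
  simp only [h3, Finset.sum_sub_distrib, Finset.sum_add_distrib, ← Finset.mul_sum,
    ← Finset.sum_mul, hT.sum_bary]
  rw [← hm, ← hs]
  ring

theorem norm_bubble_le (hT : IsSimplex T) {z : Euc d} (hz : z ∈ T) (G : Euc d → Euc d) {x : Euc d}
    (hx : x ∈ cell T) : ‖bubble T z G x‖ ≤ Metric.diam (cell T) ^ 2 * ‖G x‖ := by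
  have hv : ∀ p ∈ T, p ∈ cell T := fun p hp => subset_convexHull ℝ _ hp
  have hD : 0 ≤ Metric.diam (cell T) := Metric.diam_nonneg
  have hdist : ∀ y ∈ cell T, ∀ w ∈ cell T, ‖y - w‖ ≤ Metric.diam (cell T) := fun y hy w hw => by
    rw [← dist_eq_norm]
    exact Metric.dist_le_diam_of_mem (isBounded_cell T) hy hw
  calc ‖bubble T z G x‖ ≤ ∑ p ∈ T, ‖(bary T p x * inner ℝ (p - z) (G x)) • (p - x)‖ :=
        norm_sum_le _ _
    _ ≤ ∑ p ∈ T, bary T p x * (Metric.diam (cell T) ^ 2 * ‖G x‖) := by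
        refine Finset.sum_le_sum fun p hp => ?_
        have hb := hT.mem_cell_iff.1 hx p hp
        rw [norm_smul, norm_mul, Real.norm_eq_abs, Real.norm_eq_abs, abs_of_nonneg hb, mul_assoc]
        refine mul_le_mul_of_nonneg_left ?_ hb
        have h1 : |inner ℝ (p - z) (G x)| ≤ Metric.diam (cell T) * ‖G x‖ :=
          (abs_real_inner_le_norm _ _).trans
            (mul_le_mul_of_nonneg_right (hdist p (hv p hp) z (hv z hz)) (norm_nonneg _))
        calc _ ≤ (Metric.diam (cell T) * ‖G x‖) * Metric.diam (cell T) :=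
              mul_le_mul h1 (hdist p (hv p hp) x hx) (norm_nonneg _) (by positivity)
          _ = _ := by ring
    _ = _ := by rw [← Finset.sum_mul, hT.sum_bary, one_mul]

/-- The bubble inequality removes the weights `λ_p λ_q` from the sum of squares, and at every point
one pair of vertices realizes the width of `T` in the direction of `G`. -/
theorem exists_bubble_coercive (d m : ℕ) (hd : 2 ≤ d) : ∃ c : ℝ, 0 < c ∧
    ∀ (T : Finset (Euc d)), IsSimplex T → ∀ z : Euc d, ∀ x₀ : Euc d, ∀ ρ : ℝ, 0 < ρ →
      Metric.closedBall x₀ ρ ⊆ cell T → ∀ G : Euc d → Euc d,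
      (∀ e, PolyLE m fun x => inner ℝ e (G x)) → Continuous G →
      c * ρ ^ 2 * ∫ x in cell T, ‖G x‖ ^ 2 ≤
        ∫ x in cell T, inner ℝ (bubble T z G x) (G x) := by
  obtain ⟨C, hC, h⟩ := exists_bubble_inequality d m hd
  -- The factor 2 is the product of `1/2` in `inner_bubble` and of 4 in `(2ρ)²`.
  refine ⟨2 * C⁻¹, by positivity, fun T hT z x₀ ρ hρ hball G hG hGc => ?_⟩
  have hbc := continuous_bary T
  have hint : ∀ p q : Euc d, IntegrableOn
      (fun x => bary T p x * bary T q x * inner ℝ (p - q) (G x) ^ 2) (cell T) := fun p q =>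
    integrableOn_cell (by have := hbc p; have := hbc q; fun_prop) T
  have hint2 : ∀ p q : Euc d, IntegrableOn (fun x => inner ℝ (p - q) (G x) ^ 2) (cell T) :=
    fun p q => integrableOn_cell (by fun_prop) T
  have e1 : ∫ x in cell T, inner ℝ (bubble T z G x) (G x) = 1 / 2 * ∑ p ∈ T, ∑ q ∈ T,
      ∫ x in cell T, bary T p x * bary T q x * inner ℝ (p - q) (G x) ^ 2 := by
    simp only [hT.inner_bubble]
    rw [integral_const_mul, integral_finsetSum _ fun p _ => integrable_finsetSum _ fun q _ => hint p q]
    congr 1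
    refine Finset.sum_congr rfl fun p _ => integral_finsetSum _ fun q _ => hint p q
  have e2 : ∀ p ∈ T, ∀ q ∈ T, C⁻¹ * ∫ x in cell T, inner ℝ (p - q) (G x) ^ 2 ≤
      ∫ x in cell T, bary T p x * bary T q x * inner ℝ (p - q) (G x) ^ 2 := by
    intro p hp q hq
    rcases eq_or_ne p q with rfl | hpq
    · simp
    · rw [inv_mul_le_iff₀ hC]
      exact h T hT p hp q hq hpq _ (hG _)
  have e3 : ∫ x in cell T, (2 * ρ) ^ 2 * ‖G x‖ ^ 2 ≤
      ∑ p ∈ T, ∑ q ∈ T, ∫ x in cell T, inner ℝ (p - q) (G x) ^ 2 := by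
    have : ∑ p ∈ T, ∑ q ∈ T, ∫ x in cell T, inner ℝ (p - q) (G x) ^ 2 =
        ∫ x in cell T, ∑ p ∈ T, ∑ q ∈ T, inner ℝ (p - q) (G x) ^ 2 := by
      rw [integral_finsetSum _ fun p _ => integrable_finsetSum _ fun q _ => hint2 p q]
      exact Finset.sum_congr rfl fun p _ => (integral_finsetSum _ fun q _ => hint2 p q).symm
    rw [this]
    refine setIntegral_mono (integrableOn_cell (by fun_prop) T)
      (integrable_finsetSum _ fun p _ => integrable_finsetSum _ fun q _ => hint2 p q) fun x => ?_
    obtain ⟨p, hp, q, hq, hpq⟩ := hT.exists_width hρ hball (G x)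
    calc (2 * ρ) ^ 2 * ‖G x‖ ^ 2 = (2 * ρ * ‖G x‖) ^ 2 := by ring
      _ ≤ inner ℝ (p - q) (G x) ^ 2 := pow_le_pow_left₀ (by positivity) hpq 2
      _ ≤ ∑ q ∈ T, inner ℝ (p - q) (G x) ^ 2 :=
        Finset.single_le_sum (f := fun q => inner ℝ (p - q) (G x) ^ 2)
          (fun _ _ => sq_nonneg _) hq
      _ ≤ _ := Finset.single_le_sum (f := fun p => ∑ q ∈ T, inner ℝ (p - q) (G x) ^ 2)
          (fun _ _ => Finset.sum_nonneg fun _ _ => sq_nonneg _) hp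
  rw [integral_const_mul] at e3
  rw [e1]
  have e4 := Finset.sum_le_sum fun p hp => Finset.sum_le_sum fun q hq => e2 p hp q hq
  simp only [← Finset.mul_sum] at e4
  have e5 := mul_le_mul_of_nonneg_left e3 (inv_pos.2 hC).le
  nlinarith

end IsSimplex

end DarcyRT

namespace DarcyRT

variable {d : ℕ}

/-! ### The geometry of triangulations -/

/-- Conformity puts a common point of two faces into the hull of their common vertices; a vertex
with nonzero coordinate there must then be shared. -/
theorem IsSimplex.exists_bary_eq_zero {T : Finset (Euc d)} (hT : IsSimplex T) {s : Finset (Euc d)}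
    {x : Euc d} (hx : x ∈ convexHull ℝ ((T : Set (Euc d)) ∩ s)) :
    ∀ q ∈ T, bary T q x ≠ 0 → q ∈ s := by
  classical
  intro q hq hqx
  rw [← Finset.coe_inter] at hx
  by_contra hqs
  exact hqx (((hT.mem_cell_of_subset_iff Finset.inter_subset_left).1 hx).2 q hq
    fun h => hqs (Finset.mem_inter.1 h).2)

/-- The relative interior of the side of `T` opposite to `p`. -/
def relint (T : Finset (Euc d)) (p : Euc d) : Set (Euc d) :=
  {x | bary T p x = 0 ∧ ∀ q ∈ T.erase p, 0 < bary T q x}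

theorem IsSimplex.relint_subset {T : Finset (Euc d)} (hT : IsSimplex T) {p : Euc d} (hp : p ∈ T) :
    relint T p ⊆ cell (T.erase p) := by
  intro x hx
  rw [hT.mem_side_iff hp]
  refine ⟨fun q hq => ?_, hx.1⟩
  by_cases hqp : q = p
  · rw [hqp, hx.1]
  · exact (hx.2 q (Finset.mem_erase.2 ⟨hqp, hq⟩)).le

theorem IsSimplex.ae_mem_relint {T : Finset (Euc d)} (hT : IsSimplex T) (hd : 2 ≤ d) {p : Euc d}
    (hp : p ∈ T) :
    ∀ᵐ x ∂(μHE[d - 1] : Measure (Euc d)).restrict (cell (T.erase p)), x ∈ relint T p := by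
  rw [ae_restrict_iff' (IsSimplex.measurableSet_cell _)]
  have h : ∀ q ∈ T.erase p, ∀ᵐ x ∂(μHE[d - 1] : Measure (Euc d)),
      ¬ (x ∈ cell (T.erase p) ∩ {x | bary T q x = 0}) := fun q hq =>
    measure_eq_zero_iff_ae_notMem.1 (hT.measure_side_bary_eq_zero hd hp hq)
  filter_upwards [(Filter.eventually_all_finset _).2 h] with x hx hxc
  have hm := (hT.mem_side_iff hp).1 hxc
  refine ⟨hm.2, fun q hq => lt_of_le_of_ne (hm.1 q (Finset.mem_of_mem_erase hq)) fun h0 => ?_⟩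
  exact hx q hq ⟨hxc, h0.symm⟩

/-! ### Incidence of elements, sides and the domain. -/

namespace Triangulation

variable {Ω : Set (Euc d)} (𝒯 : Triangulation Ω)

theorem mem_elements {T : Finset (Euc d)} : T ∈ 𝒯.elements ↔ T ∈ 𝒯.faces ∧ T.card = d + 1 := by
  simp [elements]

theorem mem_sides {σ : Finset (Euc d)} : σ ∈ 𝒯.sides ↔ σ ∈ 𝒯.faces ∧ σ.card = d := by
  simp [sides]

theorem isSimplex {T : Finset (Euc d)} (hT : T ∈ 𝒯.elements) : IsSimplex T :=
  ⟨𝒯.indep (𝒯.mem_elements.1 hT).1, (𝒯.mem_elements.1 hT).2⟩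

theorem erase_mem_sides (hd : 2 ≤ d) {T : Finset (Euc d)} (hT : T ∈ 𝒯.elements) {p : Euc d}
    (hp : p ∈ T) : T.erase p ∈ 𝒯.sides := by
  have hc : (T.erase p).card = d := by
    rw [Finset.card_erase_of_mem hp, (𝒯.mem_elements.1 hT).2, Nat.add_sub_cancel]
  refine 𝒯.mem_sides.2 ⟨?_, hc⟩
  exact 𝒯.down_closed (𝒯.mem_elements.1 hT).1 (Finset.erase_subset _ _)
    (Finset.card_pos.1 (by omega))

theorem exists_erase_eq {T σ : Finset (Euc d)} (hT : T ∈ 𝒯.elements) (hσ : σ ∈ 𝒯.sides)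
    (h : σ ⊆ T) : ∃ p ∈ T, σ = T.erase p := by
  have h1 := (𝒯.mem_elements.1 hT).2
  have h2 := (𝒯.mem_sides.1 hσ).2
  obtain ⟨p, hp, hpσ⟩ := Finset.exists_mem_notMem_of_card_lt_card (show σ.card < T.card by omega)
  refine ⟨p, hp, Finset.eq_of_subset_of_card_le (fun q hq => Finset.mem_erase.2
    ⟨fun hqp => hpσ (hqp ▸ hq), h hq⟩) ?_⟩
  rw [Finset.card_erase_of_mem hp]; omega

/-- The element from which the normal component on the side `σ` is computed. -/
noncomputable def owner (σ : Finset (Euc d)) : Finset (Euc d) :=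
  Classical.epsilon fun T : Finset (Euc d) => T ∈ 𝒯.elements ∧ σ ⊆ T

theorem owner_spec {σ : Finset (Euc d)} (hσ : σ ∈ 𝒯.sides) :
    𝒯.owner σ ∈ 𝒯.elements ∧ σ ⊆ 𝒯.owner σ := by
  obtain ⟨T, hT, hσT, hc⟩ := 𝒯.pure_dim σ (𝒯.mem_sides.1 hσ).1
  exact Classical.epsilon_spec (p := fun T : Finset (Euc d) => T ∈ 𝒯.elements ∧ σ ⊆ T)
    ⟨T, 𝒯.mem_elements.2 ⟨hT, hc⟩, hσT⟩

open Classical in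
/-- The elements having `σ` as a side. -/
noncomputable def neighbors (σ : Finset (Euc d)) : Finset (Finset (Euc d)) :=
  {T ∈ 𝒯.elements | σ ⊆ T}

theorem mem_neighbors {σ T : Finset (Euc d)} :
    T ∈ 𝒯.neighbors σ ↔ T ∈ 𝒯.elements ∧ σ ⊆ T := by
  simp [neighbors]

theorem owner_mem_neighbors {σ : Finset (Euc d)} (hσ : σ ∈ 𝒯.sides) :
    𝒯.owner σ ∈ 𝒯.neighbors σ := 𝒯.mem_neighbors.2 (𝒯.owner_spec hσ)

theorem sum_elements_sides (hd : 2 ≤ d) {M : Type*} [AddCommMonoid M]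
    (F : Finset (Euc d) → Finset (Euc d) → M) :
    ∑ T ∈ 𝒯.elements, ∑ p ∈ T, F T (T.erase p) =
      ∑ σ ∈ 𝒯.sides, ∑ T ∈ 𝒯.neighbors σ, F T σ := by
  classical
  have h1 : ∀ T ∈ 𝒯.elements, ∑ p ∈ T, F T (T.erase p) =
      ∑ σ ∈ 𝒯.sides with σ ⊆ T, F T σ := by
    intro T hT
    refine Finset.sum_nbij (fun p => T.erase p) (fun p hp => ?_) (fun p hp q hq hpq => ?_)
      (fun σ hσ => ?_) fun _ _ => rfl
    · exact Finset.mem_filter.2 ⟨𝒯.erase_mem_sides hd hT hp, Finset.erase_subset _ _⟩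
    · by_contra hne
      have : p ∈ T.erase q := Finset.mem_erase.2 ⟨hne, hp⟩
      rw [← show T.erase p = T.erase q from hpq] at this
      simp at this
    · obtain ⟨hσ, hσT⟩ := Finset.mem_filter.1 hσ
      obtain ⟨p, hp, rfl⟩ := 𝒯.exists_erase_eq hT hσ hσT
      exact ⟨p, hp, rfl⟩
  rw [Finset.sum_congr rfl h1]
  refine Finset.sum_comm' fun T σ => ?_
  simp only [Finset.mem_filter, mem_neighbors]
  tauto

/-- A face containing a point of the relative interior of a side contains the side. -/
theorem erase_subset_of_mem_relint {T s : Finset (Euc d)} (hT : T ∈ 𝒯.elements)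
    (hs : s ∈ 𝒯.faces) {p x : Euc d} (hp : p ∈ T) (hx : x ∈ relint T p) (hxs : x ∈ cell s) :
    T.erase p ⊆ s := by
  have hTs := 𝒯.isSimplex hT
  have hxT : x ∈ cell T :=
    convexHull_mono (by exact_mod_cast Finset.erase_subset _ _) (hTs.relint_subset hp hx)
  have h := 𝒯.inter_subset_convexHull (𝒯.mem_elements.1 hT).1 hs ⟨hxT, hxs⟩
  intro q hq
  exact hTs.exists_bary_eq_zero h q (Finset.mem_of_mem_erase hq) (hx.2 q hq).ne'

theorem exists_mem_relint (hd : 2 ≤ d) {T : Finset (Euc d)} (hT : T ∈ 𝒯.elements) {p : Euc d}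
    (hp : p ∈ T) : ∃ x, x ∈ relint T p := by
  have hTs := 𝒯.isSimplex hT
  obtain ⟨y, hy⟩ := hTs.interior_nonempty
  have hy0 := hTs.mem_interior_iff.1 hy
  have hy1 : bary T p y < 1 := by
    obtain ⟨q, hq, hqp⟩ := hTs.exists_mem_ne hd p
    have h := hTs.sum_bary y
    rw [← Finset.add_sum_erase T _ hp] at h
    have : 0 < ∑ r ∈ T.erase p, bary T r y := Finset.sum_pos
      (fun r hr => hy0 r (Finset.mem_of_mem_erase hr)) ⟨q, Finset.mem_erase.2 ⟨hqp, hq⟩⟩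
    linarith
  -- The central projection from `p` of an interior point onto the opposite side.
  refine ⟨p + (1 - bary T p y)⁻¹ • (y - p), ?_, fun q hq => ?_⟩
  · rw [bary_line, hTs.bary_self hp]
    field_simp [(sub_pos.2 hy1).ne']
    ring
  · rw [bary_line, hTs.bary_of_ne hp (Finset.ne_of_mem_erase hq), mul_zero, zero_add]
    exact mul_pos (inv_pos.2 (sub_pos.2 hy1)) (hy0 q (Finset.mem_of_mem_erase hq))

/-- Two elements sharing a side lie on different sides of it. -/
theorem exists_bary_eq_neg_mul (hd : 2 ≤ d) {T₁ T₂ : Finset (Euc d)} (h₁ : T₁ ∈ 𝒯.elements)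
    (h₂ : T₂ ∈ 𝒯.elements) (hne : T₁ ≠ T₂) {p₁ p₂ : Euc d} (hp₁ : p₁ ∈ T₁) (hp₂ : p₂ ∈ T₂)
    (he : T₁.erase p₁ = T₂.erase p₂) :
    ∃ α : ℝ, 0 < α ∧ ∀ x, bary T₁ p₁ x = -(α * bary T₂ p₂ x) := by
  have hs₁ := 𝒯.isSimplex h₁
  have hs₂ := 𝒯.isSimplex h₂
  -- Both coordinates are affine and vanish at the vertices of the common side, so they are
  -- proportional.
  have hcomb : ∀ x, bary T₁ p₁ x = bary T₁ p₁ p₂ * bary T₂ p₂ x := by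
    intro x
    have h0 : bary T₁ p₁ x = ∑ q ∈ T₂, bary T₂ q x * bary T₁ p₁ q := by
      have e : ∀ y, bary T₁ p₁ y = bary T₁ p₁ 0 + inner ℝ (baryGrad T₁ p₁) y := fun y => by
        rw [← bary_add, zero_add]
      conv_lhs => rw [e x, ← hs₂.sum_bary_smul x]
      simp only [inner_sum, inner_smul_right]
      rw [← one_mul (bary T₁ p₁ 0), ← hs₂.sum_bary x, Finset.sum_mul, ← Finset.sum_add_distrib]
      exact Finset.sum_congr rfl fun q _ => by rw [e q]; ring
    rw [h0, Finset.sum_eq_single_of_mem p₂ hp₂, mul_comm]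
    intro q hq hqp
    have hq1 : q ∈ T₁.erase p₁ := he ▸ Finset.mem_erase.2 ⟨hqp, hq⟩
    obtain ⟨hqp₁, hqT₁⟩ := Finset.mem_erase.1 hq1
    rw [hs₁.bary_of_ne hqT₁ hqp₁.symm, mul_zero]
  have hα0 : bary T₁ p₁ p₂ ≠ 0 := by
    intro h
    have := hcomb p₁
    rw [hs₁.bary_self hp₁, h, zero_mul] at this
    exact one_ne_zero this
  refine ⟨-bary T₁ p₁ p₂, ?_, fun x => by rw [hcomb]; ring⟩
  rw [neg_pos]
  -- If `p₂` were on the same side as `p₁`, a small step from the relative interior of the side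
  -- towards `p₂` would stay in both elements with `λ_{p₁} > 0`; conformity would make `p₁` a vertex
  -- of `T₂` and the elements equal.
  refine lt_of_le_of_ne (le_of_not_gt fun hpos => ?_) hα0
  obtain ⟨c, hc⟩ := 𝒯.exists_mem_relint hd h₁ hp₁
  have hc2 : c ∈ cell T₂ := convexHull_mono
    (by rw [he]; exact_mod_cast Finset.erase_subset _ _) (hs₁.relint_subset hp₁ hc)
  have hp2c : p₂ ∈ cell T₂ := subset_convexHull ℝ _ hp₂
  have hev : ∀ᶠ t : ℝ in nhdsWithin 0 (Set.Ioi 0), ∀ q ∈ T₁.erase p₁,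
      0 < bary T₁ q (c + t • (p₂ - c)) := by
    refine (Filter.eventually_all_finset _).2 fun q hq => ?_
    have hcont : Continuous fun t : ℝ => bary T₁ q (c + t • (p₂ - c)) :=
      (continuous_bary T₁ q).comp (by fun_prop)
    have := hcont.tendsto 0
    simp only [zero_smul, add_zero] at this
    exact (this.eventually (lt_mem_nhds (hc.2 q hq))).filter_mono nhdsWithin_le_nhds
  have hev2 : ∀ᶠ t : ℝ in nhdsWithin 0 (Set.Ioi 0), t ∈ Set.Ioo (0 : ℝ) 1 :=
    Ioo_mem_nhdsGT zero_lt_one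
  obtain ⟨t, ht, ht01⟩ := (hev.and hev2).exists
  have hb1 : 0 < bary T₁ p₁ (c + t • (p₂ - c)) := by
    rw [bary_line, hc.1, mul_zero, zero_add]
    exact mul_pos ht01.1 hpos
  have hx1 : c + t • (p₂ - c) ∈ cell T₁ := by
    rw [hs₁.mem_cell_iff]
    intro q hq
    by_cases hqp : q = p₁
    · rw [hqp]; exact hb1.le
    · exact (ht q (Finset.mem_erase.2 ⟨hqp, hq⟩)).le
  have hx2 : c + t • (p₂ - c) ∈ cell T₂ :=
    (convex_convexHull ℝ _).add_smul_sub_mem hc2 hp2c ⟨ht01.1.le, ht01.2.le⟩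
  have hmem := 𝒯.inter_subset_convexHull (𝒯.mem_elements.1 h₁).1 (𝒯.mem_elements.1 h₂).1
    ⟨hx1, hx2⟩
  have hp₁T₂ := hs₁.exists_bary_eq_zero hmem p₁ hp₁ hb1.ne'
  apply hne
  refine Finset.eq_of_subset_of_card_le (fun q hq => ?_) (by rw [hs₁.card_eq, hs₂.card_eq])
  by_cases hqp : q = p₁
  · rwa [hqp]
  · exact Finset.mem_of_mem_erase (he ▸ Finset.mem_erase.2 ⟨hqp, hq⟩)

theorem outwardNormal_eq_neg (hd : 2 ≤ d) {T₁ T₂ σ : Finset (Euc d)} (hσ : σ ∈ 𝒯.sides)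
    (h₁ : T₁ ∈ 𝒯.neighbors σ) (h₂ : T₂ ∈ 𝒯.neighbors σ) (hne : T₁ ≠ T₂) :
    outwardNormal T₂ σ = -outwardNormal T₁ σ := by
  rw [mem_neighbors] at h₁ h₂
  obtain ⟨p₁, hp₁, rfl⟩ := 𝒯.exists_erase_eq h₁.1 hσ h₁.2
  obtain ⟨p₂, hp₂, he⟩ := 𝒯.exists_erase_eq h₂.1 hσ h₂.2
  have hs₁ := 𝒯.isSimplex h₁.1
  have hs₂ := 𝒯.isSimplex h₂.1
  obtain ⟨α, hα, hbary⟩ := 𝒯.exists_bary_eq_neg_mul hd h₁.1 h₂.1 hne hp₁ hp₂ he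
  rw [he, hs₂.outwardNormal_eq hd hp₂, ← he, hs₁.outwardNormal_eq hd hp₁]
  have hg : baryGrad T₁ p₁ = -(α • baryGrad T₂ p₂) := by
    refine ext_inner_right ℝ fun v => ?_
    have h1 := bary_sub T₁ p₁ v 0
    have h2 := bary_sub T₂ p₂ v 0
    rw [sub_zero] at h1 h2
    rw [← h1, inner_neg_left, real_inner_smul_left, ← h2, hbary, hbary]; ring
  have hn : ‖baryGrad T₁ p₁‖ = α * ‖baryGrad T₂ p₂‖ := by
    rw [hg, norm_neg, norm_smul, Real.norm_eq_abs, abs_of_pos hα]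
  rw [height, height, hn, hg, smul_neg, neg_neg, smul_smul, mul_inv, mul_right_comm,
    inv_mul_cancel₀ hα.ne', one_mul]

/-- A side belongs to one or two elements. -/
theorem neighbors_eq (hd : 2 ≤ d) {σ T₁ : Finset (Euc d)} (hσ : σ ∈ 𝒯.sides)
    (h₁ : T₁ ∈ 𝒯.neighbors σ) :
    𝒯.neighbors σ = {T₁} ∨ ∃ T₂, T₂ ≠ T₁ ∧ 𝒯.neighbors σ = {T₁, T₂} := by
  by_cases h : ∃ T₂ ∈ 𝒯.neighbors σ, T₂ ≠ T₁
  · obtain ⟨T₂, h₂, hne⟩ := h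
    refine Or.inr ⟨T₂, hne, Finset.Subset.antisymm (fun T₃ h₃ => ?_) ?_⟩
    · by_contra hT₃
      simp only [Finset.mem_insert, Finset.mem_singleton, not_or] at hT₃
      -- Three elements would have pairwise opposite unit normals on `σ`, forcing `n = -n`.
      have e1 := 𝒯.outwardNormal_eq_neg hd hσ h₁ h₂ hne.symm
      have e2 := 𝒯.outwardNormal_eq_neg hd hσ h₁ h₃ (Ne.symm hT₃.1)
      have e3 := 𝒯.outwardNormal_eq_neg hd hσ h₂ h₃ (Ne.symm hT₃.2)
      rw [e1, neg_neg] at e3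
      obtain ⟨p, hp, rfl⟩ := 𝒯.exists_erase_eq (𝒯.mem_neighbors.1 h₁).1 hσ (𝒯.mem_neighbors.1 h₁).2
      have hn := (𝒯.isSimplex (𝒯.mem_neighbors.1 h₁).1).norm_outwardNormal hd hp
      have h0 : outwardNormal T₁ (T₁.erase p) = 0 := by
        have := e3.symm.trans e2
        rw [eq_neg_iff_add_eq_zero, ← two_smul ℝ, smul_eq_zero] at this
        exact this.resolve_left two_ne_zero
      rw [h0, norm_zero] at hn
      exact zero_ne_one hn
    · intro T hT
      rcases Finset.mem_insert.1 hT with rfl | hT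
      · exact h₁
      · rwa [Finset.mem_singleton.1 hT]
  · push Not at h
    exact Or.inl (Finset.eq_singleton_iff_unique_mem.2 ⟨h₁, h⟩)

theorem space_eq_biUnion : closure Ω = ⋃ T ∈ 𝒯.elements, cell T := by
  rw [← 𝒯.space_eq]
  refine Set.Subset.antisymm (fun x hx => ?_) (fun x hx => ?_)
  · obtain ⟨s, hs, hxs⟩ := Geometry.SimplicialComplex.mem_space_iff.1 hx
    obtain ⟨T, hT, hsT, hc⟩ := 𝒯.pure_dim s hs
    exact Set.mem_biUnion (𝒯.mem_elements.2 ⟨hT, hc⟩) (convexHull_mono (by exact_mod_cast hsT) hxs)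
  · obtain ⟨T, hT, hxT⟩ := Set.mem_iUnion₂.1 hx
    exact Geometry.SimplicialComplex.convexHull_subset_space (𝒯.mem_elements.1 hT).1 hxT

theorem cell_subset {T : Finset (Euc d)} (hT : T ∈ 𝒯.elements) : cell T ⊆ closure Ω := by
  rw [𝒯.space_eq_biUnion]
  exact Set.subset_biUnion_of_mem (u := fun T : Finset (Euc d) => cell T) hT

theorem interior_subset (hΩ : IsPolyhedralDomain Ω) {T : Finset (Euc d)} (hT : T ∈ 𝒯.elements) :
    interior (cell T) ⊆ Ω := by
  rw [← hΩ.interior_closure]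
  exact interior_mono (𝒯.cell_subset hT)

/-- The relative interior of a side of two elements lies in the domain. -/
theorem relint_subset_domain (hΩ : IsPolyhedralDomain Ω) (hd : 2 ≤ d) {T₁ T₂ : Finset (Euc d)}
    (h₁ : T₁ ∈ 𝒯.elements) (h₂ : T₂ ∈ 𝒯.elements) (hne : T₁ ≠ T₂) {p₁ : Euc d} (hp₁ : p₁ ∈ T₁)
    (he : T₁.erase p₁ ⊆ T₂) : relint T₁ p₁ ⊆ Ω := by
  intro x hx
  have hs₁ := 𝒯.isSimplex h₁
  have hs₂ := 𝒯.isSimplex h₂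
  obtain ⟨p₂, hp₂, he⟩ := 𝒯.exists_erase_eq h₂ (𝒯.erase_mem_sides hd h₁ hp₁) he
  obtain ⟨α, hα, hbary⟩ := 𝒯.exists_bary_eq_neg_mul hd h₁ h₂ hne hp₁ hp₂ he
  have hxc := hs₁.relint_subset hp₁ hx
  -- If one of these coordinates vanished, `x` would lie in a smaller face of the common side,
  -- contrary to its being in the relative interior.
  have hx2 : ∀ q ∈ T₂.erase p₂, 0 < bary T₂ q x := by
    intro q hq
    have hxT₂ : x ∈ cell T₂ := convexHull_mono
      (by rw [he]; exact_mod_cast Finset.erase_subset _ _) hxc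
    refine lt_of_le_of_ne (hs₂.mem_cell_iff.1 hxT₂ q (Finset.mem_of_mem_erase hq)) fun h0 => ?_
    have hx' : x ∈ cell ((T₁.erase p₁).erase q) := by
      rw [hs₂.mem_cell_of_subset_iff
        (((Finset.erase_subset _ _).trans he.subset).trans (Finset.erase_subset _ _))]
      refine ⟨hs₂.mem_cell_iff.1 hxT₂, fun r hr hrn => ?_⟩
      by_cases hrq : r = q
      · rw [hrq, ← h0]
      · by_cases hrp : r = p₂
        · have := hbary x
          rw [hx.1, eq_comm, neg_eq_zero, mul_eq_zero] at this
          rw [hrp]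
          exact this.resolve_left hα.ne'
        · exact absurd (Finset.mem_erase.2 ⟨hrq, he ▸ Finset.mem_erase.2 ⟨hrp, hr⟩⟩) hrn
    have hq1 : q ∈ T₁.erase p₁ := he ▸ hq
    exact (hx.2 q hq1).ne' (((hs₁.mem_cell_of_subset_iff
      ((Finset.erase_subset _ _).trans (Finset.erase_subset _ _))).1 hx').2 q
      (Finset.mem_of_mem_erase hq1) (by simp))
  rw [← hΩ.interior_closure, mem_interior_iff_mem_nhds]
  have ev : ∀ (T : Finset (Euc d)) (p : Euc d), (∀ q ∈ T.erase p, 0 < bary T q x) →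
      ∀ᶠ z in nhds x, ∀ q ∈ T.erase p, 0 < bary T q z := fun T p h =>
    (Filter.eventually_all_finset _).2 fun q hq =>
      ((continuous_bary T q).tendsto x).eventually (lt_mem_nhds (h q hq))
  filter_upwards [ev T₁ p₁ hx.2, ev T₂ p₂ hx2] with z hz₁ hz₂
  -- Near `x` only the opposite coordinates can change sign, and they have opposite signs; so the
  -- two elements cover a neighbourhood of `x`, which is thus interior to the closure of `Ω`.
  rcases le_total 0 (bary T₁ p₁ z) with h0 | h0
  · refine 𝒯.cell_subset h₁ (hs₁.mem_cell_iff.2 fun q hq => ?_)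
    by_cases hqp : q = p₁
    · rwa [hqp]
    · exact (hz₁ q (Finset.mem_erase.2 ⟨hqp, hq⟩)).le
  · refine 𝒯.cell_subset h₂ (hs₂.mem_cell_iff.2 fun q hq => ?_)
    by_cases hqp : q = p₂
    · rw [hqp]
      have := hbary z
      by_contra hneg
      push Not at hneg
      nlinarith [mul_pos hα (neg_pos.2 hneg)]
    · exact (hz₂ q (Finset.mem_erase.2 ⟨hqp, hq⟩)).le

/-- The relative interior of a side of only one element does not meet the domain. -/
theorem notMem_of_mem_relint (hΩ : IsPolyhedralDomain Ω) {T : Finset (Euc d)}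
    (hT : T ∈ 𝒯.elements) {p : Euc d} (hp : p ∈ T) (hσ : 𝒯.neighbors (T.erase p) = {T}) {x : Euc d}
    (hx : x ∈ relint T p) : x ∉ Ω := by
  intro hxΩ
  have hs := 𝒯.isSimplex hT
  -- Near `x` no other element is present; were `x` in `Ω`, it would be interior to `T`, although
  -- `λ_p` vanishes there.
  have hev : ∀ᶠ z in nhds x, ∀ T' ∈ 𝒯.elements, T' ≠ T → z ∉ cell T' := by
    refine (Filter.eventually_all_finset _).2 fun T' hT' => ?_
    by_cases hne : T' = T
    · simp [hne]
    have hxT' : x ∉ cell T' := by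
      intro hxT'
      have := 𝒯.erase_subset_of_mem_relint hT (𝒯.mem_elements.1 hT').1 hp hx hxT'
      have hm := 𝒯.mem_neighbors.2 ⟨hT', this⟩
      rw [hσ, Finset.mem_singleton] at hm
      exact hne hm
    have := (IsSimplex.isCompact_cell T').isClosed.isOpen_compl.mem_nhds hxT'
    filter_upwards [this] with z hz _ using hz
  have hint : x ∈ interior (cell T) := by
    rw [mem_interior_iff_mem_nhds]
    filter_upwards [hev, hΩ.isOpen.mem_nhds hxΩ] with z hz hzΩ
    have hzc := subset_closure hzΩ
    rw [𝒯.space_eq_biUnion] at hzc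
    obtain ⟨T', hT', hzT'⟩ := Set.mem_iUnion₂.1 hzc
    by_cases hne : T' = T
    · rwa [← hne]
    · exact absurd hzT' (hz T' hT' hne)
  exact (hs.mem_interior_iff.1 hint p hp).ne' hx.1

theorem disjoint_interior {T₁ T₂ : Finset (Euc d)} (h₁ : T₁ ∈ 𝒯.elements) (h₂ : T₂ ∈ 𝒯.elements)
    (hne : T₁ ≠ T₂) : Disjoint (interior (cell T₁)) (interior (cell T₂)) := by
  rw [Set.disjoint_left]
  intro x hx₁ hx₂
  have hs₁ := 𝒯.isSimplex h₁
  have hmem := 𝒯.inter_subset_convexHull (𝒯.mem_elements.1 h₁).1 (𝒯.mem_elements.1 h₂).1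
    ⟨_root_.interior_subset hx₁, _root_.interior_subset hx₂⟩
  refine hne (Finset.eq_of_subset_of_card_le (fun q hq => ?_)
    (by rw [hs₁.card_eq, (𝒯.isSimplex h₂).card_eq]))
  exact hs₁.exists_bary_eq_zero hmem q hq (hs₁.mem_interior_iff.1 hx₁ q hq).ne'

theorem interior_ae_eq (s : Finset (Euc d)) :
    interior (cell s) =ᵐ[volume] cell s :=
  (convex_convexHull ℝ _).addHaar_frontier volume |> interior_ae_eq_of_null_frontier

theorem domain_ae_eq (hΩ : IsPolyhedralDomain Ω) :
    (⋃ T ∈ 𝒯.elements, interior (cell T)) =ᵐ[volume] Ω := by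
  refine Filter.EventuallyLE.antisymm
    (LE.le.eventuallyLE (Set.iUnion₂_subset fun T hT => 𝒯.interior_subset hΩ hT)) ?_
  have h : ∀ T ∈ 𝒯.elements, ∀ᵐ x, ¬ (x ∈ frontier (cell T)) := fun T _ =>
    measure_eq_zero_iff_ae_notMem.1 ((convex_convexHull ℝ _).addHaar_frontier volume)
  filter_upwards [(Filter.eventually_all_finset _).2 h] with x hx hxΩ
  have hxc := subset_closure hxΩ
  rw [𝒯.space_eq_biUnion] at hxc
  obtain ⟨T, hT, hxT⟩ := Set.mem_iUnion₂.1 hxc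
  refine Set.mem_biUnion hT ?_
  by_contra hni
  exact hx T hT ⟨subset_closure hxT, hni⟩

theorem integral_domain (hΩ : IsPolyhedralDomain Ω) {F : Euc d → ℝ}
    (hF : ∀ T ∈ 𝒯.elements, IntegrableOn F (interior (cell T))) :
    ∫ x in Ω, F x = ∑ T ∈ 𝒯.elements, ∫ x in interior (cell T), F x := by
  rw [← setIntegral_congr_set (𝒯.domain_ae_eq hΩ)]
  exact integral_biUnion_finset _ (fun T _ => isOpen_interior.measurableSet)
    (fun T₁ h₁ T₂ h₂ hne => 𝒯.disjoint_interior h₁ h₂ hne) hF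

theorem elements_nonempty (hΩ : IsPolyhedralDomain Ω) : 𝒯.elements.Nonempty := by
  obtain ⟨x, hx⟩ := hΩ.isConnected.nonempty
  have hxc := subset_closure hx
  rw [𝒯.space_eq_biUnion] at hxc
  obtain ⟨T, hT, -⟩ := Set.mem_iUnion₂.1 hxc
  exact ⟨T, hT⟩

end Triangulation

end DarcyRT

namespace DarcyRT

variable {d : ℕ}

/-! ### Raviart–Thomas fields and broken polynomials -/

/-- `w` belongs to `[P_ℓ]^d + x P_ℓ`. -/
def RTField (ℓ : ℕ) (w : Euc d → Euc d) : Prop :=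
  ∃ (P : Fin d → Euc d → ℝ) (s : Euc d → ℝ), (∀ i, PolyLE ℓ (P i)) ∧ PolyLE ℓ s ∧
    ∀ x i, w x i = P i x + x i * s x

namespace RTField

variable {ℓ : ℕ} {w w' : Euc d → Euc d}

theorem polyLE_coord (hw : RTField ℓ w) (i : Fin d) : PolyLE (ℓ + 1) fun x => w x i := by
  obtain ⟨P, s, hP, hs, h⟩ := hw
  simp only [h]
  refine ((hP i).mono (Nat.le_succ ℓ)).add ?_
  simpa only [add_comm 1 ℓ] using (PolyLE.coord i).mul hs

theorem polyLE_inner (hw : RTField ℓ w) (e : Euc d) :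
    PolyLE (ℓ + 1) fun x => inner ℝ e (w x) := by
  simp only [PiLp.inner_apply]
  exact PolyLE.sum _ fun i _ => by simpa [mul_comm] using (hw.polyLE_coord i).const_mul (e i)

theorem contDiff (hw : RTField ℓ w) : ContDiff ℝ ∞ w :=
  contDiff_euclidean.2 fun i => (hw.polyLE_coord i).contDiff

theorem contDiff_one (hw : RTField ℓ w) : ContDiff ℝ 1 w := hw.contDiff.of_le (by simp)

theorem continuous (hw : RTField ℓ w) : Continuous w := hw.contDiff.continuous

theorem const (e : Euc d) : RTField ℓ fun _ => e :=
  ⟨fun i _ => e i, fun _ => 0, fun i => PolyLE.const _, PolyLE.const _, by simp⟩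

theorem add (hw : RTField ℓ w) (hw' : RTField ℓ w') : RTField ℓ fun x => w x + w' x := by
  obtain ⟨P, s, hP, hs, h⟩ := hw
  obtain ⟨P', s', hP', hs', h'⟩ := hw'
  exact ⟨fun i x => P i x + P' i x, fun x => s x + s' x, fun i => (hP i).add (hP' i),
    hs.add hs', fun x i => by rw [PiLp.add_apply, h, h']; ring⟩

theorem const_smul (c : ℝ) (hw : RTField ℓ w) : RTField ℓ fun x => c • w x := by
  obtain ⟨P, s, hP, hs, h⟩ := hw
  exact ⟨fun i x => c * P i x, fun x => c * s x, fun i => (hP i).const_mul c, hs.const_mul c,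
    fun x i => by rw [PiLp.smul_apply, h, smul_eq_mul]; ring⟩

theorem sum {ι : Type*} (s : Finset ι) {w : ι → Euc d → Euc d} (hw : ∀ i ∈ s, RTField ℓ (w i)) :
    RTField ℓ fun x => ∑ i ∈ s, w i x := by
  classical
  induction s using Finset.induction_on with
  | empty => simpa using const (d := d) (ℓ := ℓ) 0
  | insert a s ha ih =>
    simp only [Finset.sum_insert ha]
    exact (hw a (Finset.mem_insert_self _ _)).add
      (ih fun i hi => hw i (Finset.mem_insert_of_mem hi))

/-- The building block of both liftings: `g p` is in `[P_ℓ]^d` and `-g x` in `x P_ℓ`. -/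
theorem radial {g : Euc d → ℝ} (hg : PolyLE ℓ g) (p : Euc d) : RTField ℓ fun x => g x • (p - x) :=
  ⟨fun i x => p i * g x, fun x => -g x, fun i => hg.const_mul _, hg.neg, fun x i => by
    rw [PiLp.smul_apply, PiLp.sub_apply, smul_eq_mul]; ring⟩

end RTField

theorem isRTOn_iff {ℓ : ℕ} {T : Finset (Euc d)} {v : Euc d → Euc d} :
    IsRTOn ℓ T v ↔ ∃ w, RTField ℓ w ∧ ∀ x ∈ interior (cell T), v x = w x := by
  constructor
  · rintro ⟨P, s, hP, hs, h⟩
    refine ⟨fun x => WithLp.toLp 2 fun i => MvPolynomial.eval (fun j => x j) (P i) +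
      x i * MvPolynomial.eval (fun j => x j) s, ⟨fun i x => MvPolynomial.eval (fun j => x j) (P i),
      fun x => MvPolynomial.eval (fun j => x j) s, fun i => ⟨P i, hP i, fun _ => rfl⟩,
      ⟨s, hs, fun _ => rfl⟩, fun x i => rfl⟩, fun x hx => ?_⟩
    ext i
    exact h x hx i
  · rintro ⟨w, ⟨P, s, hP, hs, h⟩, hv⟩
    choose Q hQ hPQ using hP
    obtain ⟨r, hr, hsr⟩ := hs
    exact ⟨Q, r, hQ, hr, fun x hx i => by rw [hv x hx, h, hPQ, hsr]⟩

theorem inner_gradient (f : Euc d → ℝ) (x v : Euc d) :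
    inner ℝ v (gradient f x) = fderiv ℝ f x v := by
  rw [real_inner_comm, gradient, InnerProductSpace.toDual_symm_apply]

theorem continuous_gradient {f : Euc d → ℝ} (hf : ContDiff ℝ 1 f) : Continuous (gradient f) :=
  (InnerProductSpace.toDual ℝ (Euc d)).symm.continuous.comp (hf.continuous_fderiv (by simp))

theorem continuous_divg {w : Euc d → Euc d} (hw : ContDiff ℝ 1 w) : Continuous (divg w) := by
  have := hw.continuous_fderiv (by simp)
  unfold divg
  fun_prop

theorem trace_eq {F : Type*} [TopologicalSpace F] [T2Space F] {T : Finset (Euc d)}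
    (hT : IsSimplex T) {f g : Euc d → F} (hg : Continuous g)
    (hfg : ∀ x ∈ interior (cell T), f x = g x) {x : Euc d} (hx : x ∈ cell T) :
    trace T f x = g x := by
  apply extendFrom_eq
  · rwa [hT.closure_interior]
  · refine (hg.tendsto x).mono_left nhdsWithin_le_nhds |>.congr' ?_
    filter_upwards [self_mem_nhdsWithin] with z hz using (hfg z hz).symm

/-! ### Polynomial representatives on the elements, fluxes, jumps and norms. -/

namespace Triangulation

variable {Ω : Set (Euc d)} (𝒯 : Triangulation Ω)

/-- `w T` is the restriction of the broken function `v` to each element `T`. -/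
def Rep {F : Type*} (v : Euc d → F) (w : Finset (Euc d) → Euc d → F) : Prop :=
  ∀ T ∈ 𝒯.elements, ∀ x ∈ interior (cell T), v x = w T x

/-- Broken Raviart–Thomas fields. -/
def BrokenRT (ℓ : ℕ) (w : Finset (Euc d) → Euc d → Euc d) : Prop :=
  ∀ T ∈ 𝒯.elements, RTField ℓ (w T)

/-- Broken polynomials. -/
def BrokenPoly (ℓ : ℕ) (u : Finset (Euc d) → Euc d → ℝ) : Prop :=
  ∀ T ∈ 𝒯.elements, PolyLE ℓ (u T)

theorem exists_rep_of_mem_V {ℓ : ℕ} {v : Euc d → Euc d} (hv : v ∈ 𝒯.V ℓ) :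
    ∃ w, 𝒯.BrokenRT ℓ w ∧ 𝒯.Rep v w := by
  have : ∀ T, ∃ w : Euc d → Euc d, T ∈ 𝒯.elements →
      RTField ℓ w ∧ ∀ x ∈ interior (cell T), v x = w x := fun T => by
    by_cases hT : T ∈ 𝒯.elements
    · obtain ⟨w, hw⟩ := isRTOn_iff.1 (hv.2 T hT)
      exact ⟨w, fun _ => hw⟩
    · exact ⟨0, fun h => absurd h hT⟩
  choose w hw using this
  exact ⟨w, fun T hT => (hw T hT).1, fun T hT => (hw T hT).2⟩

theorem exists_rep_of_mem_Q {ℓ : ℕ} {q : Euc d → ℝ} (hq : q ∈ 𝒯.Q ℓ) :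
    ∃ u, 𝒯.BrokenPoly ℓ u ∧ 𝒯.Rep q u := by
  have : ∀ T, ∃ u : Euc d → ℝ, T ∈ 𝒯.elements →
      PolyLE ℓ u ∧ ∀ x ∈ interior (cell T), q x = u x := fun T => by
    by_cases hT : T ∈ 𝒯.elements
    · obtain ⟨p, hp, h⟩ := hq T hT
      exact ⟨_, fun _ => ⟨⟨p, hp, fun _ => rfl⟩, h⟩⟩
    · exact ⟨0, fun h => absurd h hT⟩
  choose u hu using this
  exact ⟨u, fun T hT => (hu T hT).1, fun T hT => (hu T hT).2⟩

/-- The unit normal of the side `σ`. -/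
noncomputable def sideNormal (σ : Finset (Euc d)) : Euc d := outwardNormal (𝒯.owner σ) σ

/-- The sign of the outward normal of `T` relative to the unit normal of its side `σ`. -/
noncomputable def sideSign (σ T : Finset (Euc d)) : ℝ :=
  inner ℝ (outwardNormal T σ) (𝒯.sideNormal σ)

/-- The normal component of a broken field on the side `σ`. -/
noncomputable def flux (w : Finset (Euc d) → Euc d → Euc d) (σ : Finset (Euc d)) (x : Euc d) : ℝ :=
  inner ℝ (𝒯.sideNormal σ) (w (𝒯.owner σ) x)

/-- The scalar jump of a broken function across the side `σ`. -/
noncomputable def sjump (u : Finset (Euc d) → Euc d → ℝ) (σ : Finset (Euc d)) (x : Euc d) : ℝ :=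
  ∑ T ∈ 𝒯.neighbors σ, 𝒯.sideSign σ T * u T x

/-- The sum of the outward fluxes of a broken field through the side `σ`. -/
noncomputable def fluxJump (w : Finset (Euc d) → Euc d → Euc d) (σ : Finset (Euc d))
    (x : Euc d) : ℝ :=
  ∑ T ∈ 𝒯.neighbors σ, inner ℝ (outwardNormal T σ) (w T x)

theorem norm_outwardNormal (hd : 2 ≤ d) {σ T : Finset (Euc d)} (hσ : σ ∈ 𝒯.sides)
    (hT : T ∈ 𝒯.neighbors σ) : ‖outwardNormal T σ‖ = 1 := by
  rw [mem_neighbors] at hT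
  obtain ⟨p, hp, rfl⟩ := 𝒯.exists_erase_eq hT.1 hσ hT.2
  exact (𝒯.isSimplex hT.1).norm_outwardNormal hd hp

theorem norm_sideNormal (hd : 2 ≤ d) {σ : Finset (Euc d)} (hσ : σ ∈ 𝒯.sides) :
    ‖𝒯.sideNormal σ‖ = 1 := 𝒯.norm_outwardNormal hd hσ (𝒯.owner_mem_neighbors hσ)

theorem sideSign_owner (hd : 2 ≤ d) {σ : Finset (Euc d)} (hσ : σ ∈ 𝒯.sides) :
    𝒯.sideSign σ (𝒯.owner σ) = 1 := by
  have := 𝒯.norm_sideNormal hd hσ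
  rw [sideSign, ← sideNormal, real_inner_self_eq_norm_sq, this, one_pow]

theorem sideSign_of_ne (hd : 2 ≤ d) {σ T : Finset (Euc d)} (hσ : σ ∈ 𝒯.sides)
    (hT : T ∈ 𝒯.neighbors σ) (hne : T ≠ 𝒯.owner σ) : 𝒯.sideSign σ T = -1 := by
  rw [sideSign, 𝒯.outwardNormal_eq_neg hd hσ (𝒯.owner_mem_neighbors hσ) hT hne.symm,
    inner_neg_left, ← sideNormal, real_inner_self_eq_norm_sq, 𝒯.norm_sideNormal hd hσ, one_pow]

theorem outwardNormal_eq_smul (hd : 2 ≤ d) {σ T : Finset (Euc d)} (hσ : σ ∈ 𝒯.sides)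
    (hT : T ∈ 𝒯.neighbors σ) : outwardNormal T σ = 𝒯.sideSign σ T • 𝒯.sideNormal σ := by
  by_cases hne : T = 𝒯.owner σ
  · rw [hne, 𝒯.sideSign_owner hd hσ, one_smul, sideNormal]
  · rw [𝒯.sideSign_of_ne hd hσ hT hne,
      𝒯.outwardNormal_eq_neg hd hσ (𝒯.owner_mem_neighbors hσ) hT (Ne.symm hne), neg_one_smul,
      sideNormal]

theorem sideSign_sq (hd : 2 ≤ d) {σ T : Finset (Euc d)} (hσ : σ ∈ 𝒯.sides)
    (hT : T ∈ 𝒯.neighbors σ) : 𝒯.sideSign σ T ^ 2 = 1 := by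
  by_cases hne : T = 𝒯.owner σ
  · rw [hne, 𝒯.sideSign_owner hd hσ, one_pow]
  · rw [𝒯.sideSign_of_ne hd hσ hT hne]; norm_num

theorem side_subset_cell {σ T : Finset (Euc d)} (hT : T ∈ 𝒯.neighbors σ) :
    cell σ ⊆ cell T :=
  convexHull_mono (by exact_mod_cast (𝒯.mem_neighbors.1 hT).2)

theorem normalTrace_eq {ℓ : ℕ} {v : Euc d → Euc d} {w : Finset (Euc d) → Euc d → Euc d}
    (hw : 𝒯.BrokenRT ℓ w) (hvw : 𝒯.Rep v w) {σ : Finset (Euc d)} (hσ : σ ∈ 𝒯.sides)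
    {x : Euc d} (hx : x ∈ cell σ) : 𝒯.normalTrace σ v x = 𝒯.flux w σ x := by
  have ho := 𝒯.owner_spec hσ
  have h := trace_eq (𝒯.isSimplex ho.1) (hw _ ho.1).continuous (hvw _ ho.1)
    (𝒯.side_subset_cell (𝒯.owner_mem_neighbors hσ) hx)
  rw [flux, real_inner_comm, ← h]
  rfl

theorem jump_eq (hd : 2 ≤ d) {ℓ : ℕ} {q : Euc d → ℝ} {u : Finset (Euc d) → Euc d → ℝ}
    (hu : 𝒯.BrokenPoly ℓ u) (hqu : 𝒯.Rep q u) {σ : Finset (Euc d)} (hσ : σ ∈ 𝒯.sides)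
    {x : Euc d} (hx : x ∈ cell σ) : 𝒯.jump σ q x = 𝒯.sjump u σ x • 𝒯.sideNormal σ := by
  rw [sjump, Finset.sum_smul]
  change ∑ T ∈ 𝒯.neighbors σ, trace T q x • outwardNormal T σ = _
  refine Finset.sum_congr rfl fun T hT => ?_
  have hTe := (𝒯.mem_neighbors.1 hT).1
  rw [trace_eq (𝒯.isSimplex hTe) (hu T hTe).continuous (hqu T hTe) (𝒯.side_subset_cell hT hx),
    𝒯.outwardNormal_eq_smul hd hσ hT, smul_smul, mul_comm]

theorem norm_jump_sq (hd : 2 ≤ d) {ℓ : ℕ} {q : Euc d → ℝ} {u : Finset (Euc d) → Euc d → ℝ}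
    (hu : 𝒯.BrokenPoly ℓ u) (hqu : 𝒯.Rep q u) {σ : Finset (Euc d)} (hσ : σ ∈ 𝒯.sides)
    {x : Euc d} (hx : x ∈ cell σ) : ‖𝒯.jump σ q x‖ ^ 2 = 𝒯.sjump u σ x ^ 2 := by
  rw [𝒯.jump_eq hd hu hqu hσ hx, norm_smul, 𝒯.norm_sideNormal hd hσ, mul_one, Real.norm_eq_abs,
    sq_abs]

/-- The element part of the squared mesh-dependent norm of a broken field. -/
noncomputable def cellSq (w : Finset (Euc d) → Euc d → Euc d) : ℝ :=
  ∑ T ∈ 𝒯.elements, ∫ x in cell T, ‖w T x‖ ^ 2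

/-- The side part of the squared mesh-dependent norm of a broken field. -/
noncomputable def fluxSq (w : Finset (Euc d) → Euc d → Euc d) : ℝ :=
  ∑ σ ∈ 𝒯.sides, Metric.diam (cell σ) * ∫ x in cell σ, 𝒯.flux w σ x ^ 2 ∂μHE[d - 1]

/-- The side part of the squared mesh-dependent norm of a broken function. -/
noncomputable def jumpSq (u : Finset (Euc d) → Euc d → ℝ) : ℝ :=
  ∑ σ ∈ 𝒯.sides, (1 / Metric.diam (cell σ)) * ∫ x in cell σ, 𝒯.sjump u σ x ^ 2 ∂μHE[d - 1]

/-- The broken gradient. -/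
noncomputable def _root_.DarcyRT.brokenGrad (u : Finset (Euc d) → Euc d → ℝ) (T : Finset (Euc d)) :
    Euc d → Euc d := gradient (u T)

theorem setIntegral_interior (f : Euc d → ℝ) (s : Finset (Euc d)) :
    ∫ x in interior (cell s), f x = ∫ x in cell s, f x :=
  setIntegral_congr_set (interior_ae_eq s)

theorem setIntegral_rep {F : Type*} {v : Euc d → F} {w : Finset (Euc d) → Euc d → F}
    (hvw : 𝒯.Rep v w) (Φ : Euc d → F → ℝ) {T : Finset (Euc d)} (hT : T ∈ 𝒯.elements) :
    ∫ x in interior (cell T), Φ x (v x) = ∫ x in cell T, Φ x (w T x) := by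
  rw [← setIntegral_interior]
  exact setIntegral_congr_fun isOpen_interior.measurableSet fun x hx => by
    simp only [hvw T hT x hx]

theorem normL2_eq {ℓ : ℕ} {v : Euc d → Euc d} {w : Finset (Euc d) → Euc d → Euc d}
    (hw : 𝒯.BrokenRT ℓ w) (hvw : 𝒯.Rep v w) : 𝒯.normL2 v = √(𝒯.cellSq w + 𝒯.fluxSq w) := by
  unfold normL2 cellSq fluxSq
  congr 2
  · exact Finset.sum_congr rfl fun T hT => 𝒯.setIntegral_rep hvw (fun _ y => ‖y‖ ^ 2) hT
  · refine Finset.sum_congr rfl fun σ hσ => ?_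
    congr 1
    exact setIntegral_congr_fun (IsSimplex.measurableSet_cell _) fun x hx => by
      simp only [𝒯.normalTrace_eq hw hvw hσ hx]

theorem normH1_eq (hd : 2 ≤ d) {ℓ : ℕ} {q : Euc d → ℝ} {u : Finset (Euc d) → Euc d → ℝ}
    (hu : 𝒯.BrokenPoly ℓ u) (hqu : 𝒯.Rep q u) :
    𝒯.normH1 q = √(𝒯.cellSq (brokenGrad u) + 𝒯.jumpSq u) := by
  unfold normH1 cellSq jumpSq brokenGrad
  congr 2
  · refine Finset.sum_congr rfl fun T hT => ?_
    rw [← setIntegral_interior]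
    refine setIntegral_congr_fun isOpen_interior.measurableSet fun x hx => ?_
    have : q =ᶠ[nhds x] u T := by
      filter_upwards [isOpen_interior.mem_nhds hx] with z hz using hqu T hT z hz
    simp only [gradient, this.fderiv_eq]
  · refine Finset.sum_congr rfl fun σ hσ => ?_
    congr 1
    exact setIntegral_congr_fun (IsSimplex.measurableSet_cell _) fun x hx => by
      simp only [𝒯.norm_jump_sq hd hu hqu hσ hx]

theorem cellSq_nonneg (w : Finset (Euc d) → Euc d → Euc d) : 0 ≤ 𝒯.cellSq w :=
  Finset.sum_nonneg fun _ _ => integral_nonneg fun _ => sq_nonneg _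

theorem fluxSq_nonneg (w : Finset (Euc d) → Euc d → Euc d) : 0 ≤ 𝒯.fluxSq w :=
  Finset.sum_nonneg fun _ _ => mul_nonneg Metric.diam_nonneg (integral_nonneg fun _ => sq_nonneg _)

theorem jumpSq_nonneg (u : Finset (Euc d) → Euc d → ℝ) : 0 ≤ 𝒯.jumpSq u :=
  Finset.sum_nonneg fun _ _ => mul_nonneg (one_div_nonneg.2 Metric.diam_nonneg)
    (integral_nonneg fun _ => sq_nonneg _)

theorem continuous_flux {ℓ : ℕ} {w : Finset (Euc d) → Euc d → Euc d} (hw : 𝒯.BrokenRT ℓ w)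
    {σ : Finset (Euc d)} (hσ : σ ∈ 𝒯.sides) : Continuous (𝒯.flux w σ) := by
  have := (hw _ (𝒯.owner_spec hσ).1).continuous
  unfold flux
  fun_prop

theorem continuous_sjump {ℓ : ℕ} {u : Finset (Euc d) → Euc d → ℝ} (hu : 𝒯.BrokenPoly ℓ u)
    (σ : Finset (Euc d)) : Continuous (𝒯.sjump u σ) :=
  continuous_finsetSum _ fun T hT =>
    continuous_const.mul (hu T (𝒯.mem_neighbors.1 hT).1).continuous

theorem continuous_fluxJump {ℓ : ℕ} {w : Finset (Euc d) → Euc d → Euc d} (hw : 𝒯.BrokenRT ℓ w)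
    (σ : Finset (Euc d)) : Continuous (𝒯.fluxJump w σ) :=
  continuous_finsetSum _ fun T hT =>
    continuous_const.inner (hw T (𝒯.mem_neighbors.1 hT).1).continuous

theorem integrableOn_side (hd : 2 ≤ d) {σ : Finset (Euc d)} (hσ : σ ∈ 𝒯.sides) {f : Euc d → ℝ}
    (hf : Continuous f) : IntegrableOn f (cell σ) μHE[d - 1] := by
  have ho := 𝒯.owner_spec hσ
  obtain ⟨p, hp, he⟩ := 𝒯.exists_erase_eq ho.1 hσ ho.2
  rw [he]
  exact (𝒯.isSimplex ho.1).integrableOn_side hd hp hf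

/-- Green's formula summed over the elements. -/
theorem sum_green (hd : 2 ≤ d) {ℓ : ℕ} {w : Finset (Euc d) → Euc d → Euc d}
    (hw : 𝒯.BrokenRT ℓ w) {u : Finset (Euc d) → Euc d → ℝ}
    (hu : ∀ T ∈ 𝒯.elements, ContDiff ℝ 1 (u T)) :
    ∑ T ∈ 𝒯.elements, ∫ x in cell T, inner ℝ (w T x) (gradient (u T) x) =
      -(∑ T ∈ 𝒯.elements, ∫ x in cell T, divg (w T) x * u T x) +
        ∑ σ ∈ 𝒯.sides, ∫ y in cell σ, (∑ T ∈ 𝒯.neighbors σ,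
          inner ℝ (outwardNormal T σ) (w T y) * u T y) ∂μHE[d - 1] := by
  have h1 : ∀ T ∈ 𝒯.elements, ∫ x in cell T, inner ℝ (w T x) (gradient (u T) x) =
      -(∫ x in cell T, divg (w T) x * u T x) + ∑ p ∈ T, ∫ y in cell (T.erase p),
        inner ℝ (outwardNormal T (T.erase p)) (w T y) * u T y ∂μHE[d - 1] := by
    intro T hT
    simp only [inner_gradient]
    exact (𝒯.isSimplex hT).integral_green hd (hw T hT).contDiff_one (hu T hT)
  rw [Finset.sum_congr rfl h1, Finset.sum_add_distrib, Finset.sum_neg_distrib,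
    𝒯.sum_elements_sides hd fun T σ => ∫ y in cell σ,
      inner ℝ (outwardNormal T σ) (w T y) * u T y ∂μHE[d - 1]]
  congr 1
  refine Finset.sum_congr rfl fun σ hσ => (integral_finsetSum _ fun T hT => ?_).symm
  have hTe := (𝒯.mem_neighbors.1 hT).1
  have h2 := (hw T hTe).continuous
  have h3 := (hu T hTe).continuous
  exact 𝒯.integrableOn_side hd hσ (by fun_prop)

end Triangulation

end DarcyRT

namespace DarcyRT

variable {d : ℕ}

theorem gradient_eq_zero_of_notMem_tsupport {φ : Euc d → ℝ} {x : Euc d} (hx : x ∉ tsupport φ) :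
    gradient φ x = 0 := by
  rw [gradient, image_eq_zero_of_notMem_tsupport fun h => hx (tsupport_fderiv_subset ℝ h), map_zero]

namespace Triangulation

variable {Ω : Set (Euc d)} (𝒯 : Triangulation Ω)

/-! ### Gluing broken functions -/

/-- The function on the domain given by a broken function. -/
noncomputable def glue {F : Type*} [AddCommMonoid F] (w : Finset (Euc d) → Euc d → F)
    (x : Euc d) : F := ∑ T ∈ 𝒯.elements, (interior (cell T)).indicator (w T) x

theorem rep_glue {F : Type*} [AddCommMonoid F] (w : Finset (Euc d) → Euc d → F) :
    𝒯.Rep (𝒯.glue w) w := by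
  intro T hT x hx
  rw [glue, Finset.sum_eq_single_of_mem T hT, Set.indicator_of_mem hx]
  intro T' hT' hne
  exact Set.indicator_of_notMem (fun hx' =>
    Set.disjoint_left.1 (𝒯.disjoint_interior hT' hT hne) hx' hx) _

theorem memLp_glue {F : Type*} [NormedAddCommGroup F] [SecondCountableTopology F]
    {w : Finset (Euc d) → Euc d → F} (hw : ∀ T ∈ 𝒯.elements, Continuous (w T)) :
    MemLp (𝒯.glue w) 2 (volume.restrict Ω) := by
  refine memLp_finsetSum _ fun T hT => MemLp.restrict _ ?_
  rw [memLp_indicator_iff_restrict isOpen_interior.measurableSet]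
  obtain ⟨M, hM⟩ := ((IsSimplex.isCompact_cell T).image (hw T hT)).isBounded.exists_norm_le
  have hfin : IsFiniteMeasure (volume.restrict (interior (cell T))) :=
    ⟨by
      rw [Measure.restrict_apply_univ]
      exact (measure_mono _root_.interior_subset).trans_lt
        (IsSimplex.isCompact_cell T).measure_lt_top⟩
  exact MemLp.of_bound (hw T hT).aestronglyMeasurable M
    ((ae_restrict_iff' isOpen_interior.measurableSet).2 (Filter.Eventually.of_forall fun x hx =>
      hM _ ⟨x, _root_.interior_subset hx, rfl⟩))

theorem isFiniteMeasure_domain (𝒯 : Triangulation Ω) : IsFiniteMeasure (volume.restrict Ω) := by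
  have hc : IsCompact (closure Ω) := by
    rw [𝒯.space_eq_biUnion]
    exact 𝒯.elements.isCompact_biUnion fun T _ => IsSimplex.isCompact_cell T
  exact ⟨by simpa using (measure_mono subset_closure).trans_lt hc.measure_lt_top⟩

theorem integral_domain_rep (hΩ : IsPolyhedralDomain Ω) {F : Type*} {v : Euc d → F}
    {w : Finset (Euc d) → Euc d → F} (hvw : 𝒯.Rep v w) (Φ : Euc d → F → ℝ)
    (hΦ : ∀ T ∈ 𝒯.elements, ContinuousOn (fun x => Φ x (w T x)) (cell T)) :
    ∫ x in Ω, Φ x (v x) = ∑ T ∈ 𝒯.elements, ∫ x in cell T, Φ x (w T x) := by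
  rw [𝒯.integral_domain hΩ]
  · exact Finset.sum_congr rfl fun T hT => 𝒯.setIntegral_rep hvw Φ hT
  · intro T hT
    refine (((hΦ T hT).integrableOn_compact (IsSimplex.isCompact_cell T)).mono_set
      _root_.interior_subset).congr_fun (fun x hx => ?_) isOpen_interior.measurableSet
    simp only [hvw T hT x hx]

/-! ### The weak divergence of broken fields -/

/-- Test functions supported inside one element leave no side terms in Green's formula; the
fundamental lemma of the calculus of variations then identifies `g`. -/
theorem ae_eq_divg (hΩ : IsPolyhedralDomain Ω) (hd : 2 ≤ d) {ℓ : ℕ} {v : Euc d → Euc d}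
    {w : Finset (Euc d) → Euc d → Euc d} (hw : 𝒯.BrokenRT ℓ w) (hvw : 𝒯.Rep v w)
    {g : Euc d → ℝ} (hg : MemLp g 2 (volume.restrict Ω)) (hvg : HasWeakDiv Ω v g) :
    ∀ T ∈ 𝒯.elements,
      ∀ᵐ x ∂volume, x ∈ interior (cell T) → g x = divg (w T) x := by
  intro T hT
  have hfin := 𝒯.isFiniteMeasure_domain
  have hUΩ := 𝒯.interior_subset hΩ hT
  have hUm : MeasurableSet (interior (cell T)) := isOpen_interior.measurableSet
  have hs := 𝒯.isSimplex hT
  have hdc := continuous_divg (hw T hT).contDiff_one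
  have hgU : MemLp g 2 (volume.restrict (interior (cell T))) :=
    hg.mono_measure (Measure.restrict_mono hUΩ le_rfl)
  have hgi : IntegrableOn g (interior (cell T)) :=
    (hg.integrable (by norm_num)).mono_measure (Measure.restrict_mono hUΩ le_rfl)
  have hdi : IntegrableOn (divg (w T)) (interior (cell T)) :=
    (IsSimplex.integrableOn_cell hdc T).mono_set _root_.interior_subset
  have h := isOpen_interior.ae_eq_zero_of_integral_contDiff_smul_eq_zero (μ := volume)
    (f := fun x => g x - divg (w T) x) (U := interior (cell T))
    (hgi.sub hdi).locallyIntegrableOn ?_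
  · filter_upwards [h] with x hx hxU using sub_eq_zero.1 (hx hxU)
  intro φ hφ hφc hφU
  have hφ0 : ∀ x ∉ interior (cell T), φ x = 0 := fun x hx =>
    image_eq_zero_of_notMem_tsupport fun h => hx (hφU h)
  have hφg : ∀ x ∉ interior (cell T), gradient φ x = 0 := fun x hx =>
    gradient_eq_zero_of_notMem_tsupport fun h => hx (hφU h)
  have hweak := hvg φ hφ hφc (hφU.trans hUΩ)
  rw [setIntegral_eq_of_subset_of_forall_sdiff_eq_zero hΩ.isOpen.measurableSet hUΩ
      (fun x hx => by rw [hφg x hx.2, inner_zero_right]),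
    setIntegral_eq_of_subset_of_forall_sdiff_eq_zero hΩ.isOpen.measurableSet hUΩ
      (fun x hx => by rw [hφ0 x hx.2, mul_zero]),
    𝒯.setIntegral_rep hvw (fun x y => inner ℝ y (gradient φ x)) hT] at hweak
  have hgreen := hs.integral_green hd (hw T hT).contDiff_one (hφ.of_le (by simp))
  rw [Finset.sum_eq_zero, add_zero, ← setIntegral_interior (fun x => divg (w T) x * φ x)] at hgreen
  · simp only [inner_gradient] at hweak
    rw [hgreen, neg_inj] at hweak
    rw [← setIntegral_eq_integral_of_forall_compl_eq_zero (s := interior (cell T))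
      fun x hx => by rw [hφ0 x hx, zero_smul]]
    have hφL : MemLp φ 2 (volume.restrict (interior (cell T))) :=
      hφ.continuous.memLp_of_hasCompactSupport hφc
    have hi1 : IntegrableOn (fun x => g x * φ x) (interior (cell T)) := hgU.integrable_mul hφL
    have hi2 : IntegrableOn (fun x => divg (w T) x * φ x) (interior (cell T)) :=
      (IsSimplex.integrableOn_cell (hdc.mul hφ.continuous) T).mono_set _root_.interior_subset
    have : ∀ x, φ x • (g x - divg (w T) x) = g x * φ x - divg (w T) x * φ x := fun x => by
      rw [smul_eq_mul]; ring
    simp only [this]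
    rw [integral_sub hi1 hi2, hweak, sub_self]
  · intro p hp
    rw [setIntegral_congr_fun (IsSimplex.measurableSet_cell _) (g := fun _ => (0 : ℝ)), integral_zero]
    intro x hx
    have : φ x = 0 := hφ0 x fun hi =>
      (hs.mem_interior_iff.1 hi p hp).ne' ((hs.mem_side_iff hp).1 hx).2
    simp [this]

theorem weak_green (hΩ : IsPolyhedralDomain Ω) (hd : 2 ≤ d) {ℓ : ℕ} {v : Euc d → Euc d}
    {w : Finset (Euc d) → Euc d → Euc d} (hw : 𝒯.BrokenRT ℓ w) (hvw : 𝒯.Rep v w)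
    {φ : Euc d → ℝ} (hφ : ContDiff ℝ ∞ φ) :
    ∫ x in Ω, inner ℝ (v x) (gradient φ x) =
      -(∑ T ∈ 𝒯.elements, ∫ x in cell T, divg (w T) x * φ x) +
        ∑ σ ∈ 𝒯.sides, ∫ y in cell σ, 𝒯.fluxJump w σ y * φ y ∂μHE[d - 1] := by
  have hφ1 : ContDiff ℝ 1 φ := hφ.of_le (by simp)
  have hφg := continuous_gradient hφ1
  rw [𝒯.integral_domain_rep hΩ hvw (fun x y => inner ℝ y (gradient φ x)) fun T hT => by
    have := (hw T hT).continuous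
    exact Continuous.continuousOn (by fun_prop)]
  rw [𝒯.sum_green hd hw (u := fun _ => φ) fun _ _ => hφ1]
  simp only [fluxJump, Finset.sum_mul]

/-- The element integrals cancel against the weak divergence. With test functions vanishing on all
sides but `σ`, only the integral over `σ` is left, and the fundamental lemma is applied to the
surface measure on `σ`. -/
theorem fluxJump_ae_eq_zero (hΩ : IsPolyhedralDomain Ω) (hd : 2 ≤ d) {ℓ : ℕ} {v : Euc d → Euc d}
    {w : Finset (Euc d) → Euc d → Euc d} (hw : 𝒯.BrokenRT ℓ w) (hvw : 𝒯.Rep v w)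
    (hv : MemHDiv Ω v) {σ : Finset (Euc d)} (hσ : σ ∈ 𝒯.sides) {T : Finset (Euc d)}
    (hT : T ∈ 𝒯.neighbors σ) (hTo : T ≠ 𝒯.owner σ) :
    ∀ᵐ x ∂(μHE[d - 1] : Measure (Euc d)).restrict (cell σ), 𝒯.fluxJump w σ x = 0 := by
  classical
  obtain ⟨-, g, hg, hvg⟩ := hv
  have hgd := 𝒯.ae_eq_divg hΩ hd hw hvw hg hvg
  have ho := 𝒯.owner_spec hσ
  obtain ⟨p, hp, he⟩ := 𝒯.exists_erase_eq ho.1 hσ ho.2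
  have hFc := 𝒯.continuous_fluxJump hw σ
  -- This open set contains the relative interior of `σ`, hence almost all of `σ`, since a second
  -- element makes `σ` an interior side.
  set U : Set (Euc d) := Ω ∩ (⋃ s ∈ 𝒯.sides.erase σ, cell s)ᶜ with hU
  have hUo : IsOpen U := hΩ.isOpen.inter (Set.Finite.isClosed_biUnion (Finset.finite_toSet _)
    fun s _ => (IsSimplex.isCompact_cell s).isClosed).isOpen_compl
  have h := hUo.ae_eq_zero_of_integral_contDiff_smul_eq_zero
    (μ := (μHE[d - 1] : Measure (Euc d)).restrict (cell σ)) (f := 𝒯.fluxJump w σ)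
    (Integrable.locallyIntegrable (𝒯.integrableOn_side hd hσ hFc) |>.locallyIntegrableOn _) ?_
  · have hrel := (𝒯.isSimplex ho.1).ae_mem_relint hd hp
    rw [← he] at hrel
    filter_upwards [h, hrel] with x hx hxr
    refine hx ⟨𝒯.relint_subset_domain hΩ hd ho.1 (𝒯.mem_neighbors.1 hT).1 hTo.symm hp
      (he ▸ (𝒯.mem_neighbors.1 hT).2) hxr, fun hxs => ?_⟩
    obtain ⟨s, hs, hxs⟩ := Set.mem_iUnion₂.1 hxs
    obtain ⟨hne, hs⟩ := Finset.mem_erase.1 hs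
    have hsub := 𝒯.erase_subset_of_mem_relint ho.1 (𝒯.mem_sides.1 hs).1 hp hxr hxs
    rw [← he] at hsub
    exact hne (Finset.eq_of_subset_of_card_le hsub
      (by rw [(𝒯.mem_sides.1 hs).2, (𝒯.mem_sides.1 hσ).2])).symm
  intro φ hφ hφc hφU
  have hφ0 : ∀ x ∉ U, φ x = 0 := fun x hx =>
    image_eq_zero_of_notMem_tsupport fun h => hx (hφU h)
  have h1 := hvg φ hφ hφc (hφU.trans Set.inter_subset_left)
  rw [𝒯.weak_green hΩ hd hw hvw hφ] at h1
  have h2 : ∫ x in Ω, g x * φ x = ∑ T ∈ 𝒯.elements, ∫ x in cell T, divg (w T) x * φ x := by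
    have hi : ∀ T ∈ 𝒯.elements, IntegrableOn (fun x => divg (w T) x * φ x) (interior (cell T)) :=
      fun T hT => (IsSimplex.integrableOn_cell ((continuous_divg (hw T hT).contDiff_one).mul
        hφ.continuous) T).mono_set _root_.interior_subset
    have hae : ∀ T ∈ 𝒯.elements, (fun x => divg (w T) x * φ x) =ᵐ[volume.restrict
        (interior (cell T))] fun x => g x * φ x := fun T hT => by
      refine (ae_restrict_iff' isOpen_interior.measurableSet).2 ?_
      filter_upwards [hgd T hT] with x hx hxi
      rw [hx hxi]
    rw [𝒯.integral_domain hΩ fun T hT => (hi T hT).congr (hae T hT)]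
    refine Finset.sum_congr rfl fun T hT => ?_
    rw [← setIntegral_interior]
    exact integral_congr_ae (hae T hT).symm
  rw [h2, add_eq_left, Finset.sum_eq_single_of_mem σ hσ] at h1
  · simpa only [smul_eq_mul, mul_comm] using h1
  · intro s hs hne
    rw [setIntegral_congr_fun (IsSimplex.measurableSet_cell _) (g := fun _ => (0 : ℝ)), integral_zero]
    intro x hx
    have : φ x = 0 := hφ0 x fun hxU =>
      hxU.2 (Set.mem_biUnion (Finset.mem_erase.2 ⟨hne, hs⟩) hx)
    simp [this]

/-- In Green's formula the interior sides drop out by `hflux`. On a boundary side the test function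
vanishes almost everywhere, its relative interior being outside `Ω`. -/
theorem glue_mem_V (hΩ : IsPolyhedralDomain Ω) (hd : 2 ≤ d) {ℓ : ℕ}
    {w : Finset (Euc d) → Euc d → Euc d} (hw : 𝒯.BrokenRT ℓ w)
    (hflux : ∀ σ ∈ 𝒯.sides, ∀ T ∈ 𝒯.neighbors σ, T ≠ 𝒯.owner σ →
      ∀ᵐ x ∂(μHE[d - 1] : Measure (Euc d)).restrict (cell σ), 𝒯.fluxJump w σ x = 0) :
    𝒯.glue w ∈ 𝒯.V ℓ := by
  have hdc : ∀ T ∈ 𝒯.elements, Continuous (divg (w T)) := fun T hT =>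
    continuous_divg (hw T hT).contDiff_one
  refine ⟨⟨𝒯.memLp_glue fun T hT => (hw T hT).continuous,
    𝒯.glue fun T => divg (w T), 𝒯.memLp_glue hdc, fun φ hφ hφc hφΩ => ?_⟩, fun T hT =>
    isRTOn_iff.2 ⟨w T, hw T hT, 𝒯.rep_glue w T hT⟩⟩
  rw [𝒯.weak_green hΩ hd hw (𝒯.rep_glue w) hφ,
    𝒯.integral_domain_rep hΩ (𝒯.rep_glue fun T => divg (w T)) (fun x y => y * φ x)
      fun T hT => ((hdc T hT).mul hφ.continuous).continuousOn, add_eq_left]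
  refine Finset.sum_eq_zero fun σ hσ => ?_
  have ho := 𝒯.owner_spec hσ
  obtain ⟨p, hp, he⟩ := 𝒯.exists_erase_eq ho.1 hσ ho.2
  refine integral_eq_zero_of_ae ?_
  rcases 𝒯.neighbors_eq hd hσ (𝒯.owner_mem_neighbors hσ) with h1 | ⟨T, hT, h2⟩
  · have hrel := (𝒯.isSimplex ho.1).ae_mem_relint hd hp
    rw [← he] at hrel
    filter_upwards [hrel] with x hx
    have hxΩ := 𝒯.notMem_of_mem_relint hΩ ho.1 hp (he ▸ h1) hx
    have : φ x = 0 := image_eq_zero_of_notMem_tsupport fun h => hxΩ (hφΩ h)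
    simp [this]
  · filter_upwards [hflux σ hσ T (by rw [h2]; simp) hT] with x hx
    rw [hx]
    simp

/-! ### The form `b` on broken functions -/

/-- The elementwise expression of the form `b`. -/
noncomputable def bBroken (w : Finset (Euc d) → Euc d → Euc d)
    (u : Finset (Euc d) → Euc d → ℝ) : ℝ :=
  ∑ T ∈ 𝒯.elements, (∫ x in cell T, inner ℝ (w T x) (brokenGrad u T x)) -
    ∑ σ ∈ 𝒯.sides, ∫ y in cell σ, 𝒯.flux w σ y * 𝒯.sjump u σ y ∂μHE[d - 1]

/-- Since the outward fluxes from the two sides of `σ` are opposite almost everywhere, the side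
terms of Green's formula combine into flux times jump. -/
theorem bForm_eq (hΩ : IsPolyhedralDomain Ω) (hd : 2 ≤ d) {ℓ : ℕ} {v : Euc d → Euc d}
    {w : Finset (Euc d) → Euc d → Euc d} (hw : 𝒯.BrokenRT ℓ w) (hvw : 𝒯.Rep v w)
    (hv : MemHDiv Ω v) {q : Euc d → ℝ} {u : Finset (Euc d) → Euc d → ℝ}
    (hu : 𝒯.BrokenPoly ℓ u) (hqu : 𝒯.Rep q u) :
    bForm Ω v q = 𝒯.bBroken w u := by
  have hspec : MemLp (weakDiv Ω v) 2 (volume.restrict Ω) ∧ HasWeakDiv Ω v (weakDiv Ω v) :=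
    Classical.epsilon_spec (p := fun g => MemLp g 2 (volume.restrict Ω) ∧ HasWeakDiv Ω v g) hv.2
  have hgd := 𝒯.ae_eq_divg hΩ hd hw hvw hspec.1 hspec.2
  have hu1 : ∀ T ∈ 𝒯.elements, ContDiff ℝ 1 (u T) := fun T hT =>
    (hu T hT).contDiff.of_le (by simp)
  have h2 : ∫ x in Ω, weakDiv Ω v x * q x =
      ∑ T ∈ 𝒯.elements, ∫ x in cell T, divg (w T) x * u T x := by
    have hi : ∀ T ∈ 𝒯.elements, IntegrableOn (fun x => divg (w T) x * u T x) (interior (cell T)) :=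
      fun T hT => (IsSimplex.integrableOn_cell ((continuous_divg (hw T hT).contDiff_one).mul
        (hu1 T hT).continuous) T).mono_set _root_.interior_subset
    have hae : ∀ T ∈ 𝒯.elements, (fun x => divg (w T) x * u T x) =ᵐ[volume.restrict
        (interior (cell T))] fun x => weakDiv Ω v x * q x := fun T hT => by
      refine (ae_restrict_iff' isOpen_interior.measurableSet).2 ?_
      filter_upwards [hgd T hT] with x hx hxi
      rw [hx hxi, hqu T hT x hxi]
    rw [𝒯.integral_domain hΩ fun T hT => (hi T hT).congr (hae T hT)]
    refine Finset.sum_congr rfl fun T hT => ?_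
    rw [← setIntegral_interior]
    exact integral_congr_ae (hae T hT).symm
  have h3 := 𝒯.sum_green hd hw hu1
  have h4 : ∀ σ ∈ 𝒯.sides, ∫ y in cell σ, (∑ T ∈ 𝒯.neighbors σ,
      inner ℝ (outwardNormal T σ) (w T y) * u T y) ∂μHE[d - 1] =
      ∫ y in cell σ, 𝒯.flux w σ y * 𝒯.sjump u σ y ∂μHE[d - 1] := by
    intro σ hσ
    refine integral_congr_ae ?_
    rcases 𝒯.neighbors_eq hd hσ (𝒯.owner_mem_neighbors hσ) with h1 | ⟨T, hT, h2⟩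
    · refine Filter.Eventually.of_forall fun y => ?_
      simp only [sjump, flux, h1, Finset.sum_singleton, 𝒯.sideSign_owner hd hσ, one_mul]
      rfl
    · have hTn : T ∈ 𝒯.neighbors σ := by rw [h2]; simp
      filter_upwards [𝒯.fluxJump_ae_eq_zero hΩ hd hw hvw hv hσ hTn hT] with y hy
      rw [fluxJump, h2, Finset.sum_pair hT.symm, ← sideNormal] at hy
      simp only [sjump, flux, h2, Finset.sum_pair hT.symm, 𝒯.sideSign_owner hd hσ,
        𝒯.sideSign_of_ne hd hσ hTn hT]
      rw [eq_neg_of_add_eq_zero_right hy, ← sideNormal]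
      ring
  rw [bForm, h2, bBroken, ← Finset.sum_congr rfl h4]
  unfold brokenGrad
  linarith

end Triangulation

end DarcyRT

namespace DarcyRT

variable {d : ℕ}

namespace Triangulation

variable {Ω : Set (Euc d)} (𝒯 : Triangulation Ω)

/-! ### Continuity of the forms on broken functions -/

/-- The `L²` product of broken fields. -/
noncomputable def cellInner (w w' : Finset (Euc d) → Euc d → Euc d) : ℝ :=
  ∑ T ∈ 𝒯.elements, ∫ x in cell T, inner ℝ (w T x) (w' T x)

/-- The pairing of the fluxes of a broken field with the jumps of a broken function. -/
noncomputable def sideInner (w : Finset (Euc d) → Euc d → Euc d)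
    (u : Finset (Euc d) → Euc d → ℝ) : ℝ :=
  ∑ σ ∈ 𝒯.sides, ∫ y in cell σ, 𝒯.flux w σ y * 𝒯.sjump u σ y ∂μHE[d - 1]

theorem bBroken_eq (w : Finset (Euc d) → Euc d → Euc d) (u : Finset (Euc d) → Euc d → ℝ) :
    𝒯.bBroken w u = 𝒯.cellInner w (brokenGrad u) - 𝒯.sideInner w u := rfl

/-- Broken fields that are continuous on each element. -/
def BrokenCont (w : Finset (Euc d) → Euc d → Euc d) : Prop := ∀ T ∈ 𝒯.elements, Continuous (w T)

variable {𝒯}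

theorem BrokenRT.cont {ℓ : ℕ} {w : Finset (Euc d) → Euc d → Euc d} (hw : 𝒯.BrokenRT ℓ w) :
    𝒯.BrokenCont w := fun T hT => (hw T hT).continuous

theorem BrokenPoly.cont_grad {ℓ : ℕ} {u : Finset (Euc d) → Euc d → ℝ} (hu : 𝒯.BrokenPoly ℓ u) :
    𝒯.BrokenCont (brokenGrad u) := fun T hT =>
  continuous_gradient ((hu T hT).contDiff.of_le (by simp))

theorem diam_side_pos (hd : 2 ≤ d) {σ : Finset (Euc d)} (hσ : σ ∈ 𝒯.sides) :
    0 < Metric.diam (cell σ) := by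
  obtain ⟨x, hx, y, hy, hxy⟩ := Finset.one_lt_card.1
    (show 1 < σ.card by rw [(𝒯.mem_sides.1 hσ).2]; omega)
  exact (dist_pos.2 hxy).trans_le (Metric.dist_le_diam_of_mem (IsSimplex.isBounded_cell σ)
    (subset_convexHull ℝ _ hx) (subset_convexHull ℝ _ hy))

/-- Cauchy–Schwarz in the form of a nonnegative quadratic in `t`. In this form the element and side
contributions can be added before the discriminant is taken. -/
theorem cellInner_quadratic {w w' : Finset (Euc d) → Euc d → Euc d} (hw : 𝒯.BrokenCont w)
    (hw' : 𝒯.BrokenCont w') (t : ℝ) :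
    0 ≤ 𝒯.cellSq w * (t * t) + 2 * 𝒯.cellInner w w' * t + 𝒯.cellSq w' := by
  unfold cellSq cellInner
  rw [Finset.sum_mul, Finset.mul_sum, Finset.sum_mul, ← Finset.sum_add_distrib,
    ← Finset.sum_add_distrib]
  refine Finset.sum_nonneg fun T hT => ?_
  have h1 := hw T hT
  have h2 := hw' T hT
  rw [← integral_mul_const, ← integral_const_mul, ← integral_mul_const,
    ← integral_add (IsSimplex.integrableOn_cell (by fun_prop) T)
      (IsSimplex.integrableOn_cell (by fun_prop) T),
    ← integral_add (IsSimplex.integrableOn_cell (by fun_prop) T)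
      (IsSimplex.integrableOn_cell (by fun_prop) T)]
  refine integral_nonneg fun x => ?_
  have : ‖w T x‖ ^ 2 * (t * t) + 2 * inner ℝ (w T x) (w' T x) * t + ‖w' T x‖ ^ 2 =
      ‖t • w T x + w' T x‖ ^ 2 := by
    rw [norm_add_sq_real, norm_smul, mul_pow, Real.norm_eq_abs, sq_abs, real_inner_smul_left]
    ring
  simp only [this]
  positivity

theorem sideInner_quadratic (hd : 2 ≤ d) {ℓ : ℕ} {w : Finset (Euc d) → Euc d → Euc d}
    (hw : 𝒯.BrokenRT ℓ w) {u : Finset (Euc d) → Euc d → ℝ} (hu : 𝒯.BrokenPoly ℓ u) (t : ℝ) :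
    0 ≤ 𝒯.fluxSq w * (t * t) - 2 * 𝒯.sideInner w u * t + 𝒯.jumpSq u := by
  unfold fluxSq sideInner jumpSq
  rw [Finset.sum_mul, Finset.mul_sum, Finset.sum_mul, ← Finset.sum_sub_distrib,
    ← Finset.sum_add_distrib]
  refine Finset.sum_nonneg fun σ hσ => ?_
  have h1 := 𝒯.continuous_flux hw hσ
  have h2 := 𝒯.continuous_sjump hu σ
  have hD := 𝒯.diam_side_pos hd hσ
  rw [← integral_const_mul, ← integral_mul_const, ← integral_const_mul, ← integral_mul_const,
    ← integral_const_mul,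
    ← integral_sub (𝒯.integrableOn_side hd hσ (by fun_prop))
      (𝒯.integrableOn_side hd hσ (by fun_prop)),
    ← integral_add (𝒯.integrableOn_side hd hσ (by fun_prop))
      (𝒯.integrableOn_side hd hσ (by fun_prop))]
  refine integral_nonneg fun x => ?_
  have : Metric.diam (cell σ) * 𝒯.flux w σ x ^ 2 * (t * t) -
      2 * (𝒯.flux w σ x * 𝒯.sjump u σ x) * t + 1 / Metric.diam (cell σ) * 𝒯.sjump u σ x ^ 2 =
      1 / Metric.diam (cell σ) * (Metric.diam (cell σ) * 𝒯.flux w σ x * t - 𝒯.sjump u σ x) ^ 2 := by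
    field_simp
    ring
  simp only [this]
  positivity

theorem _root_.abs_le_sqrt_mul_sqrt_of_quadratic {A B D : ℝ} (hA : 0 ≤ A)
    (h : ∀ t : ℝ, 0 ≤ A * (t * t) + 2 * B * t + D) : |B| ≤ √A * √D := by
  have h1 := discrim_le_zero h
  rw [discrim] at h1
  rw [← Real.sqrt_mul hA]
  exact Real.abs_le_sqrt (by linarith)

theorem abs_cellInner_le {w w' : Finset (Euc d) → Euc d → Euc d} (hw : 𝒯.BrokenCont w)
    (hw' : 𝒯.BrokenCont w') : |𝒯.cellInner w w'| ≤ √(𝒯.cellSq w) * √(𝒯.cellSq w') :=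
  abs_le_sqrt_mul_sqrt_of_quadratic (𝒯.cellSq_nonneg w) (cellInner_quadratic hw hw')

theorem abs_bBroken_le (hd : 2 ≤ d) {ℓ : ℕ} {w : Finset (Euc d) → Euc d → Euc d}
    (hw : 𝒯.BrokenRT ℓ w) {u : Finset (Euc d) → Euc d → ℝ} (hu : 𝒯.BrokenPoly ℓ u) :
    |𝒯.bBroken w u| ≤ √(𝒯.cellSq w + 𝒯.fluxSq w) * √(𝒯.cellSq (brokenGrad u) + 𝒯.jumpSq u) := by
  refine abs_le_sqrt_mul_sqrt_of_quadratic
    (add_nonneg (𝒯.cellSq_nonneg w) (𝒯.fluxSq_nonneg w)) fun t => ?_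
  have h1 := cellInner_quadratic hw.cont hu.cont_grad t
  have h2 := sideInner_quadratic hd hw hu t
  rw [bBroken_eq]
  linarith

/-! ### Linearity -/

theorem BrokenRT.add_smul {ℓ : ℕ} {w w' : Finset (Euc d) → Euc d → Euc d} (hw : 𝒯.BrokenRT ℓ w)
    (hw' : 𝒯.BrokenRT ℓ w') (c : ℝ) : 𝒯.BrokenRT ℓ fun T x => w T x + c • w' T x :=
  fun T hT => (hw T hT).add ((hw' T hT).const_smul c)

theorem flux_add_smul (w w' : Finset (Euc d) → Euc d → Euc d) (c : ℝ) (σ : Finset (Euc d))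
    (x : Euc d) : 𝒯.flux (fun T x => w T x + c • w' T x) σ x =
      𝒯.flux w σ x + c * 𝒯.flux w' σ x := by
  simp only [flux, inner_add_right, inner_smul_right]

theorem fluxJump_add_smul (w w' : Finset (Euc d) → Euc d → Euc d) (c : ℝ) (σ : Finset (Euc d))
    (x : Euc d) : 𝒯.fluxJump (fun T x => w T x + c • w' T x) σ x =
      𝒯.fluxJump w σ x + c * 𝒯.fluxJump w' σ x := by
  simp only [fluxJump, inner_add_right, inner_smul_right, Finset.sum_add_distrib, Finset.mul_sum]

theorem cellInner_add_smul {w w' G : Finset (Euc d) → Euc d → Euc d} (hw : 𝒯.BrokenCont w)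
    (hw' : 𝒯.BrokenCont w') (hG : 𝒯.BrokenCont G) (c : ℝ) :
    𝒯.cellInner (fun T x => w T x + c • w' T x) G =
      𝒯.cellInner w G + c * 𝒯.cellInner w' G := by
  unfold cellInner
  rw [Finset.mul_sum, ← Finset.sum_add_distrib]
  refine Finset.sum_congr rfl fun T hT => ?_
  have h1 := hw T hT
  have h2 := hw' T hT
  have h3 := hG T hT
  rw [← integral_const_mul, ← integral_add (IsSimplex.integrableOn_cell (by fun_prop) T)
      (IsSimplex.integrableOn_cell (by fun_prop) T)]
  simp only [inner_add_left, real_inner_smul_left]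

theorem sideInner_add_smul (hd : 2 ≤ d) {ℓ : ℕ} {w w' : Finset (Euc d) → Euc d → Euc d}
    (hw : 𝒯.BrokenRT ℓ w) (hw' : 𝒯.BrokenRT ℓ w') {u : Finset (Euc d) → Euc d → ℝ}
    (hu : 𝒯.BrokenPoly ℓ u) (c : ℝ) :
    𝒯.sideInner (fun T x => w T x + c • w' T x) u = 𝒯.sideInner w u + c * 𝒯.sideInner w' u := by
  unfold sideInner
  rw [Finset.mul_sum, ← Finset.sum_add_distrib]
  refine Finset.sum_congr rfl fun σ hσ => ?_
  have h1 := 𝒯.continuous_flux hw hσ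
  have h2 := 𝒯.continuous_flux hw' hσ
  have h3 := 𝒯.continuous_sjump hu σ
  rw [← integral_const_mul, ← integral_add (𝒯.integrableOn_side hd hσ (by fun_prop))
      (𝒯.integrableOn_side hd hσ (by fun_prop))]
  simp only [flux_add_smul, add_mul, mul_assoc]

theorem bBroken_add_smul (hd : 2 ≤ d) {ℓ : ℕ} {w w' : Finset (Euc d) → Euc d → Euc d}
    (hw : 𝒯.BrokenRT ℓ w) (hw' : 𝒯.BrokenRT ℓ w') {u : Finset (Euc d) → Euc d → ℝ}
    (hu : 𝒯.BrokenPoly ℓ u) (c : ℝ) :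
    𝒯.bBroken (fun T x => w T x + c • w' T x) u = 𝒯.bBroken w u + c * 𝒯.bBroken w' u := by
  rw [bBroken_eq, bBroken_eq, bBroken_eq, cellInner_add_smul hw.cont hw'.cont hu.cont_grad,
    sideInner_add_smul hd hw hw' hu]
  ring

theorem cellSq_add_smul_le {w w' : Finset (Euc d) → Euc d → Euc d} (hw : 𝒯.BrokenCont w)
    (hw' : 𝒯.BrokenCont w') (c : ℝ) :
    𝒯.cellSq (fun T x => w T x + c • w' T x) ≤ 2 * 𝒯.cellSq w + 2 * c ^ 2 * 𝒯.cellSq w' := by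
  unfold cellSq
  rw [Finset.mul_sum, Finset.mul_sum, ← Finset.sum_add_distrib]
  refine Finset.sum_le_sum fun T hT => ?_
  have h1 := hw T hT
  have h2 := hw' T hT
  rw [← integral_const_mul, ← integral_const_mul,
    ← integral_add (IsSimplex.integrableOn_cell (by fun_prop) T)
      (IsSimplex.integrableOn_cell (by fun_prop) T)]
  refine setIntegral_mono (IsSimplex.integrableOn_cell (by fun_prop) T)
    (IsSimplex.integrableOn_cell (by fun_prop) T) fun x => ?_
  have h3 := parallelogram_law_with_norm ℝ (w T x) (c • w' T x)
  have h4 : ‖c • w' T x‖ ^ 2 = c ^ 2 * ‖w' T x‖ ^ 2 := by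
    rw [norm_smul, mul_pow, Real.norm_eq_abs, sq_abs]
  nlinarith [mul_self_nonneg ‖w T x - c • w' T x‖]

theorem fluxSq_add_smul_le (hd : 2 ≤ d) {ℓ : ℕ} {w w' : Finset (Euc d) → Euc d → Euc d}
    (hw : 𝒯.BrokenRT ℓ w) (hw' : 𝒯.BrokenRT ℓ w') (c : ℝ) :
    𝒯.fluxSq (fun T x => w T x + c • w' T x) ≤ 2 * 𝒯.fluxSq w + 2 * c ^ 2 * 𝒯.fluxSq w' := by
  unfold fluxSq
  rw [Finset.mul_sum, Finset.mul_sum, ← Finset.sum_add_distrib]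
  refine Finset.sum_le_sum fun σ hσ => ?_
  have h1 := 𝒯.continuous_flux hw hσ
  have h2 := 𝒯.continuous_flux hw' hσ
  rw [mul_left_comm 2, mul_left_comm (2 * c ^ 2), ← mul_add]
  refine mul_le_mul_of_nonneg_left ?_ Metric.diam_nonneg
  rw [← integral_const_mul, ← integral_const_mul,
    ← integral_add (𝒯.integrableOn_side hd hσ (by fun_prop))
      (𝒯.integrableOn_side hd hσ (by fun_prop))]
  simp only [flux_add_smul]
  refine setIntegral_mono (𝒯.integrableOn_side hd hσ (by fun_prop))
    (𝒯.integrableOn_side hd hσ (by fun_prop)) fun x => ?_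
  nlinarith [sq_nonneg (𝒯.flux w σ x - c * 𝒯.flux w' σ x)]

/-! ### The discrete trace inequality -/

/-- Replacing `γ` by `|γ| + 1` provides a positive constant for every real `γ`. -/
theorem ShapeRegular.exists_ball {γ : ℝ} (h : 𝒯.ShapeRegular γ) {T : Finset (Euc d)}
    (hT : T ∈ 𝒯.elements) : ∃ x ρ, 0 < ρ ∧ Metric.closedBall x ρ ⊆ cell T ∧
      Metric.diam (cell T) ≤ (|γ| + 1) * ρ := by
  obtain ⟨x, ρ, hρ, hb, hD⟩ := h T hT
  exact ⟨x, ρ, hρ, hb, hD.trans (mul_le_mul_of_nonneg_right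
    ((le_abs_self γ).trans (by linarith)) hρ.le)⟩

/-- The trace inequality is applied to the normal component, a polynomial of degree `ℓ + 1` on the
owner of the side, after `diam σ` has been bounded by `g` times the height. The factor `d + 1`
counts the sides of an element. -/
theorem exists_fluxSq_le (hd : 2 ≤ d) (ℓ : ℕ) (γ : ℝ) : ∃ C : ℝ, 0 < C ∧
    ∀ {Ω : Set (Euc d)} (𝒯 : Triangulation Ω), 𝒯.ShapeRegular γ →
      ∀ w, 𝒯.BrokenRT ℓ w → 𝒯.fluxSq w ≤ C * 𝒯.cellSq w := by
  obtain ⟨C, hC, h⟩ := IsSimplex.exists_trace_inequality d (ℓ + 1) hd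
  set g : ℝ := |γ| + 1 with hg
  have hg0 : 0 < g := by positivity
  refine ⟨g * C * (d + 1), by positivity, fun 𝒯 hreg w hw => ?_⟩
  have key : ∀ σ ∈ 𝒯.sides, Metric.diam (cell σ) * ∫ x in cell σ, 𝒯.flux w σ x ^ 2 ∂μHE[d - 1] ≤
      ∑ T ∈ 𝒯.neighbors σ, g * C * ∫ x in cell T, ‖w T x‖ ^ 2 := by
    intro σ hσ
    have ho := 𝒯.owner_spec hσ
    refine le_trans ?_ (Finset.single_le_sum (f := fun T => g * C * ∫ x in cell T, ‖w T x‖ ^ 2)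
      (fun T _ => mul_nonneg (by positivity) (integral_nonneg fun _ => sq_nonneg _))
      (𝒯.owner_mem_neighbors hσ))
    obtain ⟨p, hp, he⟩ := 𝒯.exists_erase_eq ho.1 hσ ho.2
    obtain ⟨x₀, ρ, hρ, hball, hD⟩ := hreg.exists_ball ho.1
    have hs := 𝒯.isSimplex ho.1
    have hwo := (hw _ ho.1).continuous
    have h1 := h _ hs p hp _ ((hw _ ho.1).polyLE_inner (𝒯.sideNormal σ))
    rw [← he] at h1
    have h2 := hs.two_mul_le_height hd hp hρ hball
    have h3 : Metric.diam (cell σ) ≤ g * height (𝒯.owner σ) p :=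
      ((IsSimplex.diam_side_le σ ho.2).trans hD).trans
        (mul_le_mul_of_nonneg_left (by linarith) hg0.le)
    have h4 : ∫ x in cell (𝒯.owner σ), inner ℝ (𝒯.sideNormal σ) (w (𝒯.owner σ) x) ^ 2 ≤
        ∫ x in cell (𝒯.owner σ), ‖w (𝒯.owner σ) x‖ ^ 2 := by
      refine setIntegral_mono (IsSimplex.integrableOn_cell (by fun_prop) _)
        (IsSimplex.integrableOn_cell (by fun_prop) _) fun x => ?_
      have := abs_real_inner_le_norm (𝒯.sideNormal σ) (w (𝒯.owner σ) x)
      rw [𝒯.norm_sideNormal hd hσ, one_mul] at this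
      exact sq_le_sq.2 (by rwa [abs_norm])
    have h5 : 0 ≤ ∫ x in cell σ, 𝒯.flux w σ x ^ 2 ∂μHE[d - 1] := integral_nonneg fun _ => sq_nonneg _
    calc _ ≤ g * height (𝒯.owner σ) p * ∫ x in cell σ, 𝒯.flux w σ x ^ 2 ∂μHE[d - 1] :=
          mul_le_mul_of_nonneg_right h3 h5
      _ = g * (height (𝒯.owner σ) p * ∫ x in cell σ, 𝒯.flux w σ x ^ 2 ∂μHE[d - 1]) := by ring
      _ ≤ g * (C * ∫ x in cell (𝒯.owner σ), ‖w (𝒯.owner σ) x‖ ^ 2) :=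
          mul_le_mul_of_nonneg_left (h1.trans (mul_le_mul_of_nonneg_left h4 hC.le)) hg0.le
      _ = _ := by ring
  refine (Finset.sum_le_sum key).trans ?_
  rw [← 𝒯.sum_elements_sides hd fun T _ => g * C * ∫ x in cell T, ‖w T x‖ ^ 2, cellSq,
    Finset.mul_sum]
  refine Finset.sum_le_sum fun T hT => ?_
  rw [Finset.sum_const, (𝒯.isSimplex hT).card_eq, nsmul_eq_mul]
  push_cast
  exact le_of_eq (by ring)

end Triangulation

end DarcyRT

/-! ### Collapsing an element onto a side; explicit test fields. -/

namespace DarcyRT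

variable {d : ℕ}

/-- A vertex of the side of `T` opposite to `p`. -/
noncomputable def sideVertex (T : Finset (Euc d)) (p : Euc d) : Euc d :=
  Classical.epsilon fun z => z ∈ T.erase p

/-- The affine projection of `T` onto the side opposite to `p` that moves `p` to a vertex of the
side. -/
noncomputable def collapse (T : Finset (Euc d)) (p x : Euc d) : Euc d :=
  x + bary T p x • (sideVertex T p - p)

theorem IsSimplex.sideVertex_mem {T : Finset (Euc d)} (hT : IsSimplex T) (hd : 2 ≤ d) (p : Euc d) :
    sideVertex T p ∈ T.erase p := by
  obtain ⟨q, hq, hqp⟩ := hT.exists_mem_ne hd p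
  exact Classical.epsilon_spec (p := fun z => z ∈ T.erase p) ⟨q, Finset.mem_erase.2 ⟨hqp, hq⟩⟩

theorem PolyLE.comp_collapse {m : ℕ} {f : Euc d → ℝ} (hf : PolyLE m f) (T : Finset (Euc d))
    (p : Euc d) : PolyLE m fun x => f (collapse T p x) := by
  refine hf.comp fun i => ?_
  simp only [collapse, PiLp.add_apply, PiLp.smul_apply, smul_eq_mul]
  refine (PolyLE.coord i).add ?_
  simpa only [mul_comm] using (polyLE_bary T p).const_mul ((sideVertex T p - p) i)

theorem continuous_collapse (T : Finset (Euc d)) (p : Euc d) : Continuous (collapse T p) := by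
  have := continuous_bary T p
  unfold collapse
  fun_prop

theorem collapse_of_bary_eq_zero {T : Finset (Euc d)} {p x : Euc d} (h : bary T p x = 0) :
    collapse T p x = x := by
  rw [collapse, h, zero_smul, add_zero]

/-- On the side opposite to `p`, a field `∑ c_q (q - x)` has normal component `-h c_p`. -/
theorem IsSimplex.inner_outwardNormal_sum {T : Finset (Euc d)} (hT : IsSimplex T) (hd : 2 ≤ d)
    {p : Euc d} (hp : p ∈ T) (c : Euc d → ℝ) {x : Euc d} (hx : bary T p x = 0) :
    inner ℝ (outwardNormal T (T.erase p)) (∑ q ∈ T, c q • (q - x)) = -(height T p * c p) := by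
  rw [inner_sum, Finset.sum_eq_single_of_mem p hp]
  · rw [inner_smul_right, hT.inner_outwardNormal_sub hd hp, hx, hT.bary_self hp]; ring
  · intro q hq hqp
    rw [inner_smul_right, hT.inner_outwardNormal_sub hd hp, hx, hT.bary_of_ne hq hqp.symm]; ring

namespace Triangulation

variable {Ω : Set (Euc d)} (𝒯 : Triangulation Ω)

/-! ### Lifting the jumps -/

/-- The broken Raviart–Thomas field whose normal component on every side is minus the jump of `u`
divided by the diameter of the side. -/
noncomputable def jumpLift (u : Finset (Euc d) → Euc d → ℝ) (T : Finset (Euc d)) (x : Euc d) :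
    Euc d :=
  ∑ p ∈ T, (𝒯.sideSign (T.erase p) T / (Metric.diam (cell (T.erase p)) * height T p) *
    𝒯.sjump u (T.erase p) (collapse T p x)) • (p - x)

variable {𝒯}

theorem BrokenPoly.sjump {ℓ : ℕ} {u : Finset (Euc d) → Euc d → ℝ} (hu : 𝒯.BrokenPoly ℓ u)
    (σ : Finset (Euc d)) : PolyLE ℓ (𝒯.sjump u σ) :=
  PolyLE.sum _ fun T hT => (hu T (𝒯.mem_neighbors.1 hT).1).const_mul _

theorem brokenRT_jumpLift {ℓ : ℕ} {u : Finset (Euc d) → Euc d → ℝ} (hu : 𝒯.BrokenPoly ℓ u) :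
    𝒯.BrokenRT ℓ (𝒯.jumpLift u) := fun T _ =>
  RTField.sum _ fun p _ =>
    RTField.radial (((hu.sjump (T.erase p)).comp_collapse T p).const_mul _) p

/-- Only the summand of the vertex opposite to `σ` has a normal component on `σ`; it brings a factor
`height` that cancels the one in the coefficient. The sign makes the outward fluxes of two
neighbours opposite. -/
theorem inner_jumpLift (hd : 2 ≤ d) (u : Finset (Euc d) → Euc d → ℝ) {σ T : Finset (Euc d)}
    (hσ : σ ∈ 𝒯.sides) (hT : T ∈ 𝒯.neighbors σ) {x : Euc d} (hx : x ∈ cell σ) :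
    inner ℝ (outwardNormal T σ) (𝒯.jumpLift u T x) =
      -(𝒯.sideSign σ T * (1 / Metric.diam (cell σ) * 𝒯.sjump u σ x)) := by
  rw [mem_neighbors] at hT
  obtain ⟨p, hp, rfl⟩ := 𝒯.exists_erase_eq hT.1 hσ hT.2
  have hs := 𝒯.isSimplex hT.1
  have hx0 := ((hs.mem_side_iff hp).1 hx).2
  have hh := (hs.height_pos hd hp).ne'
  have hD := (𝒯.diam_side_pos hd hσ).ne'
  rw [jumpLift, hs.inner_outwardNormal_sum hd hp
    (fun p => 𝒯.sideSign (T.erase p) T / (Metric.diam (cell (T.erase p)) * height T p) *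
      𝒯.sjump u (T.erase p) (collapse T p x)) hx0, collapse_of_bary_eq_zero hx0]
  field_simp

theorem flux_jumpLift (hd : 2 ≤ d) (u : Finset (Euc d) → Euc d → ℝ) {σ : Finset (Euc d)}
    (hσ : σ ∈ 𝒯.sides) {x : Euc d} (hx : x ∈ cell σ) :
    𝒯.flux (𝒯.jumpLift u) σ x = -(1 / Metric.diam (cell σ) * 𝒯.sjump u σ x) := by
  rw [flux, sideNormal, inner_jumpLift hd u hσ (𝒯.owner_mem_neighbors hσ) hx,
    𝒯.sideSign_owner hd hσ, one_mul]

theorem fluxJump_jumpLift (hd : 2 ≤ d) (u : Finset (Euc d) → Euc d → ℝ) {σ T : Finset (Euc d)}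
    (hσ : σ ∈ 𝒯.sides) (hT : T ∈ 𝒯.neighbors σ) (hTo : T ≠ 𝒯.owner σ) {x : Euc d}
    (hx : x ∈ cell σ) : 𝒯.fluxJump (𝒯.jumpLift u) σ x = 0 := by
  rw [fluxJump, Finset.sum_congr rfl fun T hT => inner_jumpLift hd u hσ hT hx]
  rcases 𝒯.neighbors_eq hd hσ (𝒯.owner_mem_neighbors hσ) with h1 | ⟨T', hT', h2⟩
  · rw [h1, Finset.mem_singleton] at hT
    exact absurd hT hTo
  · rw [h2, Finset.sum_pair hT'.symm, 𝒯.sideSign_owner hd hσ,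
      𝒯.sideSign_of_ne hd hσ (by rw [h2]; simp) hT']
    ring

theorem fluxSq_jumpLift (hd : 2 ≤ d) (u : Finset (Euc d) → Euc d → ℝ) :
    𝒯.fluxSq (𝒯.jumpLift u) = 𝒯.jumpSq u := by
  unfold fluxSq jumpSq
  refine Finset.sum_congr rfl fun σ hσ => ?_
  have hD := 𝒯.diam_side_pos hd hσ
  rw [setIntegral_congr_fun (IsSimplex.measurableSet_cell _)
    (g := fun x => (1 / Metric.diam (cell σ)) ^ 2 * 𝒯.sjump u σ x ^ 2)
    fun x hx => by simp only [flux_jumpLift hd u hσ hx, neg_sq, mul_pow], integral_const_mul]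
  field_simp

theorem sideInner_jumpLift (hd : 2 ≤ d) (u : Finset (Euc d) → Euc d → ℝ) :
    𝒯.sideInner (𝒯.jumpLift u) u = -𝒯.jumpSq u := by
  unfold sideInner jumpSq
  rw [← Finset.sum_neg_distrib]
  refine Finset.sum_congr rfl fun σ hσ => ?_
  rw [setIntegral_congr_fun (IsSimplex.measurableSet_cell _)
    (g := fun x => -(1 / Metric.diam (cell σ)) * 𝒯.sjump u σ x ^ 2)
    fun x hx => by simp only [flux_jumpLift hd u hσ hx]; ring, integral_const_mul]
  ring

theorem card_neighbors_le (hd : 2 ≤ d) {σ : Finset (Euc d)} (hσ : σ ∈ 𝒯.sides) :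
    (𝒯.neighbors σ).card ≤ 2 := by
  rcases 𝒯.neighbors_eq hd hσ (𝒯.owner_mem_neighbors hσ) with h | ⟨T, -, h⟩
  · simp [h]
  · rw [h]; exact Finset.card_le_two

/-- Undoing the collapse costs a factor `h`, so with `D = diam T` and `δ = diam σ` the coefficient
becomes `(D / (δ h))² h = (D² / (δ h)) (1 / δ)`. Here `1 / δ` is the weight in the norm, and `D² /
(δ h)` is bounded because `δ` and `h` are at least the inradius. -/
theorem exists_cellSq_jumpLift_le (hd : 2 ≤ d) (ℓ : ℕ) (γ : ℝ) : ∃ C : ℝ, 0 < C ∧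
    ∀ {Ω : Set (Euc d)} (𝒯 : Triangulation Ω), 𝒯.ShapeRegular γ →
      ∀ u, 𝒯.BrokenPoly ℓ u → 𝒯.cellSq (𝒯.jumpLift u) ≤ C * 𝒯.jumpSq u := by
  set g : ℝ := |γ| + 1 with hg
  have hg0 : 0 < g := by positivity
  -- Two elements per side, `d + 1` summands in the square of a sum, and `g ^ 2` from shape
  -- regularity.
  refine ⟨2 * ((d + 1) * g ^ 2), by positivity, fun 𝒯 hreg u hu => ?_⟩
  set X : Finset (Euc d) → ℝ := fun σ =>
    1 / Metric.diam (cell σ) * ∫ x in cell σ, 𝒯.sjump u σ x ^ 2 ∂μHE[d - 1] with hX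
  have hX0 : ∀ σ, 0 ≤ X σ := fun σ => mul_nonneg (one_div_nonneg.2 Metric.diam_nonneg)
    (integral_nonneg fun _ => sq_nonneg _)
  have key : ∀ T ∈ 𝒯.elements, ∫ x in cell T, ‖𝒯.jumpLift u T x‖ ^ 2 ≤
      ∑ p ∈ T, ((d + 1) * g ^ 2) * X (T.erase p) := by
    intro T hT
    obtain ⟨x₀, ρ, hρ, hball, hD⟩ := hreg.exists_ball hT
    have hs := 𝒯.isSimplex hT
    have hlc := (brokenRT_jumpLift hu T hT).continuous
    set D := Metric.diam (cell T) with hDdef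
    have hD0 : 0 ≤ D := Metric.diam_nonneg
    have hJc : ∀ p, Continuous fun x => 𝒯.sjump u (T.erase p) (collapse T p x) ^ 2 := fun p =>
      ((𝒯.continuous_sjump hu (T.erase p)).comp (continuous_collapse T p)).pow 2
    have hpt : ∀ x ∈ cell T, ‖𝒯.jumpLift u T x‖ ^ 2 ≤ ∑ p ∈ T, (d + 1) *
        ((D / (Metric.diam (cell (T.erase p)) * height T p)) ^ 2 *
          𝒯.sjump u (T.erase p) (collapse T p x) ^ 2) := by
      intro x hx
      have h1 : ‖𝒯.jumpLift u T x‖ ≤ ∑ p ∈ T, D / (Metric.diam (cell (T.erase p)) * height T p) *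
          |𝒯.sjump u (T.erase p) (collapse T p x)| := by
        refine (norm_sum_le _ _).trans (Finset.sum_le_sum fun p hp => ?_)
        have hσ := 𝒯.erase_mem_sides hd hT hp
        have hsg := 𝒯.sideSign_sq hd hσ (𝒯.mem_neighbors.2 ⟨hT, Finset.erase_subset _ _⟩)
        have hsg' : |𝒯.sideSign (T.erase p) T| = 1 := by
          rw [← sq_eq_sq₀ (abs_nonneg _) zero_le_one, sq_abs, hsg, one_pow]
        have hpos : 0 < Metric.diam (cell (T.erase p)) * height T p :=
          mul_pos (𝒯.diam_side_pos hd hσ) (hs.height_pos hd hp)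
        have hpx : ‖p - x‖ ≤ D := by
          rw [← dist_eq_norm]
          exact Metric.dist_le_diam_of_mem (IsSimplex.isBounded_cell T)
            (subset_convexHull ℝ _ hp) hx
        rw [norm_smul, Real.norm_eq_abs, abs_mul, abs_div, hsg', abs_of_pos hpos]
        calc _ ≤ 1 / (Metric.diam (cell (T.erase p)) * height T p) *
              |𝒯.sjump u (T.erase p) (collapse T p x)| * D :=
              mul_le_mul_of_nonneg_left hpx (by positivity)
          _ = _ := by ring
      have h2 := pow_le_pow_left₀ (norm_nonneg _) h1 2
      refine h2.trans ((sq_sum_le_card_mul_sum_sq).trans ?_)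
      rw [hs.card_eq, Finset.mul_sum]
      refine Finset.sum_le_sum fun p _ => ?_
      rw [mul_pow, sq_abs]
      push_cast
      exact le_rfl
    calc ∫ x in cell T, ‖𝒯.jumpLift u T x‖ ^ 2
        ≤ ∫ x in cell T, ∑ p ∈ T, (d + 1) *
          ((D / (Metric.diam (cell (T.erase p)) * height T p)) ^ 2 *
            𝒯.sjump u (T.erase p) (collapse T p x) ^ 2) :=
          setIntegral_mono_on (IsSimplex.integrableOn_cell (by fun_prop) T)
            (IsSimplex.integrableOn_cell (continuous_finsetSum _ fun p _ =>
              continuous_const.mul (continuous_const.mul (hJc p))) T)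
            (IsSimplex.measurableSet_cell _) hpt
      _ = ∑ p ∈ T, (d + 1) * ((D / (Metric.diam (cell (T.erase p)) * height T p)) ^ 2 *
            ∫ x in cell T, 𝒯.sjump u (T.erase p) (collapse T p x) ^ 2) := by
          have hint : ∀ p, IntegrableOn (fun x => ((d : ℝ) + 1) *
              ((D / (Metric.diam (cell (T.erase p)) * height T p)) ^ 2 *
                𝒯.sjump u (T.erase p) (collapse T p x) ^ 2)) (cell T) := fun p =>
            IsSimplex.integrableOn_cell
              (continuous_const.mul (continuous_const.mul (hJc p))) T
          rw [integral_finsetSum _ fun p _ => hint p]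
          simp only [integral_const_mul]
      _ ≤ _ := by
          refine Finset.sum_le_sum fun p hp => ?_
          have hσ := 𝒯.erase_mem_sides hd hT hp
          have hδ := 𝒯.diam_side_pos hd hσ
          have hh := hs.height_pos hd hp
          have hc := hs.integral_comp_collapse_le hd hp (hs.sideVertex_mem hd p)
            (g := fun x => 𝒯.sjump u (T.erase p) x ^ 2)
            ((𝒯.continuous_sjump hu (T.erase p)).pow 2) fun _ => sq_nonneg _
          have h1 := hs.two_mul_le_height hd hp hρ hball
          have h2 := hs.two_mul_le_diam_side hd hp hρ hball
          have hI : 0 ≤ ∫ y in cell (T.erase p), 𝒯.sjump u (T.erase p) y ^ 2 ∂μHE[d - 1] :=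
            integral_nonneg fun _ => sq_nonneg _
          set δ := Metric.diam (cell (T.erase p))
          set h := height T p
          have h3 : D ^ 2 / (δ * h) ≤ g ^ 2 := by
            rw [div_le_iff₀ (by positivity)]
            calc D ^ 2 ≤ (g * ρ) ^ 2 := pow_le_pow_left₀ hD0 hD 2
              _ = g ^ 2 * (ρ * ρ) := by ring
              _ ≤ g ^ 2 * (δ * h) := by
                refine mul_le_mul_of_nonneg_left ?_ (by positivity)
                exact mul_le_mul (by linarith) (by linarith) hρ.le hδ.le
          calc _ ≤ (d + 1) * ((D / (δ * h)) ^ 2 * (h *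
                ∫ y in cell (T.erase p), 𝒯.sjump u (T.erase p) y ^ 2 ∂μHE[d - 1])) := by
                refine mul_le_mul_of_nonneg_left ?_ (by positivity)
                exact mul_le_mul_of_nonneg_left hc (by positivity)
            _ = (d + 1) * (D ^ 2 / (δ * h)) * X (T.erase p) := by
                have hXp : X (T.erase p) =
                    1 / δ * ∫ y in cell (T.erase p), 𝒯.sjump u (T.erase p) y ^ 2 ∂μHE[d - 1] := rfl
                rw [hXp]
                field_simp
            _ ≤ _ := mul_le_mul_of_nonneg_right
                (mul_le_mul_of_nonneg_left h3 (by positivity)) (hX0 _)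
  calc 𝒯.cellSq (𝒯.jumpLift u) ≤ ∑ T ∈ 𝒯.elements, ∑ p ∈ T, ((d + 1) * g ^ 2) * X (T.erase p) :=
        Finset.sum_le_sum key
    _ = ∑ σ ∈ 𝒯.sides, ∑ T ∈ 𝒯.neighbors σ, ((d + 1) * g ^ 2) * X σ :=
        𝒯.sum_elements_sides hd fun _ σ => ((d + 1) * g ^ 2) * X σ
    _ ≤ ∑ σ ∈ 𝒯.sides, 2 * ((d + 1) * g ^ 2) * X σ := by
        refine Finset.sum_le_sum fun σ hσ => ?_
        rw [Finset.sum_const, nsmul_eq_mul, mul_assoc 2]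
        refine mul_le_mul_of_nonneg_right ?_ (mul_nonneg (by positivity) (hX0 σ))
        exact_mod_cast card_neighbors_le hd hσ
    _ = _ := by rw [← Finset.mul_sum]; rfl

/-! ### Lifting the gradient -/

/-- The broken Raviart–Thomas field without normal components that tests the broken gradient. -/
noncomputable def _root_.DarcyRT.gradLift (u : Finset (Euc d) → Euc d → ℝ) (T : Finset (Euc d))
    (x : Euc d) : Euc d :=
  (1 / Metric.diam (cell T) ^ 2) •
    bubble T (Classical.epsilon fun z => z ∈ T) (brokenGrad u T) x

theorem _root_.DarcyRT.PolyLE.inner_gradient {ℓ : ℕ} {f : Euc d → ℝ} (hf : PolyLE ℓ f)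
    (e : Euc d) : PolyLE (ℓ - 1) fun x => inner ℝ e (gradient f x) := by
  simp only [DarcyRT.inner_gradient]
  exact hf.fderiv_apply e

theorem brokenRT_gradLift {ℓ : ℕ} (hℓ : 1 ≤ ℓ) {u : Finset (Euc d) → Euc d → ℝ}
    (hu : 𝒯.BrokenPoly ℓ u) : 𝒯.BrokenRT ℓ (gradLift u) := fun T hT => by
  refine RTField.const_smul _ (RTField.sum _ fun p _ => RTField.radial ?_ p)
  -- The degree `1 + (ℓ - 1)` is at most `ℓ` precisely because `1 ≤ ℓ`.
  exact ((polyLE_bary T p).mul ((hu T hT).inner_gradient _)).mono (by omega)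

/-- The coefficient of `p - x` contains `λ_p`, which vanishes on the side where this term could have
a normal component. -/
theorem inner_gradLift (hd : 2 ≤ d) (u : Finset (Euc d) → Euc d → ℝ) {σ T : Finset (Euc d)}
    (hσ : σ ∈ 𝒯.sides) (hT : T ∈ 𝒯.neighbors σ) {x : Euc d} (hx : x ∈ cell σ) :
    inner ℝ (outwardNormal T σ) (gradLift u T x) = 0 := by
  rw [mem_neighbors] at hT
  obtain ⟨p, hp, rfl⟩ := 𝒯.exists_erase_eq hT.1 hσ hT.2
  have hs := 𝒯.isSimplex hT.1
  have hx0 := ((hs.mem_side_iff hp).1 hx).2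
  rw [gradLift, inner_smul_right, bubble, hs.inner_outwardNormal_sum hd hp (fun p => bary T p x *
    inner ℝ (p - Classical.epsilon fun z => z ∈ T) (brokenGrad u T x)) hx0, hx0]
  simp

theorem fluxJump_gradLift (hd : 2 ≤ d) (u : Finset (Euc d) → Euc d → ℝ) {σ : Finset (Euc d)}
    (hσ : σ ∈ 𝒯.sides) {x : Euc d} (hx : x ∈ cell σ) : 𝒯.fluxJump (gradLift u) σ x = 0 :=
  Finset.sum_eq_zero fun _ hT => inner_gradLift hd u hσ hT hx

theorem flux_gradLift (hd : 2 ≤ d) (u : Finset (Euc d) → Euc d → ℝ) {σ : Finset (Euc d)}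
    (hσ : σ ∈ 𝒯.sides) {x : Euc d} (hx : x ∈ cell σ) : 𝒯.flux (gradLift u) σ x = 0 :=
  inner_gradLift hd u hσ (𝒯.owner_mem_neighbors hσ) hx

theorem fluxSq_gradLift (hd : 2 ≤ d) (u : Finset (Euc d) → Euc d → ℝ) :
    𝒯.fluxSq (gradLift u) = 0 := by
  refine Finset.sum_eq_zero fun σ hσ => ?_
  rw [setIntegral_congr_fun (IsSimplex.measurableSet_cell _) (g := fun _ => (0 : ℝ))
    fun x hx => by simp [flux_gradLift hd u hσ hx]]
  simp

theorem sideInner_gradLift (hd : 2 ≤ d) (u : Finset (Euc d) → Euc d → ℝ) :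
    𝒯.sideInner (gradLift u) u = 0 := by
  refine Finset.sum_eq_zero fun σ hσ => ?_
  rw [setIntegral_congr_fun (IsSimplex.measurableSet_cell _) (g := fun _ => (0 : ℝ))
    fun x hx => by simp [flux_gradLift hd u hσ hx]]
  simp

theorem diam_cell_pos (hd : 2 ≤ d) {T : Finset (Euc d)} (hT : T ∈ 𝒯.elements) :
    0 < Metric.diam (cell T) := by
  obtain ⟨p, hp⟩ := Finset.card_pos.1 (show 0 < T.card by
    rw [(𝒯.mem_elements.1 hT).2]; omega)
  exact (𝒯.diam_side_pos hd (𝒯.erase_mem_sides hd hT hp)).trans_le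
    (IsSimplex.diam_side_le _ (Finset.erase_subset _ _))

theorem cellSq_gradLift_le (hd : 2 ≤ d) {ℓ : ℕ} (hℓ : 1 ≤ ℓ) {u : Finset (Euc d) → Euc d → ℝ}
    (hu : 𝒯.BrokenPoly ℓ u) : 𝒯.cellSq (gradLift u) ≤ 𝒯.cellSq (brokenGrad u) := by
  refine Finset.sum_le_sum fun T hT => ?_
  have h1 := (brokenRT_gradLift hℓ hu T hT).continuous
  have h2 := hu.cont_grad T hT
  have hs := 𝒯.isSimplex hT
  have hD := 𝒯.diam_cell_pos hd hT
  refine setIntegral_mono_on (IsSimplex.integrableOn_cell (by fun_prop) T)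
    (IsSimplex.integrableOn_cell (by fun_prop) T) (IsSimplex.measurableSet_cell _) fun x hx => ?_
  refine pow_le_pow_left₀ (norm_nonneg _) ?_ 2
  have hz : (Classical.epsilon fun z => z ∈ T) ∈ T :=
    Classical.epsilon_spec (p := fun z => z ∈ T)
      (Finset.card_pos.1 (show 0 < T.card by rw [hs.card_eq]; omega))
  rw [gradLift, norm_smul, Real.norm_eq_abs, abs_of_pos (by positivity), one_div,
    inv_mul_le_iff₀ (by positivity)]
  exact hs.norm_bubble_le hz _ hx

theorem exists_cellInner_gradLift_ge (hd : 2 ≤ d) (ℓ : ℕ) (γ : ℝ) : ∃ c : ℝ, 0 < c ∧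
    ∀ {Ω : Set (Euc d)} (𝒯 : Triangulation Ω), 𝒯.ShapeRegular γ →
      ∀ u, 𝒯.BrokenPoly ℓ u →
        c * 𝒯.cellSq (brokenGrad u) ≤ 𝒯.cellInner (gradLift u) (brokenGrad u) := by
  obtain ⟨c, hc, h⟩ := IsSimplex.exists_bubble_coercive d (ℓ - 1) hd
  set g : ℝ := |γ| + 1 with hg
  have hg0 : 0 < g := by positivity
  -- Coercivity of the bubble carries `ρ ^ 2` and the scaling of `gradLift` divides by the squared
  -- diameter; shape regularity bounds the quotient below by `1 / g ^ 2`.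
  refine ⟨c / g ^ 2, by positivity, fun 𝒯 hreg u hu => ?_⟩
  unfold cellSq cellInner
  rw [Finset.mul_sum]
  refine Finset.sum_le_sum fun T hT => ?_
  obtain ⟨x₀, ρ, hρ, hball, hD⟩ := hreg.exists_ball hT
  have hD0 := 𝒯.diam_cell_pos hd hT
  have h1 := h T (𝒯.isSimplex hT) (Classical.epsilon fun z => z ∈ T) x₀ ρ hρ hball
    (brokenGrad u T) (fun e => (hu T hT).inner_gradient e) (hu.cont_grad T hT)
  simp only [gradLift, real_inner_smul_left]
  rw [integral_const_mul]
  have hI : 0 ≤ ∫ x in cell T, ‖brokenGrad u T x‖ ^ 2 := integral_nonneg fun _ => sq_nonneg _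
  have h2 : 1 / g ^ 2 ≤ ρ ^ 2 / Metric.diam (cell T) ^ 2 := by
    rw [div_le_div_iff₀ (by positivity) (by positivity), one_mul]
    calc _ ≤ (g * ρ) ^ 2 := pow_le_pow_left₀ hD0.le hD 2
      _ = _ := by ring
  calc c / g ^ 2 * ∫ x in cell T, ‖brokenGrad u T x‖ ^ 2
      = 1 / g ^ 2 * (c * ∫ x in cell T, ‖brokenGrad u T x‖ ^ 2) := by ring
    _ ≤ ρ ^ 2 / Metric.diam (cell T) ^ 2 * (c * ∫ x in cell T, ‖brokenGrad u T x‖ ^ 2) :=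
        mul_le_mul_of_nonneg_right h2 (by positivity)
    _ = 1 / Metric.diam (cell T) ^ 2 * (c * ρ ^ 2 * ∫ x in cell T, ‖brokenGrad u T x‖ ^ 2) := by
        ring
    _ ≤ _ := mul_le_mul_of_nonneg_left h1 (by positivity)

/-- The inf-sup condition in terms of broken functions. -/
theorem exists_infsup_field (hd : 2 ≤ d) {ℓ : ℕ} (hℓ : 1 ≤ ℓ) (γ : ℝ) : ∃ C : ℝ, 0 < C ∧
    ∀ {Ω : Set (Euc d)} (𝒯 : Triangulation Ω), 𝒯.ShapeRegular γ → ∀ u, 𝒯.BrokenPoly ℓ u →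
      ∃ w, 𝒯.BrokenRT ℓ w ∧
        (∀ σ ∈ 𝒯.sides, ∀ T ∈ 𝒯.neighbors σ, T ≠ 𝒯.owner σ →
          ∀ x ∈ cell σ, 𝒯.fluxJump w σ x = 0) ∧
        1 / 2 * (𝒯.cellSq (brokenGrad u) + 𝒯.jumpSq u) ≤ 𝒯.bBroken w u ∧
        𝒯.cellSq w + 𝒯.fluxSq w ≤ C * (𝒯.cellSq (brokenGrad u) + 𝒯.jumpSq u) := by
  obtain ⟨C₁, hC₁, h₁⟩ := exists_cellSq_jumpLift_le hd ℓ γ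
  obtain ⟨c, hc, h₂⟩ := exists_cellInner_gradLift_ge hd ℓ γ
  -- After multiplication by the coercivity constant `c`, the part `C₁ / 2` absorbs the cross term
  -- and `1 / 2` survives.
  set M : ℝ := (C₁ / 2 + 1 / 2) / c with hM
  refine ⟨2 * C₁ + 2 * M ^ 2 + 2, by positivity, fun 𝒯 hreg u hu => ?_⟩
  have e₁ := h₁ 𝒯 hreg u hu
  have e₂ := h₂ 𝒯 hreg u hu
  have hJ := brokenRT_jumpLift hu
  have hG := brokenRT_gradLift hℓ hu
  have hg0 := 𝒯.cellSq_nonneg (brokenGrad u)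
  have hj0 := 𝒯.jumpSq_nonneg u
  refine ⟨fun T x => 𝒯.jumpLift u T x + M • gradLift u T x, hJ.add_smul hG M,
    fun σ hσ T hT hTo x hx => ?_, ?_, ?_⟩
  · rw [fluxJump_add_smul, fluxJump_jumpLift hd u hσ hT hTo hx, fluxJump_gradLift hd u hσ hx]
    ring
  · rw [bBroken_add_smul hd hJ hG hu, bBroken_eq, bBroken_eq, sideInner_jumpLift hd,
      sideInner_gradLift hd]
    have h4 := abs_cellInner_le hJ.cont hu.cont_grad
    -- Young's inequality, weighted so that half of the jump term remains.
    have h5 : √(𝒯.cellSq (𝒯.jumpLift u)) * √(𝒯.cellSq (brokenGrad u)) ≤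
        𝒯.jumpSq u / 2 + C₁ / 2 * 𝒯.cellSq (brokenGrad u) := by
      rw [← Real.sqrt_mul (𝒯.cellSq_nonneg _)]
      refine Real.sqrt_le_iff.2 ⟨by positivity, ?_⟩
      nlinarith [mul_le_mul_of_nonneg_right e₁ hg0,
        sq_nonneg (𝒯.jumpSq u / 2 - C₁ / 2 * 𝒯.cellSq (brokenGrad u))]
    have h6 : (C₁ / 2 + 1 / 2) * 𝒯.cellSq (brokenGrad u) ≤
        M * 𝒯.cellInner (gradLift u) (brokenGrad u) := by
      calc _ = M * (c * 𝒯.cellSq (brokenGrad u)) := by rw [hM]; field_simp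
        _ ≤ _ := mul_le_mul_of_nonneg_left e₂ (by positivity)
    have h7 := neg_abs_le (𝒯.cellInner (𝒯.jumpLift u) (brokenGrad u))
    linarith
  · have h3 := cellSq_add_smul_le hJ.cont hG.cont M
    have h4 := fluxSq_add_smul_le hd hJ hG M
    rw [fluxSq_jumpLift hd, fluxSq_gradLift hd] at h4
    have h5 := mul_le_mul_of_nonneg_left (cellSq_gradLift_le hd hℓ hu)
      (show 0 ≤ 2 * M ^ 2 by positivity)
    have h6 : 0 ≤ (2 * C₁ + 2) * 𝒯.cellSq (brokenGrad u) := by positivity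
    have h7 : 0 ≤ 2 * M ^ 2 * 𝒯.jumpSq u := by positivity
    linarith

end Triangulation

end DarcyRT

namespace DarcyRT

variable {d : ℕ}

/-! ### The coefficient -/

/-- The operator `w ↦ M⁻¹ w` on the Euclidean space. -/
noncomputable def invCLM (M : Matrix (Fin d) (Fin d) ℝ) : Euc d →L[ℝ] Euc d :=
  LinearMap.toContinuousLinearMap (Matrix.toEuclideanLin M⁻¹)

theorem continuousOn_invCLM {K : Euc d → Matrix (Fin d) (Fin d) ℝ} {s : Set (Euc d)}
    (hK : ContinuousOn K s) (hpos : ∀ x ∈ s, (K x).PosDef) :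
    ContinuousOn (fun x => invCLM (K x)) s := by
  let L : Matrix (Fin d) (Fin d) ℝ →ₗ[ℝ] (Euc d →L[ℝ] Euc d) :=
    (Matrix.toEuclideanLin.trans LinearMap.toContinuousLinearMap).toLinearMap
  have hL : Continuous L := L.continuous_of_finiteDimensional
  refine hL.comp_continuousOn (f := fun x => (K x)⁻¹) fun x hx => ?_
  refine ContinuousAt.comp_continuousWithinAt (g := fun M : Matrix (Fin d) (Fin d) ℝ => M⁻¹)
    (continuousAt_matrix_inv _ ?_) (hK x hx)
  simp only [Ring.inverse_eq_inv']
  exact continuousAt_inv₀ (hpos x hx).det_pos.ne'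

theorem inner_invCLM_pos {M : Matrix (Fin d) (Fin d) ℝ} (hM : M.PosDef) {e : Euc d} (he : e ≠ 0) :
    0 < inner ℝ (invCLM M e) e := by
  have h := hM.inv.dotProduct_mulVec_pos (x := WithLp.ofLp e) (by simpa using he)
  have h2 : inner ℝ (invCLM M e) e = star (WithLp.ofLp e) ⬝ᵥ (M⁻¹).mulVec (WithLp.ofLp e) := by
    simp [invCLM, PiLp.inner_apply, dotProduct, Matrix.ofLp_toLpLin]
  rwa [h2]

/-- The form `⟨K⁻¹e, e⟩` is continuous and positive on the compact product of `s` and the unit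
sphere, hence bounded away from zero; homogeneity gives all `e`. -/
theorem exists_bounds_invCLM {K : Euc d → Matrix (Fin d) (Fin d) ℝ} {s : Set (Euc d)}
    (hs : IsCompact s) (hK : ContinuousOn K s) (hpos : ∀ x ∈ s, (K x).PosDef) :
    ∃ α β : ℝ, 0 < α ∧ 0 < β ∧ (∀ x ∈ s, ∀ e, α * ‖e‖ ^ 2 ≤ inner ℝ (invCLM (K x) e) e) ∧
      ∀ x ∈ s, ∀ e, ‖invCLM (K x) e‖ ≤ β * ‖e‖ := by
  have hc := continuousOn_invCLM hK hpos
  obtain ⟨β, hβ⟩ := hs.exists_bound_of_continuousOn hc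
  obtain ⟨α, hα, h⟩ := (hs.prod (isCompact_sphere (0 : Euc d) 1)).exists_forall_le'
    (f := fun y : Euc d × Euc d => inner ℝ (invCLM (K y.1) y.2) y.2) (a := (0 : ℝ))
    (ContinuousOn.inner ((hc.comp continuousOn_fst fun y hy => hy.1).clm_apply continuousOn_snd)
      continuousOn_snd)
    fun y hy => inner_invCLM_pos (hpos _ hy.1) (by
      rintro h0
      have := hy.2
      simp [h0] at this)
  refine ⟨α, |β| + 1, hα, by positivity, fun x hx e => ?_, fun x hx e => ?_⟩
  · rcases eq_or_ne e 0 with rfl | he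
    · simp
    have he' := norm_pos_iff.2 he
    have h1 := h (x, ‖e‖⁻¹ • e) ⟨hx, by simp [norm_smul, he]⟩
    simp only [map_smul, real_inner_smul_left, real_inner_smul_right] at h1
    calc α * ‖e‖ ^ 2 ≤ ‖e‖⁻¹ * (‖e‖⁻¹ * inner ℝ (invCLM (K x) e) e) * ‖e‖ ^ 2 :=
          mul_le_mul_of_nonneg_right h1 (by positivity)
      _ = _ := by field_simp
  · refine ((invCLM (K x)).le_opNorm e).trans (mul_le_mul_of_nonneg_right ?_ (norm_nonneg _))
    linarith [hβ x hx, le_abs_self β]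

/-- Good test functions yield quotients only for `A > 0`. For `A = 0` the upper bound makes all
quotients zero, and it suffices that one exists. -/
theorem _root_.exists_isLUB_of_abs_le {s : Set ℝ} (hs : s.Nonempty) {c C A : ℝ} (hA : 0 ≤ A)
    (hub : ∀ t ∈ s, |t| ≤ C * A) (hlb : 0 < A → ∃ t ∈ s, c * A ≤ t) :
    ∃ S, IsLUB s S ∧ c * A ≤ S ∧ S ≤ C * A := by
  have hb : C * A ∈ upperBounds s := fun t ht => (le_abs_self t).trans (hub t ht)
  have hS := isLUB_csSup hs ⟨_, hb⟩
  refine ⟨_, hS, ?_, hS.2 hb⟩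
  rcases hA.eq_or_lt with rfl | hA
  · obtain ⟨t, ht⟩ := hs
    have h1 := hub t ht
    rw [mul_zero] at h1 ⊢
    rw [abs_nonpos_iff.1 h1] at ht
    exact hS.1 ht
  · obtain ⟨t, ht, h⟩ := hlb hA
    exact h.trans (hS.1 ht)

/-! ### The form `a` on broken fields, and the two estimates. -/

namespace Triangulation

variable {Ω : Set (Euc d)} (𝒯 : Triangulation Ω)

/-- The form `a` on broken fields. -/
noncomputable def aBroken (A : Euc d → Euc d →L[ℝ] Euc d)
    (w w' : Finset (Euc d) → Euc d → Euc d) : ℝ :=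
  ∑ T ∈ 𝒯.elements, ∫ x in cell T, inner ℝ (A x (w T x)) (w' T x)

variable {𝒯}

theorem continuousOn_inner_apply {A : Euc d → Euc d →L[ℝ] Euc d} (hA : ContinuousOn A (closure Ω))
    {T : Finset (Euc d)} (hT : T ∈ 𝒯.elements) {f g : Euc d → Euc d} (hf : Continuous f)
    (hg : Continuous g) : ContinuousOn (fun x => inner ℝ (A x (f x)) (g x)) (cell T) :=
  ContinuousOn.inner ((hA.mono (𝒯.cell_subset hT)).clm_apply hf.continuousOn) hg.continuousOn

theorem integrableOn_inner_apply {A : Euc d → Euc d →L[ℝ] Euc d} (hA : ContinuousOn A (closure Ω))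
    {T : Finset (Euc d)} (hT : T ∈ 𝒯.elements) {f g : Euc d → Euc d} (hf : Continuous f)
    (hg : Continuous g) : IntegrableOn (fun x => inner ℝ (A x (f x)) (g x)) (cell T) :=
  (continuousOn_inner_apply hA hT hf hg).integrableOn_compact (IsSimplex.isCompact_cell T)

theorem aForm_eq (hΩ : IsPolyhedralDomain Ω) {K : Euc d → Matrix (Fin d) (Fin d) ℝ}
    (hA : ContinuousOn (fun x => invCLM (K x)) (closure Ω)) {v v' : Euc d → Euc d}
    {w w' : Finset (Euc d) → Euc d → Euc d} (hw : 𝒯.BrokenCont w) (hw' : 𝒯.BrokenCont w')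
    (hvw : 𝒯.Rep v w) (hvw' : 𝒯.Rep v' w') :
    aForm Ω K v v' = 𝒯.aBroken (fun x => invCLM (K x)) w w' :=
  -- The two fields are treated as one broken function with values in pairs.
  𝒯.integral_domain_rep hΩ (v := fun x => (v x, v' x)) (w := fun T x => (w T x, w' T x))
    (fun T hT x hx => by simp only [hvw T hT x hx, hvw' T hT x hx])
    (fun x y => inner ℝ (invCLM (K x) y.1) y.2)
    fun _ hT => continuousOn_inner_apply hA hT (hw _ hT) (hw' _ hT)

theorem aBroken_add_smul {A : Euc d → Euc d →L[ℝ] Euc d} (hA : ContinuousOn A (closure Ω))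
    {w w₁ w₂ : Finset (Euc d) → Euc d → Euc d} (hw : 𝒯.BrokenCont w) (h₁ : 𝒯.BrokenCont w₁)
    (h₂ : 𝒯.BrokenCont w₂) (c : ℝ) :
    𝒯.aBroken A w (fun T x => w₁ T x + c • w₂ T x) = 𝒯.aBroken A w w₁ + c * 𝒯.aBroken A w w₂ := by
  unfold aBroken
  rw [Finset.mul_sum, ← Finset.sum_add_distrib]
  refine Finset.sum_congr rfl fun T hT => ?_
  rw [← integral_const_mul, ← integral_add (integrableOn_inner_apply hA hT (hw T hT) (h₁ T hT))
    ((integrableOn_inner_apply hA hT (hw T hT) (h₂ T hT)).const_mul c)]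
  simp only [inner_add_right, real_inner_smul_right]

theorem le_aBroken_self {A : Euc d → Euc d →L[ℝ] Euc d} (hA : ContinuousOn A (closure Ω)) {α : ℝ}
    (hα : ∀ x ∈ closure Ω, ∀ e, α * ‖e‖ ^ 2 ≤ inner ℝ (A x e) e)
    {w : Finset (Euc d) → Euc d → Euc d} (hw : 𝒯.BrokenCont w) :
    α * 𝒯.cellSq w ≤ 𝒯.aBroken A w w := by
  unfold aBroken cellSq
  rw [Finset.mul_sum]
  refine Finset.sum_le_sum fun T hT => ?_
  have h := hw T hT
  rw [← integral_const_mul]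
  exact setIntegral_mono_on (IsSimplex.integrableOn_cell (by fun_prop) T)
    (integrableOn_inner_apply hA hT h h) (IsSimplex.measurableSet_cell _)
    fun x hx => hα x (𝒯.cell_subset hT hx) _

theorem abs_aBroken_le {A : Euc d → Euc d →L[ℝ] Euc d} (hA : ContinuousOn A (closure Ω)) {β : ℝ}
    (hβ0 : 0 ≤ β) (hβ : ∀ x ∈ closure Ω, ∀ e, ‖A x e‖ ≤ β * ‖e‖)
    {w w' : Finset (Euc d) → Euc d → Euc d} (hw : 𝒯.BrokenCont w) (hw' : 𝒯.BrokenCont w') :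
    |𝒯.aBroken A w w'| ≤ β * √(𝒯.cellSq w) * √(𝒯.cellSq w') := by
  have h : |𝒯.aBroken A w w'| ≤ √(β ^ 2 * 𝒯.cellSq w) * √(𝒯.cellSq w') := by
    refine abs_le_sqrt_mul_sqrt_of_quadratic (mul_nonneg (sq_nonneg _) (𝒯.cellSq_nonneg w))
      fun t => ?_
    unfold aBroken cellSq
    rw [Finset.mul_sum, Finset.sum_mul, Finset.mul_sum, Finset.sum_mul, ← Finset.sum_add_distrib,
      ← Finset.sum_add_distrib]
    refine Finset.sum_nonneg fun T hT => ?_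
    have h1 := hw T hT
    have h2 := hw' T hT
    have h3 := ((integrableOn_inner_apply hA hT h1 h2).const_mul 2).mul_const t
    have h4 : IntegrableOn (fun x => β ^ 2 * ‖w T x‖ ^ 2 * (t * t)) (cell T) :=
      IsSimplex.integrableOn_cell (by fun_prop) T
    have h34 : Integrable (fun x => β ^ 2 * ‖w T x‖ ^ 2 * (t * t) +
        2 * inner ℝ (A x (w T x)) (w' T x) * t) (volume.restrict (cell T)) := h4.add h3
    rw [← integral_const_mul, ← integral_mul_const, ← integral_const_mul, ← integral_mul_const,
      ← integral_add h4 h3, ← integral_add h34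
        (IsSimplex.integrableOn_cell (by fun_prop) T)]
    refine setIntegral_nonneg (IsSimplex.measurableSet_cell _) fun x hx => ?_
    have h5 := pow_le_pow_left₀ (norm_nonneg _) (hβ x (𝒯.cell_subset hT hx) (w T x)) 2
    have h6 : 0 ≤ ‖t • A x (w T x) + w' T x‖ ^ 2 := by positivity
    rw [norm_add_sq_real, norm_smul, mul_pow, Real.norm_eq_abs, sq_abs, real_inner_smul_left] at h6
    rw [mul_pow] at h5
    have h7 := mul_le_mul_of_nonneg_left h5 (sq_nonneg t)
    linarith
  rwa [Real.sqrt_mul (sq_nonneg _), Real.sqrt_sq hβ0] at h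

/-! ### Nontriviality -/

/-- A constant unit field serves; it guarantees that the suprema are over nonempty sets. -/
theorem exists_mem_V_normL2_pos (hΩ : IsPolyhedralDomain Ω) (hd : 2 ≤ d) (𝒯 : Triangulation Ω)
    (ℓ : ℕ) : ∃ v ∈ 𝒯.V ℓ, 0 < 𝒯.normL2 v := by
  obtain ⟨e, he⟩ : ∃ e : Euc d, ‖e‖ = 1 := by
    have : Nonempty (Fin d) := ⟨⟨0, by omega⟩⟩
    exact exists_norm_eq _ zero_le_one
  have hw : 𝒯.BrokenRT ℓ fun _ _ => e := fun _ _ => RTField.const e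
  refine ⟨𝒯.glue fun _ _ => e, 𝒯.glue_mem_V hΩ hd hw fun σ hσ T hT hTo => ?_, ?_⟩
  · refine Filter.Eventually.of_forall fun x => ?_
    rcases 𝒯.neighbors_eq hd hσ hT with h | ⟨T₂, hne, h⟩
    · have := 𝒯.owner_mem_neighbors hσ
      rw [h, Finset.mem_singleton] at this
      exact absurd this.symm hTo
    · have hT₂ : T₂ ∈ 𝒯.neighbors σ := by rw [h]; simp
      rw [fluxJump, h, Finset.sum_pair hne.symm, 𝒯.outwardNormal_eq_neg hd hσ hT hT₂ hne.symm,
        inner_neg_left, add_neg_cancel]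
  · rw [𝒯.normL2_eq hw (𝒯.rep_glue _)]
    refine Real.sqrt_pos.2 (add_pos_of_pos_of_nonneg ?_ (𝒯.fluxSq_nonneg _))
    refine Finset.sum_pos (fun T hT => ?_) (𝒯.elements_nonempty hΩ)
    simp only [he, one_pow, integral_const, smul_eq_mul, mul_one, measureReal_restrict_apply_univ]
    refine ENNReal.toReal_pos ?_ (IsSimplex.isCompact_cell T).measure_lt_top.ne
    exact ((isOpen_interior.measure_pos volume (𝒯.isSimplex hT).interior_nonempty).trans_le
      (measure_mono _root_.interior_subset)).ne'

/-! ### The inf-sup condition -/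

theorem normL2_nonneg (v : Euc d → Euc d) : 0 ≤ 𝒯.normL2 v := Real.sqrt_nonneg _

theorem normH1_nonneg (q : Euc d → ℝ) : 0 ≤ 𝒯.normH1 q := Real.sqrt_nonneg _

theorem abs_bForm_le (hΩ : IsPolyhedralDomain Ω) (hd : 2 ≤ d) {ℓ : ℕ} {v : Euc d → Euc d}
    (hv : v ∈ 𝒯.V ℓ) {q : Euc d → ℝ} (hq : q ∈ 𝒯.Q ℓ) :
    |bForm Ω v q| ≤ 𝒯.normL2 v * 𝒯.normH1 q := by
  obtain ⟨w, hw, hvw⟩ := 𝒯.exists_rep_of_mem_V hv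
  obtain ⟨u, hu, hqu⟩ := 𝒯.exists_rep_of_mem_Q hq
  rw [𝒯.bForm_eq hΩ hd hw hvw hv.1 hu hqu, 𝒯.normL2_eq hw hvw, 𝒯.normH1_eq hd hu hqu]
  exact abs_bBroken_le hd hw hu

theorem normL2_sq {ℓ : ℕ} {v : Euc d → Euc d} {w : Finset (Euc d) → Euc d → Euc d}
    (hw : 𝒯.BrokenRT ℓ w) (hvw : 𝒯.Rep v w) : 𝒯.normL2 v ^ 2 = 𝒯.cellSq w + 𝒯.fluxSq w := by
  rw [𝒯.normL2_eq hw hvw, Real.sq_sqrt (add_nonneg (𝒯.cellSq_nonneg w) (𝒯.fluxSq_nonneg w))]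

theorem normH1_sq (hd : 2 ≤ d) {ℓ : ℕ} {q : Euc d → ℝ} {u : Finset (Euc d) → Euc d → ℝ}
    (hu : 𝒯.BrokenPoly ℓ u) (hqu : 𝒯.Rep q u) :
    𝒯.normH1 q ^ 2 = 𝒯.cellSq (brokenGrad u) + 𝒯.jumpSq u := by
  rw [𝒯.normH1_eq hd hu hqu, Real.sq_sqrt (add_nonneg (𝒯.cellSq_nonneg _) (𝒯.jumpSq_nonneg u))]

theorem exists_infsup (hΩ : IsPolyhedralDomain Ω) (hd : 2 ≤ d) {ℓ : ℕ} (hℓ : 1 ≤ ℓ) (γ : ℝ) :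
    ∃ C : ℝ, 0 < C ∧ ∀ 𝒯 : Triangulation Ω, 𝒯.ShapeRegular γ → ∀ q ∈ 𝒯.Q ℓ, ∃ v ∈ 𝒯.V ℓ,
      1 / 2 * 𝒯.normH1 q ^ 2 ≤ bForm Ω v q ∧ 𝒯.normL2 v ≤ C * 𝒯.normH1 q := by
  obtain ⟨C, hC, h⟩ := exists_infsup_field hd hℓ γ
  refine ⟨√C, Real.sqrt_pos.2 hC, fun 𝒯 hreg q hq => ?_⟩
  obtain ⟨u, hu, hqu⟩ := 𝒯.exists_rep_of_mem_Q hq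
  obtain ⟨w, hw, hflux, hb, hn⟩ := h 𝒯 hreg u hu
  have hv : 𝒯.glue w ∈ 𝒯.V ℓ := 𝒯.glue_mem_V hΩ hd hw fun σ hσ T hT hTo =>
    (ae_restrict_iff' (IsSimplex.measurableSet_cell _)).2
      (Filter.Eventually.of_forall (hflux σ hσ T hT hTo))
  refine ⟨_, hv, ?_, ?_⟩
  · rwa [𝒯.bForm_eq hΩ hd hw (𝒯.rep_glue w) hv.1 hu hqu, normH1_sq hd hu hqu]
  · rw [𝒯.normL2_eq hw (𝒯.rep_glue w), 𝒯.normH1_eq hd hu hqu, ← Real.sqrt_mul hC.le]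
    exact Real.sqrt_le_sqrt hn

/-! ### The stability estimate -/

/-- This turns `L²` coercivity of `a` into coercivity in the mesh-dependent norm on the whole
discrete space. -/
theorem exists_normL2_sq_le (hd : 2 ≤ d) (ℓ : ℕ) (γ : ℝ) : ∃ C : ℝ, 0 < C ∧
    ∀ {Ω : Set (Euc d)} (𝒯 : Triangulation Ω), 𝒯.ShapeRegular γ → ∀ {v w}, 𝒯.BrokenRT ℓ w →
      𝒯.Rep v w → 𝒯.normL2 v ^ 2 ≤ C * 𝒯.cellSq w := by
  obtain ⟨C, hC, h⟩ := exists_fluxSq_le hd ℓ γ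
  refine ⟨1 + C, by positivity, fun 𝒯 hreg v w hw hvw => ?_⟩
  rw [normL2_sq hw hvw]
  linarith [h 𝒯 hreg w hw]

theorem abs_aForm_le (hΩ : IsPolyhedralDomain Ω) {K : Euc d → Matrix (Fin d) (Fin d) ℝ}
    (hA : ContinuousOn (fun x => invCLM (K x)) (closure Ω)) {β : ℝ} (hβ0 : 0 ≤ β)
    (hβ : ∀ x ∈ closure Ω, ∀ e, ‖invCLM (K x) e‖ ≤ β * ‖e‖) {ℓ : ℕ} {v v' : Euc d → Euc d}
    (hv : v ∈ 𝒯.V ℓ) (hv' : v' ∈ 𝒯.V ℓ) :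
    |aForm Ω K v v'| ≤ β * 𝒯.normL2 v * 𝒯.normL2 v' := by
  obtain ⟨w, hw, hvw⟩ := 𝒯.exists_rep_of_mem_V hv
  obtain ⟨w', hw', hvw'⟩ := 𝒯.exists_rep_of_mem_V hv'
  rw [aForm_eq hΩ hA hw.cont hw'.cont hvw hvw', 𝒯.normL2_eq hw hvw, 𝒯.normL2_eq hw' hvw']
  refine (abs_aBroken_le hA hβ0 hβ hw.cont hw'.cont).trans ?_
  have h1 := 𝒯.fluxSq_nonneg w
  have h2 := 𝒯.fluxSq_nonneg w'
  gcongr <;> linarith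

/-- The combination of two members of the finite element space, up to values outside the interiors
of the elements. -/
theorem exists_add_smul (hΩ : IsPolyhedralDomain Ω) (hd : 2 ≤ d) {ℓ : ℕ} {v v' : Euc d → Euc d}
    (hv : v ∈ 𝒯.V ℓ) (hv' : v' ∈ 𝒯.V ℓ) {K : Euc d → Matrix (Fin d) (Fin d) ℝ}
    (hA : ContinuousOn (fun x => invCLM (K x)) (closure Ω)) (c : ℝ) :
    ∃ z ∈ 𝒯.V ℓ, aForm Ω K v z = aForm Ω K v v + c * aForm Ω K v v' ∧
      (∀ q ∈ 𝒯.Q ℓ, bForm Ω z q = bForm Ω v q + c * bForm Ω v' q) ∧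
      𝒯.normL2 z ^ 2 ≤ 2 * 𝒯.normL2 v ^ 2 + 2 * c ^ 2 * 𝒯.normL2 v' ^ 2 := by
  obtain ⟨w, hw, hvw⟩ := 𝒯.exists_rep_of_mem_V hv
  obtain ⟨w', hw', hvw'⟩ := 𝒯.exists_rep_of_mem_V hv'
  have hz := hw.add_smul hw' c
  have hzV : 𝒯.glue (fun T x => w T x + c • w' T x) ∈ 𝒯.V ℓ := by
    refine 𝒯.glue_mem_V hΩ hd hz fun σ hσ T hT hTo => ?_
    filter_upwards [𝒯.fluxJump_ae_eq_zero hΩ hd hw hvw hv.1 hσ hT hTo,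
      𝒯.fluxJump_ae_eq_zero hΩ hd hw' hvw' hv'.1 hσ hT hTo] with x h1 h2
    rw [fluxJump_add_smul, h1, h2, mul_zero, add_zero]
  refine ⟨_, hzV, ?_, fun q hq => ?_, ?_⟩
  · rw [aForm_eq hΩ hA hw.cont hz.cont hvw (𝒯.rep_glue _), aForm_eq hΩ hA hw.cont hw.cont hvw hvw,
      aForm_eq hΩ hA hw.cont hw'.cont hvw hvw', aBroken_add_smul hA hw.cont hw.cont hw'.cont]
  · obtain ⟨u, hu, hqu⟩ := 𝒯.exists_rep_of_mem_Q hq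
    rw [𝒯.bForm_eq hΩ hd hz (𝒯.rep_glue _) hzV.1 hu hqu, 𝒯.bForm_eq hΩ hd hw hvw hv.1 hu hqu,
      𝒯.bForm_eq hΩ hd hw' hvw' hv'.1 hu hqu, bBroken_add_smul hd hw hw' hu]
  · rw [normL2_sq hz (𝒯.rep_glue _), normL2_sq hw hvw, normL2_sq hw' hvw']
    linarith [cellSq_add_smul_le hw.cont hw'.cont c, fluxSq_add_smul_le hd hw hw' c]

theorem neg_mem_Q {ℓ : ℕ} {q : Euc d → ℝ} (hq : q ∈ 𝒯.Q ℓ) : -q ∈ 𝒯.Q ℓ := fun T hT => by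
  obtain ⟨p, hp, h⟩ := hq T hT
  exact ⟨-p, by rwa [MvPolynomial.totalDegree_neg], fun x hx => by simp [h x hx]⟩

theorem normH1_neg (hd : 2 ≤ d) {ℓ : ℕ} {q : Euc d → ℝ} (hq : q ∈ 𝒯.Q ℓ) :
    𝒯.normH1 (-q) = 𝒯.normH1 q := by
  obtain ⟨u, hu, hqu⟩ := 𝒯.exists_rep_of_mem_Q hq
  have hu' : 𝒯.BrokenPoly ℓ fun T x => -u T x := fun T hT => (hu T hT).neg
  have hqu' : 𝒯.Rep (-q) fun T x => -u T x := fun T hT x hx => by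
    rw [Pi.neg_apply, hqu T hT x hx]
  rw [𝒯.normH1_eq hd hu hqu, 𝒯.normH1_eq hd hu' hqu']
  have h1 : ∀ T x, brokenGrad (fun T x => -u T x) T x = -brokenGrad u T x := fun T x => by
    simp only [brokenGrad, gradient]
    rw [show (fun x => -u T x) = -u T from rfl, fderiv_neg, map_neg]
  have h2 : ∀ σ x, 𝒯.sjump (fun T x => -u T x) σ x = -𝒯.sjump u σ x := fun σ x => by
    simp only [sjump, mul_neg, Finset.sum_neg_distrib]
  simp only [cellSq, jumpSq, h1, h2, norm_neg, neg_sq]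

theorem _root_.DarcyRT.bForm_neg_right (v : Euc d → Euc d) (q : Euc d → ℝ) :
    bForm Ω v (-q) = -bForm Ω v q := by
  simp only [bForm, Pi.neg_apply, mul_neg, integral_neg]

theorem abs_BForm_le (hΩ : IsPolyhedralDomain Ω) (hd : 2 ≤ d)
    {K : Euc d → Matrix (Fin d) (Fin d) ℝ}
    (hA : ContinuousOn (fun x => invCLM (K x)) (closure Ω)) {β : ℝ} (hβ0 : 0 ≤ β)
    (hβ : ∀ x ∈ closure Ω, ∀ e, ‖invCLM (K x) e‖ ≤ β * ‖e‖) {ℓ : ℕ} {v w : Euc d → Euc d}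
    (hv : v ∈ 𝒯.V ℓ) (hw : w ∈ 𝒯.V ℓ) {q r : Euc d → ℝ} (hq : q ∈ 𝒯.Q ℓ) (hr : r ∈ 𝒯.Q ℓ) :
    |BForm Ω K v q w r| ≤
      (β + 1) * (𝒯.normL2 v + 𝒯.normH1 q) * (𝒯.normL2 w + 𝒯.normH1 r) := by
  have h1 := abs_aForm_le hΩ hA hβ0 hβ hv hw
  have h2 := abs_bForm_le hΩ hd hw hq
  have h3 := abs_bForm_le hΩ hd hv hr
  have hX := 𝒯.normL2_nonneg v
  have hY := 𝒯.normL2_nonneg w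
  have hN := 𝒯.normH1_nonneg q
  have hR := 𝒯.normH1_nonneg r
  refine (abs_add_three _ _ _).trans ((add_le_add_three h1 h2 h3).trans (sub_nonneg.1 ?_))
  have : 0 ≤ β * (𝒯.normL2 v * 𝒯.normH1 r + 𝒯.normH1 q * 𝒯.normL2 w + 𝒯.normH1 q * 𝒯.normH1 r) +
      𝒯.normL2 v * 𝒯.normL2 w + 𝒯.normH1 q * 𝒯.normH1 r := by positivity
  linarith

/-- The test pair is `(v + δ v', -q)`, with `v'` the inf-sup field of `q`. The terms `±b(v,q)`
cancel, and `a(v,v) + δ a(v,v') + δ b(v',q)` remains. -/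
theorem exists_stability (hΩ : IsPolyhedralDomain Ω) (hd : 2 ≤ d) {ℓ : ℕ} (hℓ : 1 ≤ ℓ) (γ : ℝ)
    {K : Euc d → Matrix (Fin d) (Fin d) ℝ}
    (hA : ContinuousOn (fun x => invCLM (K x)) (closure Ω)) {α β : ℝ} (hα0 : 0 < α) (hβ0 : 0 < β)
    (hα : ∀ x ∈ closure Ω, ∀ e, α * ‖e‖ ^ 2 ≤ inner ℝ (invCLM (K x) e) e)
    (hβ : ∀ x ∈ closure Ω, ∀ e, ‖invCLM (K x) e‖ ≤ β * ‖e‖) :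
    ∃ m M : ℝ, 0 < m ∧ 0 < M ∧ ∀ 𝒯 : Triangulation Ω, 𝒯.ShapeRegular γ → ∀ v ∈ 𝒯.V ℓ, ∀ q ∈ 𝒯.Q ℓ,
      ∃ w ∈ 𝒯.V ℓ, ∃ r ∈ 𝒯.Q ℓ,
        m * (𝒯.normL2 v + 𝒯.normH1 q) ^ 2 ≤ BForm Ω K v q w r ∧
        𝒯.normL2 w + 𝒯.normH1 r ≤ M * (𝒯.normL2 v + 𝒯.normH1 q) := by
  obtain ⟨C, hC, hinf⟩ := exists_infsup hΩ hd hℓ γ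
  obtain ⟨D, hD, htr⟩ := exists_normL2_sq_le hd ℓ γ
  set a := α / D with ha
  have ha0 : 0 < a := by positivity
  -- Tuned so that `a / 2 = δ (β²C² + 1)`: then `(a/2)X² + (δ/4)N² - δβCXN` is `δ` times a sum of
  -- two squares.
  set δ := a / (2 * (β ^ 2 * C ^ 2 + 1)) with hδ
  have hδ0 : 0 < δ := by positivity
  have hδa : δ * (2 * (β ^ 2 * C ^ 2 + 1)) = a := by rw [hδ]; field_simp
  set m := min (a / 2) (δ / 4) with hm
  have hm0 : 0 < m := by positivity
  -- The half comes from `(X + N)² ≤ 2(X² + N²)`. In the second constant `2(1 + δC)` accounts for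
  -- the field and 1 for `-q`.
  refine ⟨m / 2, 2 * (1 + δ * C) + 1, by positivity, by positivity, fun 𝒯 hreg v hv q hq => ?_⟩
  obtain ⟨v', hv', hb, hn⟩ := hinf 𝒯 hreg q hq
  obtain ⟨z, hz, hza, hzb, hzn⟩ := exists_add_smul hΩ hd hv hv' hA δ
  have hX := 𝒯.normL2_nonneg v
  have hY := 𝒯.normL2_nonneg v'
  have hN := 𝒯.normH1_nonneg q
  refine ⟨z, hz, -q, neg_mem_Q hq, ?_, ?_⟩
  · obtain ⟨w, hw, hvw⟩ := 𝒯.exists_rep_of_mem_V hv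
    have h1 : a * 𝒯.normL2 v ^ 2 ≤ aForm Ω K v v := by
      rw [aForm_eq hΩ hA hw.cont hw.cont hvw hvw]
      refine le_trans ?_ (le_aBroken_self hA hα hw.cont)
      calc a * 𝒯.normL2 v ^ 2 ≤ a * (D * 𝒯.cellSq w) :=
            mul_le_mul_of_nonneg_left (htr 𝒯 hreg hw hvw) ha0.le
        _ = _ := by rw [ha]; field_simp
    have h2 : -(β * C * 𝒯.normL2 v * 𝒯.normH1 q) ≤ aForm Ω K v v' := by
      have h := abs_aForm_le hΩ hA hβ0.le hβ hv hv'
      have h' : β * 𝒯.normL2 v * 𝒯.normL2 v' ≤ β * 𝒯.normL2 v * (C * 𝒯.normH1 q) :=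
        mul_le_mul_of_nonneg_left hn (by positivity)
      linarith [neg_abs_le (aForm Ω K v v')]
    have h3 : BForm Ω K v q z (-q) = aForm Ω K v v + δ * aForm Ω K v v' + δ * bForm Ω v' q := by
      rw [BForm, hza, hzb q hq, bForm_neg_right]
      ring
    set X := 𝒯.normL2 v
    set N := 𝒯.normH1 q
    have h4 : δ * (β * C * X * N) ≤ a / 2 * X ^ 2 + δ / 4 * N ^ 2 := by
      have : a / 2 * X ^ 2 + δ / 4 * N ^ 2 - δ * (β * C * X * N) =
          δ * ((β * C * X - N / 2) ^ 2 + X ^ 2) := by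
        rw [← hδa]
        ring
      have h5 : 0 ≤ δ * ((β * C * X - N / 2) ^ 2 + X ^ 2) := by positivity
      linarith
    have h5 := mul_le_mul_of_nonneg_left h2 hδ0.le
    have h6 := mul_le_mul_of_nonneg_left hb hδ0.le
    have h7 : m * X ^ 2 ≤ a / 2 * X ^ 2 :=
      mul_le_mul_of_nonneg_right (min_le_left _ _) (sq_nonneg _)
    have h8 : m * N ^ 2 ≤ δ / 4 * N ^ 2 :=
      mul_le_mul_of_nonneg_right (min_le_right _ _) (sq_nonneg _)
    have h9 : 0 ≤ m / 2 * (X - N) ^ 2 := by positivity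
    rw [h3]
    linarith
  · rw [normH1_neg hd hq]
    have h1 : 𝒯.normL2 z ≤ 2 * (𝒯.normL2 v + δ * 𝒯.normL2 v') := by
      refine le_of_sq_le_sq (hzn.trans (sub_nonneg.1 ?_)) (by positivity)
      have : 0 ≤ 2 * 𝒯.normL2 v ^ 2 + 2 * δ ^ 2 * 𝒯.normL2 v' ^ 2 +
          8 * δ * 𝒯.normL2 v * 𝒯.normL2 v' := by positivity
      linarith
    have h2 := mul_le_mul_of_nonneg_left hn hδ0.le
    have h3 : 0 ≤ 2 * (δ * C) * 𝒯.normL2 v + 2 * 𝒯.normH1 q + 𝒯.normL2 v := by positivity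
    linarith

end Triangulation

end DarcyRT

/-! ### From the test functions to the suprema. -/

theorem mainTheorem4 {d : ℕ} (hd : d = 2 ∨ d = 3) (Ω : Set (Euc d)) (hΩ : IsPolyhedralDomain Ω)
    (ℓ : ℕ) (hℓ : 1 ≤ ℓ) (γ : ℝ) :
    -- the inf-sup condition for `b`
    (∃ c C : ℝ, 0 < c ∧ 0 < C ∧
      ∀ 𝒯 : Triangulation Ω, 𝒯.ShapeRegular γ → ∀ q ∈ 𝒯.Q ℓ,
        ∃ S : ℝ,
          IsLUB {t : ℝ | ∃ v ∈ 𝒯.V ℓ, 0 < 𝒯.normL2 v ∧ t = bForm Ω v q / 𝒯.normL2 v} S ∧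
          c * 𝒯.normH1 q ≤ S ∧ S ≤ C * 𝒯.normH1 q) ∧
    -- the stability estimate for `B`
    (∀ K : Euc d → Matrix (Fin d) (Fin d) ℝ, ContinuousOn K (closure Ω) →
      (∀ x ∈ closure Ω, (K x).PosDef) →
      ∃ c C : ℝ, 0 < c ∧ 0 < C ∧
        ∀ 𝒯 : Triangulation Ω, 𝒯.ShapeRegular γ → ∀ v ∈ 𝒯.V ℓ, ∀ q ∈ 𝒯.Q ℓ,
          ∃ S : ℝ,
            IsLUB {t : ℝ | ∃ w ∈ 𝒯.V ℓ, ∃ r ∈ 𝒯.Q ℓ, 0 < 𝒯.normL2 w + 𝒯.normH1 r ∧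
              t = BForm Ω K v q w r / (𝒯.normL2 w + 𝒯.normH1 r)} S ∧
            c * (𝒯.normL2 v + 𝒯.normH1 q) ≤ S ∧ S ≤ C * (𝒯.normL2 v + 𝒯.normH1 q)) := by
  have hd2 : 2 ≤ d := by omega
  refine ⟨?_, fun K hK hpos => ?_⟩
  · obtain ⟨C, hC, hinf⟩ := Triangulation.exists_infsup hΩ hd2 hℓ γ
    refine ⟨1 / (2 * C), 1, by positivity, one_pos, fun 𝒯 hreg q hq =>
      exists_isLUB_of_abs_le ?_ (𝒯.normH1_nonneg q) ?_ fun hN => ?_⟩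
    · obtain ⟨v, hv, hpos⟩ := Triangulation.exists_mem_V_normL2_pos hΩ hd2 𝒯 ℓ
      exact ⟨_, v, hv, hpos, rfl⟩
    · rintro t ⟨v, hv, hpos, rfl⟩
      rw [abs_div, abs_of_pos hpos, div_le_iff₀ hpos, one_mul, mul_comm]
      exact Triangulation.abs_bForm_le hΩ hd2 hv hq
    · obtain ⟨v, hv, hb, hn⟩ := hinf 𝒯 hreg q hq
      have h1 := (le_abs_self _).trans (Triangulation.abs_bForm_le hΩ hd2 hv hq)
      -- The test field is nonzero because `b(v,q)` is positive and bounded by the product of the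
      -- norms.
      have hX : 0 < 𝒯.normL2 v := by
        refine pos_of_mul_pos_left (lt_of_lt_of_le ?_ (hb.trans h1)) hN.le
        positivity
      refine ⟨_, ⟨v, hv, hX, rfl⟩, ?_⟩
      rw [le_div_iff₀ hX]
      calc 1 / (2 * C) * 𝒯.normH1 q * 𝒯.normL2 v
          ≤ 1 / (2 * C) * 𝒯.normH1 q * (C * 𝒯.normH1 q) :=
            mul_le_mul_of_nonneg_left hn (by positivity)
        _ = 1 / 2 * 𝒯.normH1 q ^ 2 := by field_simp
        _ ≤ _ := hb
  · obtain ⟨P, hP⟩ := hΩ.polyhedral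
    have hcpt : IsCompact (closure Ω) := by
      rw [hP]
      exact P.isCompact_biUnion fun s _ => IsSimplex.isCompact_cell s
    obtain ⟨α, β, hα0, hβ0, hα, hβ⟩ := exists_bounds_invCLM hcpt hK hpos
    have hA := continuousOn_invCLM hK hpos
    obtain ⟨m, M, hm, hM, hst⟩ := Triangulation.exists_stability hΩ hd2 hℓ γ hA hα0 hβ0 hα hβ
    -- The lower constant is the quotient of `m A²`, the value of the form, by `M A`, the size of
    -- the test pair, divided by `A`, the norm of `(v, q)`.
    refine ⟨m / M, β + 1, by positivity, by positivity, fun 𝒯 hreg v hv q hq =>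
      exists_isLUB_of_abs_le ?_ (add_nonneg (𝒯.normL2_nonneg v) (𝒯.normH1_nonneg q)) ?_
        fun hN => ?_⟩
    · obtain ⟨w, hw, hw0⟩ := Triangulation.exists_mem_V_normL2_pos hΩ hd2 𝒯 ℓ
      exact ⟨_, w, hw, q, hq, add_pos_of_pos_of_nonneg hw0 (𝒯.normH1_nonneg q), rfl⟩
    · rintro t ⟨w, hw, r, hr, h0, rfl⟩
      rw [abs_div, abs_of_pos h0, div_le_iff₀ h0]
      exact Triangulation.abs_BForm_le hΩ hd2 hA hβ0.le hβ hv hw hq hr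
    · obtain ⟨w, hw, r, hr, hB, hn⟩ := hst 𝒯 hreg v hv q hq
      have h1 := (le_abs_self _).trans (Triangulation.abs_BForm_le hΩ hd2 hA hβ0.le hβ hv hw hq hr)
      have h2 : 0 < m * (𝒯.normL2 v + 𝒯.normH1 q) ^ 2 := by positivity
      have hX : 0 < 𝒯.normL2 w + 𝒯.normH1 r :=
        pos_of_mul_pos_right (h2.trans_le (hB.trans h1))
          (mul_nonneg (by positivity) hN.le)
      refine ⟨_, ⟨w, hw, r, hr, hX, rfl⟩, ?_⟩
      rw [le_div_iff₀ hX]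
      calc m / M * (𝒯.normL2 v + 𝒯.normH1 q) * (𝒯.normL2 w + 𝒯.normH1 r)
          ≤ m / M * (𝒯.normL2 v + 𝒯.normH1 q) * (M * (𝒯.normL2 v + 𝒯.normH1 q)) :=
            mul_le_mul_of_nonneg_left hn (by positivity)
        _ = m * (𝒯.normL2 v + 𝒯.normH1 q) ^ 2 := by field_simp
        _ ≤ _ := hB
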